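/- Consider the equations of class $\mathcal Q^+$ for $u:\mathbb Z^2\to\mathbb R$, $$\begin{aligned}\mathcal Q^+ ={}& a_1(u_{n,m}+u_{n+1,m+1})+a_2(u_{n+1,m}+u_{n,m+1})+(\alpha_1-\alpha_2)u_{n,m}u_{n+1,m}+(\alpha_1+\alpha_2)u_{n,m+1}u_{n+1,m+1}\\&+(\beta_1-\beta_2)u_{n,m}u_{n,m+1}+(\beta_1+\beta_2)u_{n+1,m}u_{n+1,m+1}+\gamma_1u_{n,m}u_{n+1,m+1}+\gamma_2u_{n+1,m}u_{n,m+1}\\&+(\xi_1-\xi_3)u_{n,m}u_{n+1,m}u_{n,m+1}+(\xi_1+\xi_3)u_{n,m}u_{n+1,m}u_{n+1,m+1}\\&+(\xi_2-\xi_4)u_{n+1,m}u_{n,m+1}u_{n+1,m+1}+(\xi_2+\xi_4)u_{n,m}u_{n,m+1}u_{n+1,m+1}\\&+\zeta u_{n,m}u_{n+1,m}u_{n,m+1}u_{n+1,m+1}=0,\end{aligned}$$ with 13 real coefficients such that $a_1\ne0$, $a_2\ne0$, $|a_1|\neq|a_2|$. For $\kappa\in\mathbb R$ let $K=e^{i\kappa}$,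 $\Omega=e^{-i\omega}$, where the real dispersion relation $\omega=\omega(\kappa)$ is a differentiable function with $a_1(1+K\Omega)+a_2(K+\Omega)=0$ for all $\kappa$ (such functions exist). Call $\kappa$ non-resonant if $a_1(1+K^2\Omega^2)+a_2(K^2+\Omega^2)\neq0$. Insert the formal multiscale expansion $$u_{n,m}=\sum_{\ell\ge1}\varepsilon^{\ell}\sum_{|\alpha|\le\ell}K^{\alpha n}\Omega^{\alpha m}u_\ell^{(\alpha)}(n_1,m_1,m_2),\qquad u_\ell^{(-\alpha)}=\overline{u_\ell^{(\alpha)}},\quad n_1=\varepsilon n,\ m_1=\varepsilon m,\ m_2=\varepsilon^2m,$$ with smooth amplitudes $u_\ell^{(\alpha)}$, whose shifts are Taylor expanded in $\varepsilon$ (further slow times $m_j=\varepsilon^jm$, $j\ge3$, do not enter up to order $\varepsilon^3$), and let $W_j^{(\alpha)}$ be the coefficient of $\varepsilon^jK^{\alpha n}\Omega^{\alpha m}$ in $\mathcal Q^+$. (A) For every non-resonant $\kappa$ the order $\varepsilon^3$ is a nonlinear Schrödinger equation: there is exactly one pair $(\rho_1,\rho_2)\in\mathbb C^2$ for which there is a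 constant $\lambda\neq0$ such that, whenever $W_1^{(\alpha)}=W_2^{(\alpha)}=0$ for all $\alpha$ and $u_2^{(1)}$ depends on $n_1,m_1$ only through $\xi=n_1-\omega'(\kappa)m_1$, then $u_1^{(1)}=\varphi(\xi,m_2)$ for some function $\varphi$ and $$W_3^{(1)}=\lambda\left(i\,\partial_{m_2}\varphi+\rho_1\,\partial_\xi^2\varphi+\rho_2\,\varphi|\varphi|^2\right).$$ Here $\rho_1=a_1a_2(a_1^2-a_2^2)\sin\kappa/(a_1^2+a_2^2+2a_1a_2\cos\kappa)^2$ is real. Moreover, if all amplitudes are bounded and $W_1^{(\alpha)}=W_2^{(\alpha)}=0$ for all $\alpha$ and $W_3^{(1)}=0$, then $u_2^{(1)}$ depends on $n_1,m_1$ only through $\xi$, and $u_1^{(1)}=\varphi(\xi,m_2)$ where $i\partial_{m_2}\varphi+\rho_1\partial_\xi^2\varphi+\rho_2\varphi|\varphi|^2=0$. (B) $\rho_2$ is real for all non-resonant $\kappa$ if and only if the coefficients satisfy at least one of the following sets of conditions. * Case 1: $\alpha_2=\beta_2=0$, $\xi_1=\xi_2$, $\xi_3=\xi_4$. * Case 2: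 $\alpha_2=\beta_2$, $\alpha_1=\beta_1$, $a_1=2a_2$, $\gamma_1=2\gamma_2$, $a_1(\xi_1-\xi_2)=-a_1(\xi_3-\xi_4)=-2\alpha_2\gamma_2$. * Case 3: $\alpha_2=-\beta_2$, $\alpha_1=\beta_1$, $a_2=2a_1$, $\gamma_2=2\gamma_1$, $a_1(\xi_1-\xi_2)=a_1(\xi_3-\xi_4)=-\alpha_2\gamma_1$. * Case 4: $a_2\alpha_1=a_2\beta_1=\tfrac12(a_1+a_2)\gamma_2$, $a_2\gamma_1=a_1\gamma_2$, $a_1(\xi_1-\xi_2)=-\alpha_2\gamma_1$, $a_1(\xi_3-\xi_4)=\beta_2\gamma_1$. * Case 5: $(a_2-a_1)\beta_2=(a_2+a_1)\alpha_2$, $2a_1a_2(a_1-a_2)\alpha_1=(a_1+a_2)(\gamma_2a_1^2-\gamma_1a_2^2)$, $2a_1a_2\beta_1=\gamma_1a_2^2+\gamma_2a_1^2$, $(a_2-a_1)(\xi_1-\xi_2)=(\gamma_1-\gamma_2)\alpha_2$, $(a_2-a_1)^2(\xi_3-\xi_4)=[\gamma_2(a_2-3a_1)-\gamma_1(a_1-3a_2)]\alpha_2$.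 * Case 6: $(a_2+a_1)\beta_2=(a_2-a_1)\alpha_2$, $2a_1a_2\alpha_1=\gamma_1a_2^2+\gamma_2a_1^2$, $2a_1a_2(a_1-a_2)\beta_1=(a_1+a_2)(\gamma_2a_1^2-\gamma_1a_2^2)$, $(a_2^2-a_1^2)(\xi_1-\xi_2)=[\gamma_1(a_1-3a_2)-\gamma_2(a_2-3a_1)]\alpha_2$, $(a_1+a_2)(\xi_3-\xi_4)=(\gamma_2-\gamma_1)\alpha_2$. (C) The six subclasses have $9,7,7,8,8,8$ free parameters, respectively: that many of the 13 coefficients range freely over a nonempty open set, and the remaining ones are smooth functions of them. (D) For real $C$ and $D\neq0$ the substitution $u\mapsto u/(Cu+D)$ at all four lattice points, followed by multiplication by the product of the four denominators $Cu+D$, maps every equation of the above form to exactly one equation of this form (with new coefficients), and each of the six subclasses (with $a_1,a_2\neq0$, $|a_1|\ne|a_2|$) is invariant: an equation belongs to it if and only if its image does. -/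

import Mathlib

noncomputable section

namespace Multiscale

/-- The names of the 13 coefficients of the multilinear equation. -/
inductive Param
  | a₁ | a₂ | α₁ | α₂ | β₁ | β₂ | γ₁ | γ₂ | ξ₁ | ξ₂ | ξ₃ | ξ₄ | ζ
  deriving DecidableEq

instance : Fintype Param :=
  ⟨{.a₁, .a₂, .α₁, .α₂, .β₁, .β₂, .γ₁, .γ₂, .ξ₁, .ξ₂, .ξ₃, .ξ₄, .ζ}, by intro x; cases x <;> decide⟩

/-- An equation of the class `Q⁺`, given by its 13 real coefficients. -/
abbrev QPlus := Param → ℝ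

/-- The left-hand side of the equation, with values in any commutative real algebra; the arguments
stand for `u_{n,m}`, `u_{n+1,m}`, `u_{n,m+1}`, `u_{n+1,m+1}`. -/
def QPlus.lhs (c : QPlus) {A : Type*} [CommRing A] [Algebra ℝ A] (u₀₀ u₁₀ u₀₁ u₁₁ : A) : A :=
  c .a₁ • (u₀₀ + u₁₁) + c .a₂ • (u₁₀ + u₀₁)
    + (c .α₁ - c .α₂) • (u₀₀ * u₁₀) + (c .α₁ + c .α₂) • (u₀₁ * u₁₁)
    + (c .β₁ - c .β₂) • (u₀₀ * u₀₁) + (c .β₁ + c .β₂) • (u₁₀ * u₁₁)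
    + c .γ₁ • (u₀₀ * u₁₁) + c .γ₂ • (u₁₀ * u₀₁)
    + (c .ξ₁ - c .ξ₃) • (u₀₀ * u₁₀ * u₀₁) + (c .ξ₁ + c .ξ₃) • (u₀₀ * u₁₀ * u₁₁)
    + (c .ξ₂ - c .ξ₄) • (u₁₀ * u₀₁ * u₁₁) + (c .ξ₂ + c .ξ₄) • (u₀₀ * u₀₁ * u₁₁)
    + c .ζ • (u₀₀ * u₁₀ * u₀₁ * u₁₁)

/-- The standing assumption on the linear part. -/
def QPlus.IsDispersive (c : QPlus) : Prop :=
  c .a₁ ≠ 0 ∧ c .a₂ ≠ 0 ∧ |c .a₁| ≠ |c .a₂|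

/-! ### Dispersion relation -/

/-- `K = e^{iκ}` -/
def bigK (κ : ℝ) : ℂ := Complex.exp (Complex.I * κ)

/-- `Ω = e^{-iω}` -/
def bigOmega (w : ℝ) : ℂ := Complex.exp (-(Complex.I * w))

/-- The value of the linear part of the equation on `z^n y^m`, divided by `z^n y^m`. -/
def QPlus.symbol (c : QPlus) (z y : ℂ) : ℂ := c .a₁ * (1 + z * y) + c .a₂ * (z + y)

/-- `ω` is a (differentiable, real) dispersion relation: for every wave number `κ` the plane wave
`e^{i(κ n - ω(κ) m)}` solves the linear part of the equation. -/
def QPlus.IsDispersionRelation (c : QPlus) (ω : ℝ → ℝ) : Prop :=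
  Differentiable ℝ ω ∧ ∀ κ, c.symbol (bigK κ) (bigOmega (ω κ)) = 0

/-- The second harmonic `e^{2i(κ n - ω m)}` does not solve the linear part, so that the second
harmonic amplitude is determined by the first one. -/
def QPlus.NonResonant (c : QPlus) (ω : ℝ → ℝ) (κ : ℝ) : Prop :=
  c.symbol (bigK κ ^ 2) (bigOmega (ω κ) ^ 2) ≠ 0

/-! ### The multiscale expansion -/

/-- Complex functions of the slow variables `n₁ = ε n`, `m₁ = ε m`, `m₂ = ε² m`. (The slow times
`m_j` with `j ≥ 3` do not enter the expansion of the equation up to order `ε³`.) -/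
abbrev Slow := ℝ → ℝ → ℝ → ℂ

def dn₁ (f : Slow) : Slow := fun n₁ m₁ m₂ => deriv (fun s => f s m₁ m₂) n₁
def dm₁ (f : Slow) : Slow := fun n₁ m₁ m₂ => deriv (fun s => f n₁ s m₂) m₁
def dm₂ (f : Slow) : Slow := fun n₁ m₁ m₂ => deriv (fun s => f n₁ m₁ s) m₂

/-- `∇ = ∂_{m₁} + ∂_{n₁}` -/
def nabla (f : Slow) : Slow := dm₁ f + dn₁ f

/-- The operators giving the coefficient of `ε^i` in the Taylor expansion of the four fields
`f(n₁, m₁, m₂)`, `f(n₁ + ε, m₁, m₂)`, `f(n₁, m₁ + ε, m₂ + ε²)`, `f(n₁ + ε, m₁ + ε, m₂ + ε²)`. -/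
def opId (i : ℕ) (f : Slow) : Slow := if i = 0 then f else 0

def opA (i : ℕ) (f : Slow) : Slow := (1 / (i.factorial : ℝ)) • dn₁^[i] f

def opB (i : ℕ) (f : Slow) : Slow :=
  ∑ q ∈ Finset.range (i / 2 + 1),
    (1 / ((i - 2 * q).factorial * q.factorial : ℝ)) • dm₁^[i - 2 * q] (dm₂^[q] f)

def opC (i : ℕ) (f : Slow) : Slow :=
  ∑ q ∈ Finset.range (i / 2 + 1),
    (1 / ((i - 2 * q).factorial * q.factorial : ℝ)) • nabla^[i - 2 * q] (dm₂^[q] f)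

/-- Amplitudes: `u ℓ α` is the amplitude `u_ℓ^{(α)}` of the `α`-th harmonic at order `ε^ℓ`;
only those with `1 ≤ ℓ` and `|α| ≤ ℓ` occur in the expansion. -/
abbrev Amplitudes := ℕ → ℤ → Slow

/-- Smooth amplitudes of a real field. -/
def Amplitudes.Admissible (u : Amplitudes) : Prop :=
  (∀ ℓ α, ContDiff ℝ ((⊤ : ℕ∞) : WithTop ℕ∞)
    (fun p : ℝ × ℝ × ℝ => u ℓ α p.1 p.2.1 p.2.2)) ∧
  ∀ ℓ α n₁ m₁ m₂, u ℓ (-α) n₁ m₁ m₂ = (starRingEnd ℂ) (u ℓ α n₁ m₁ m₂)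

def Amplitudes.Bounded (u : Amplitudes) : Prop :=
  ∀ ℓ α, ∃ M : ℝ, ∀ n₁ m₁ m₂, ‖u ℓ α n₁ m₁ m₂‖ ≤ M

/-- Formal expansions: power series in `ε` whose coefficients are Laurent polynomials in the
carrier harmonic `T = K^n Ω^m`, with functions of the slow variables as coefficients. -/
abbrev Expansion := PowerSeries (LaurentPolynomial Slow)

/-- The expansion of a (shifted) field
`∑_r ε^r ∑_{|α| ≤ r} z^α K^{αn} Ω^{αm} ∑_{max(1,|α|) ≤ j ≤ r} op_{r-j} u_j^{(α)}`,
where `z` is the phase factor and `op` the family of slow operators of the shift. -/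
def expand (z : ℂ) (op : ℕ → Slow → Slow) (u : Amplitudes) : Expansion :=
  PowerSeries.mk fun r =>
    ∑ α ∈ Finset.Icc (-(r : ℤ)) r,
      LaurentPolynomial.C
          (z ^ α • ∑ j ∈ Finset.Icc (max 1 α.natAbs) r, op (r - j) (u j α)) *
        LaurentPolynomial.T α

/-- The amplitude `W_j^{(α)}` of `ε^j K^{αn} Ω^{αm}` in the expanded equation, for the carrier
wave with wave number `κ` and frequency `w`. -/
def QPlus.W (c : QPlus) (κ w : ℝ) (u : Amplitudes) (j : ℕ) (α : ℤ) : Slow :=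
  (PowerSeries.coeff j
    (c.lhs (expand 1 opId u) (expand (bigK κ) opA u) (expand (bigOmega w) opB u)
      (expand (bigK κ * bigOmega w) opC u) : Expansion)).coeff α

/-- `f` depends on `n₁, m₁` only through `ξ = n₁ - v m₁`, with profile `φ(ξ, m₂)`. -/
def HasProfile (v : ℝ) (f : Slow) (φ : ℝ → ℝ → ℂ) : Prop :=
  ∀ n₁ m₁ m₂, f n₁ m₁ m₂ = φ (n₁ - v * m₁) m₂

/-- The nonlinear Schrödinger expression `i φ_{m₂} + ρ₁ φ_{ξξ} + ρ₂ φ |φ|²`. -/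
def nls (ρ₁ ρ₂ : ℂ) (φ : ℝ → ℝ → ℂ) (x t : ℝ) : ℂ :=
  Complex.I * deriv (fun s => φ x s) t + ρ₁ * iteratedDeriv 2 (fun y => φ y t) x
    + ρ₂ * (φ x t * ((‖φ x t‖ ^ 2 : ℝ) : ℂ))

/-- At wave number `κ` the order `ε³` of the expansion is the NLS equation with coefficients
`ρ₁, ρ₂`: once the orders `ε` and `ε²` are satisfied and `u_2^{(1)}` depends on `n₁, m₁` through
`ξ = n₁ - ω'(κ) m₁`, the amplitude `u_1^{(1)}` is a function `φ(ξ, m₂)` and `W_3^{(1)}` is the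
NLS expression in `φ`, up to a nonzero constant factor. -/
def QPlus.ReducesToNLS (c : QPlus) (ω : ℝ → ℝ) (κ : ℝ) (ρ₁ ρ₂ : ℂ) : Prop :=
  ∃ lam : ℂ, lam ≠ 0 ∧ ∀ u : Amplitudes, u.Admissible →
    (∀ α, c.W κ (ω κ) u 1 α = 0) → (∀ α, c.W κ (ω κ) u 2 α = 0) →
    (∃ ψ, HasProfile (deriv ω κ) (u 2 1) ψ) →
    ∃ φ, HasProfile (deriv ω κ) (u 1 1) φ ∧
      ∀ n₁ m₁ m₂, c.W κ (ω κ) u 3 1 n₁ m₁ m₂ = lam * nls ρ₁ ρ₂ φ (n₁ - deriv ω κ * m₁) m₂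

/-! ### The six families -/

def QPlus.Case1 (c : QPlus) : Prop :=
  c .α₂ = 0 ∧ c .β₂ = 0 ∧ c .ξ₁ = c .ξ₂ ∧ c .ξ₃ = c .ξ₄

def QPlus.Case2 (c : QPlus) : Prop :=
  c .α₂ = c .β₂ ∧ c .α₁ = c .β₁ ∧ c .a₁ = 2 * c .a₂ ∧ c .γ₁ = 2 * c .γ₂ ∧
  c .a₁ * (c .ξ₁ - c .ξ₂) = -2 * c .α₂ * c .γ₂ ∧
  -c .a₁ * (c .ξ₃ - c .ξ₄) = -2 * c .α₂ * c .γ₂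

def QPlus.Case3 (c : QPlus) : Prop :=
  c .α₂ = -c .β₂ ∧ c .α₁ = c .β₁ ∧ c .a₂ = 2 * c .a₁ ∧ c .γ₂ = 2 * c .γ₁ ∧
  c .a₁ * (c .ξ₁ - c .ξ₂) = -c .α₂ * c .γ₁ ∧
  c .a₁ * (c .ξ₃ - c .ξ₄) = -c .α₂ * c .γ₁

def QPlus.Case4 (c : QPlus) : Prop :=
  c .a₂ * c .α₁ = 1 / 2 * (c .a₁ + c .a₂) * c .γ₂ ∧
  c .a₂ * c .β₁ = 1 / 2 * (c .a₁ + c .a₂) * c .γ₂ ∧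
  c .a₂ * c .γ₁ = c .a₁ * c .γ₂ ∧
  c .a₁ * (c .ξ₁ - c .ξ₂) = -c .α₂ * c .γ₁ ∧
  c .a₁ * (c .ξ₃ - c .ξ₄) = c .β₂ * c .γ₁

def QPlus.Case5 (c : QPlus) : Prop :=
  (c .a₂ - c .a₁) * c .β₂ = (c .a₂ + c .a₁) * c .α₂ ∧
  2 * c .a₁ * c .a₂ * (c .a₁ - c .a₂) * c .α₁ =
    (c .a₁ + c .a₂) * (c .γ₂ * c .a₁ ^ 2 - c .γ₁ * c .a₂ ^ 2) ∧
  2 * c .a₁ * c .a₂ * c .β₁ = c .γ₁ * c .a₂ ^ 2 + c .γ₂ * c .a₁ ^ 2 ∧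
  (c .a₂ - c .a₁) * (c .ξ₁ - c .ξ₂) = (c .γ₁ - c .γ₂) * c .α₂ ∧
  (c .a₂ - c .a₁) ^ 2 * (c .ξ₃ - c .ξ₄) =
    (c .γ₂ * (c .a₂ - 3 * c .a₁) - c .γ₁ * (c .a₁ - 3 * c .a₂)) * c .α₂

def QPlus.Case6 (c : QPlus) : Prop :=
  (c .a₂ + c .a₁) * c .β₂ = (c .a₂ - c .a₁) * c .α₂ ∧
  2 * c .a₁ * c .a₂ * c .α₁ = c .γ₁ * c .a₂ ^ 2 + c .γ₂ * c .a₁ ^ 2 ∧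
  2 * c .a₁ * c .a₂ * (c .a₁ - c .a₂) * c .β₁ =
    (c .a₁ + c .a₂) * (c .γ₂ * c .a₁ ^ 2 - c .γ₁ * c .a₂ ^ 2) ∧
  (c .a₂ ^ 2 - c .a₁ ^ 2) * (c .ξ₁ - c .ξ₂) =
    (c .γ₁ * (c .a₁ - 3 * c .a₂) - c .γ₂ * (c .a₂ - 3 * c .a₁)) * c .α₂ ∧
  (c .a₁ + c .a₂) * (c .ξ₃ - c .ξ₄) = (c .γ₂ - c .γ₁) * c .α₂

/-- The six subclasses of dispersive equations. -/
def family : Fin 6 → Set QPlus :=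
  ![{c | c.IsDispersive ∧ c.Case1}, {c | c.IsDispersive ∧ c.Case2},
    {c | c.IsDispersive ∧ c.Case3}, {c | c.IsDispersive ∧ c.Case4},
    {c | c.IsDispersive ∧ c.Case5}, {c | c.IsDispersive ∧ c.Case6}]

/-- The numbers of free parameters of the six subclasses. -/
def numFree : Fin 6 → ℕ := ![9, 7, 7, 8, 8, 8]

/-- `S` has `N` free parameters: `N` of the 13 coefficients range freely over a nonempty open set
`U` of `ℝ^N`, and the other coefficients are smooth functions of them. -/
def HasFreeParameters (S : Set QPlus) (N : ℕ) : Prop :=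
  ∃ J : Finset Param, J.card = N ∧ ∃ U : Set (J → ℝ), IsOpen U ∧ U.Nonempty ∧
    ∃ g : (J → ℝ) → QPlus, ContDiffOn ℝ ((⊤ : ℕ∞) : WithTop ℕ∞) g U ∧
      (∀ p ∈ U, ∀ j : J, g p j = p j) ∧ S = g '' U

/-! ### Restricted Möbius transformations -/

/-- `c'` arises from `c` by the substitution `u ↦ u / (C u + D)` at all four lattice points,
after clearing denominators. -/
def IsMobiusImage (C D : ℝ) (c c' : QPlus) : Prop :=
  ∀ x y z w : ℝ, C * x + D ≠ 0 → C * y + D ≠ 0 → C * z + D ≠ 0 → C * w + D ≠ 0 →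
    c'.lhs x y z w =
      (C * x + D) * (C * y + D) * (C * z + D) * (C * w + D) *
        c.lhs (x / (C * x + D)) (y / (C * y + D)) (z / (C * z + D)) (w / (C * w + D))

end Multiscale

end

/-!
The orders `ε` and `ε²` make `u_1^{(1)}` travel with the group velocity and express the zeroth and
second harmonics through it, so that the order `ε³` closes up to an NLS equation whose nonlinear
coefficient collects the cubic terms and the feedback of these two harmonics.

Put `κ = 2 θ`, `ω = 2 φ`, and `a₁ : a₂ = (r - 1) : (r + 1)`. Multiplying by `(K Ω)^(-1/2)` removes
all common phases, the dispersion relation becomes `tan θ tan φ = r`, and `Im ρ₂` becomes a rational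
function of `tan² θ`. It vanishes for all `κ` if and only if its numerator is the zero polynomial.

A Möbius substitution changes the equation by a translation and a rescaling in suitable coordinates.
The translation part drops out of the numerator, whose vanishing is therefore a small system
bilinear in `(α₂, β₂)` and three translation-invariant coefficients. Its solutions are the six
cases, and the same coordinates show that the cases are invariant.
-/

noncomputable section

namespace Multiscale

/-! ### Amplitudes of products of formal expansions -/

section PowerSeries

open PowerSeries

variable {R : Type*} [CommSemiring R] {e f : PowerSeries R}

theorem coeff_two_mul_of_X_dvd (he : X ∣ e) (hf : X ∣ f) :
    coeff 2 (e * f) = coeff 1 e * coeff 1 f := by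
  rw [X_dvd_iff, ← coeff_zero_eq_constantCoeff_apply] at he hf
  rw [coeff_mul, Finset.Nat.sum_antidiagonal_eq_sum_range_succ_mk]
  simp only [Finset.sum_range_succ, Finset.range_zero, Finset.sum_empty, he, hf, Nat.sub_self,
    Nat.sub_zero, Nat.reduceSub, zero_mul, mul_zero, zero_add, add_zero]

theorem coeff_three_mul_of_X_dvd (he : X ∣ e) (hf : X ∣ f) :
    coeff 3 (e * f) = coeff 1 e * coeff 2 f + coeff 2 e * coeff 1 f := by
  rw [X_dvd_iff, ← coeff_zero_eq_constantCoeff_apply] at he hf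
  rw [coeff_mul, Finset.Nat.sum_antidiagonal_eq_sum_range_succ_mk]
  simp only [Finset.sum_range_succ, Finset.range_zero, Finset.sum_empty, he, hf, Nat.sub_self,
    Nat.sub_zero, Nat.reduceSub, zero_mul, mul_zero, zero_add, add_zero]

end PowerSeries

section LaurentPolynomial

open LaurentPolynomial

variable {R : Type*} [Semiring R] (s : Finset ℤ) (f : ℤ → R)

theorem coeff_sum_C_mul_T (γ : ℤ) :
    (∑ β ∈ s, C (f β) * T β).coeff γ = if γ ∈ s then f γ else 0 := by
  simp only [AddMonoidAlgebra.coeff_sum, Finsupp.finsetSum_apply, ← single_eq_C_mul_T,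
    AddMonoidAlgebra.coeff_single, Finsupp.single_apply, Finset.sum_ite_eq']

theorem coeff_sum_C_mul_T_mul (q : R[T;T⁻¹]) (γ : ℤ) :
    ((∑ β ∈ s, C (f β) * T β) * q).coeff γ = ∑ β ∈ s, f β * q.coeff (γ - β) := by
  simp only [Finset.sum_mul, AddMonoidAlgebra.coeff_sum, Finsupp.finsetSum_apply,
    ← single_eq_C_mul_T, AddMonoidAlgebra.coeff_single_mul_apply, neg_add_eq_sub]

end LaurentPolynomial

theorem sum_Icc_neg_one_one {M : Type*} [AddCommMonoid M] (f : ℤ → M) :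
    ∑ β ∈ Finset.Icc (-1) 1, f β = f (-1) + f 0 + f 1 := by
  rw [show Finset.Icc (-1 : ℤ) 1 = {-1, 0, 1} by decide, Finset.sum_insert (by decide),
    Finset.sum_insert (by decide), Finset.sum_singleton, add_assoc]

/-- The amplitude of `ε^j K^{αn} Ω^{αm}` in a formal expansion. -/
def amplitude (j : ℕ) (α : ℤ) : Expansion →ₗ[ℝ] Slow where
  toFun e := (PowerSeries.coeff j e).coeff α
  map_add' e f := by rw [map_add, AddMonoidAlgebra.coeff_add, Finsupp.add_apply]
  map_smul' _ _ := rfl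

theorem amplitude_apply (j : ℕ) (α : ℤ) (e : Expansion) :
    amplitude j α e = (PowerSeries.coeff j e).coeff α := rfl

theorem amplitude_eq_zero_of_X_pow_dvd {e : Expansion} {k j : ℕ} (he : PowerSeries.X ^ k ∣ e)
    (hj : j < k) (α : ℤ) : amplitude j α e = 0 := by
  rw [amplitude_apply, PowerSeries.X_pow_dvd_iff.mp he j hj]
  rfl

/-- A lattice shift as seen by the multiscale expansion: the phase factor it gives to the carrier
wave, and the operators `op i` by which it acts on slow functions at relative order `ε^i`. -/
structure LatticeShift where
  phase : ℂ
  op : ℕ → Slow → Slow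
  op_zero : ∀ f, op 0 f = f
  op_map_zero : ∀ i, op i 0 = 0

namespace LatticeShift

variable (s t r : LatticeShift) (u : Amplitudes)

/-- The formal expansion of the shifted field. -/
def field : Expansion := expand s.phase s.op u

theorem X_dvd_field : PowerSeries.X ∣ s.field u := by
  rw [PowerSeries.X_dvd_iff, ← PowerSeries.coeff_zero_eq_constantCoeff_apply, field, expand,
    PowerSeries.coeff_mk]
  simp

theorem amplitude_field (j : ℕ) (α : ℤ) :
    amplitude j α (s.field u) = if α.natAbs ≤ j then
      s.phase ^ α • ∑ i ∈ Finset.Icc (max 1 α.natAbs) j, s.op (j - i) (u i α) else 0 := by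
  rw [amplitude_apply, field, expand, PowerSeries.coeff_mk, coeff_sum_C_mul_T]
  exact if_congr (by rw [Finset.mem_Icc]; omega) rfl rfl

theorem coeff_coeff_field_mul (j : ℕ) (q : LaurentPolynomial Slow) (γ : ℤ) :
    (PowerSeries.coeff j (s.field u) * q).coeff γ =
      ∑ β ∈ Finset.Icc (-(j : ℤ)) j, amplitude j β (s.field u) * q.coeff (γ - β) := by
  simp only [amplitude_apply, field, expand, PowerSeries.coeff_mk, coeff_sum_C_mul_T_mul,
    coeff_sum_C_mul_T]
  exact Finset.sum_congr rfl fun β hβ => by rw [if_pos hβ]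

theorem amplitude_one_field {α : ℤ} (hα : α.natAbs ≤ 1) :
    amplitude 1 α (s.field u) = s.phase ^ α • u 1 α := by
  rw [amplitude_field, if_pos hα, max_eq_left hα]
  simp [s.op_zero]

theorem amplitude_two_field {α : ℤ} (hα : α.natAbs ≤ 1) :
    amplitude 2 α (s.field u) = s.phase ^ α • (s.op 1 (u 1 α) + u 2 α) := by
  rw [amplitude_field, if_pos (hα.trans one_le_two), max_eq_left hα,
    show Finset.Icc 1 2 = {1, 2} from rfl]
  simp [s.op_zero]

theorem amplitude_two_field_of_natAbs_eq_two {α : ℤ} (hα : α.natAbs = 2) :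
    amplitude 2 α (s.field u) = s.phase ^ α • u 2 α := by
  rw [amplitude_field, if_pos hα.le, hα]
  simp [s.op_zero]

theorem amplitude_three_one_field :
    amplitude 3 1 (s.field u) = s.phase • (s.op 2 (u 1 1) + s.op 1 (u 2 1) + u 3 1) := by
  rw [amplitude_field, if_pos (by decide),
    show Finset.Icc (max 1 (1 : ℤ).natAbs) 3 = {1, 2, 3} from rfl]
  simp [s.op_zero, add_assoc]

theorem X_sq_dvd_mul : PowerSeries.X ^ 2 ∣ s.field u * t.field u := by
  rw [sq]
  exact mul_dvd_mul (s.X_dvd_field u) (t.X_dvd_field u)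

theorem X_pow_three_dvd_mul : PowerSeries.X ^ 3 ∣ s.field u * t.field u * r.field u := by
  rw [pow_succ]
  exact mul_dvd_mul (s.X_sq_dvd_mul t u) (r.X_dvd_field u)

theorem X_pow_four_dvd_mul (q : LatticeShift) :
    PowerSeries.X ^ 4 ∣ s.field u * t.field u * r.field u * q.field u := by
  rw [pow_succ]
  exact mul_dvd_mul (s.X_pow_three_dvd_mul t r u) (q.X_dvd_field u)

theorem amplitude_two_mul (γ : ℤ) :
    amplitude 2 γ (s.field u * t.field u) =
      ∑ β ∈ Finset.Icc (-1) 1, if (γ - β).natAbs ≤ 1 then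
        (s.phase ^ β * t.phase ^ (γ - β)) • (u 1 β * u 1 (γ - β)) else 0 := by
  rw [amplitude_apply, coeff_two_mul_of_X_dvd (s.X_dvd_field u) (t.X_dvd_field u),
    coeff_coeff_field_mul]
  refine Finset.sum_congr rfl fun β hβ => ?_
  have hβ : β.natAbs ≤ 1 := by rw [Finset.mem_Icc] at hβ; omega
  rw [← amplitude_apply, amplitude_one_field s u hβ]
  split_ifs with hγ
  · rw [amplitude_one_field t u hγ, smul_mul_smul_comm]
  · rw [amplitude_field, if_neg hγ, mul_zero]

theorem amplitude_two_mul_of_lt {γ : ℤ} (hγ : 2 < γ.natAbs) :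
    amplitude 2 γ (s.field u * t.field u) = 0 := by
  rw [amplitude_two_mul]
  refine Finset.sum_eq_zero fun β hβ => if_neg ?_
  rw [Finset.mem_Icc] at hβ
  omega

theorem amplitude_two_two_mul {α : ℤ} (hα : α.natAbs = 1) :
    amplitude 2 (2 * α) (s.field u * t.field u) =
      ((s.phase ^ α) * (t.phase ^ α)) • (u 1 α ^ 2) := by
  rw [amplitude_two_mul, sum_Icc_neg_one_one]
  rcases Int.natAbs_eq_iff.mp hα with rfl | rfl <;> norm_num [sq]

variable {u}

theorem amplitude_two_zero_mul (hu : u 1 0 = 0) :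
    amplitude 2 0 (s.field u * t.field u) =
      (s.phase⁻¹ * t.phase + s.phase * t.phase⁻¹) • (u 1 1 * u 1 (-1)) := by
  rw [amplitude_two_mul, sum_Icc_neg_one_one]
  norm_num [hu, add_smul, mul_comm (u 1 (-1))]

theorem amplitude_two_one_mul (hu : u 1 0 = 0) {α : ℤ} (hα : α.natAbs = 1) :
    amplitude 2 α (s.field u * t.field u) = 0 := by
  rw [amplitude_two_mul, sum_Icc_neg_one_one]
  rcases Int.natAbs_eq_iff.mp hα with rfl | rfl <;> norm_num [hu]

theorem amplitude_three_one_mul (hu : u 1 0 = 0) :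
    amplitude 3 1 (s.field u * t.field u) =
      (s.phase + t.phase) • (u 2 0 * u 1 1)
        + (s.phase⁻¹ * t.phase ^ 2 + s.phase ^ 2 * t.phase⁻¹) • (u 2 2 * u 1 (-1)) := by
  rw [amplitude_apply, coeff_three_mul_of_X_dvd (s.X_dvd_field u) (t.X_dvd_field u),
    mul_comm (PowerSeries.coeff 2 _), AddMonoidAlgebra.coeff_add, Finsupp.add_apply,
    coeff_coeff_field_mul, coeff_coeff_field_mul]
  simp only [Nat.cast_one, sum_Icc_neg_one_one, ← amplitude_apply]
  norm_num [amplitude_one_field, amplitude_two_field, amplitude_two_field_of_natAbs_eq_two, hu,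
    op_map_zero]
  funext n₁ m₁ m₂
  simp only [Pi.add_apply, Pi.mul_apply, Pi.smul_apply, smul_eq_mul]
  ring

theorem amplitude_three_one_mul_mul (hu : u 1 0 = 0) :
    amplitude 3 1 (s.field u * t.field u * r.field u) =
      (s.phase⁻¹ * t.phase * r.phase + s.phase * t.phase⁻¹ * r.phase
        + s.phase * t.phase * r.phase⁻¹) • (u 1 1 ^ 2 * u 1 (-1)) := by
  have hX : PowerSeries.X ∣ t.field u * r.field u := (t.X_dvd_field u).mul_right _
  have hlow : PowerSeries.coeff 1 (t.field u * r.field u) = 0 :=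
    PowerSeries.X_pow_dvd_iff.mp (t.X_sq_dvd_mul r u) 1 one_lt_two
  rw [mul_assoc, amplitude_apply, coeff_three_mul_of_X_dvd (s.X_dvd_field u) hX, hlow, mul_zero,
    add_zero, coeff_coeff_field_mul]
  simp only [Nat.cast_one, sum_Icc_neg_one_one, ← amplitude_apply, amplitude_two_mul]
  norm_num [amplitude_one_field, hu]
  funext n₁ m₁ m₂
  simp only [Pi.add_apply, Pi.mul_apply, Pi.smul_apply, smul_eq_mul, Pi.pow_apply]
  ring

end LatticeShift

/-! ### The first three orders of the equation -/

section SlowOperators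

theorem dn₁_zero : dn₁ 0 = 0 := by funext n₁ m₁ m₂; simp [dn₁]

theorem dm₁_zero : dm₁ 0 = 0 := by funext n₁ m₁ m₂; simp [dm₁]

theorem dm₂_zero : dm₂ 0 = 0 := by funext n₁ m₁ m₂; simp [dm₂]

theorem nabla_zero : nabla 0 = 0 := by rw [nabla, dm₁_zero, dn₁_zero, add_zero]

/-- The family of slow operators of the shift from `(n, m)` to `(n + p.1, m + p.2)`. -/
def cornerOp (p : Fin 2 × Fin 2) : ℕ → Slow → Slow :=
  ![![opId, opB], ![opA, opC]] p.1 p.2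

theorem cornerOp_apply_zero (p : Fin 2 × Fin 2) (f : Slow) : cornerOp p 0 f = f := by
  fin_cases p <;> simp [cornerOp, opId, opA, opB, opC]

theorem cornerOp_map_zero (p : Fin 2 × Fin 2) (i : ℕ) : cornerOp p i 0 = 0 := by
  fin_cases p <;> simp [cornerOp, opId, opA, opB, opC, Function.iterate_fixed dn₁_zero,
    Function.iterate_fixed dm₁_zero, Function.iterate_fixed dm₂_zero,
    Function.iterate_fixed nabla_zero]

theorem cornerOp_one (p : Fin 2 × Fin 2) (f : Slow) :
    cornerOp p 1 f = ![![0, dm₁ f], ![dn₁ f, nabla f]] p.1 p.2 := by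
  fin_cases p <;> simp [cornerOp, opId, opA, opB, opC]

theorem cornerOp_two (p : Fin 2 × Fin 2) (f : Slow) :
    cornerOp p 2 f = ![![0, dm₂ f + (1 / 2 : ℝ) • dm₁ (dm₁ f)],
      ![(1 / 2 : ℝ) • dn₁ (dn₁ f), dm₂ f + (1 / 2 : ℝ) • nabla (nabla f)]] p.1 p.2 := by
  fin_cases p <;> simp [cornerOp, opId, opA, opB, opC, Finset.sum_range_succ, add_comm]

end SlowOperators

/-- The factor `K^i Ω^j` of the carrier wave at the corner `(i, j)` of the elementary square. -/
def cornerPhase (K Ω : ℂ) (p : Fin 2 × Fin 2) : ℂ := K ^ (p.1 : ℕ) * Ω ^ (p.2 : ℕ)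

theorem cornerPhase_eq (K Ω : ℂ) (p : Fin 2 × Fin 2) :
    cornerPhase K Ω p = ![![1, Ω], ![K, K * Ω]] p.1 p.2 := by
  fin_cases p <;> simp [cornerPhase]

/-- The shift to the corner `p` of the elementary square. -/
def cornerShift (κ w : ℝ) (p : Fin 2 × Fin 2) : LatticeShift where
  phase := cornerPhase (bigK κ) (bigOmega w) p
  op := cornerOp p
  op_zero := cornerOp_apply_zero p
  op_map_zero := cornerOp_map_zero p

namespace QPlus

section Parts

variable {M N : Type*} [AddCommGroup M] [Module ℝ M] [AddCommGroup N] [Module ℝ N] (c : QPlus)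

/-- The linear part of the equation, with the field at the corner `p` replaced by `f p`. -/
def linearPart (f : Fin 2 × Fin 2 → M) : M :=
  c .a₁ • (f (0, 0) + f (1, 1)) + c .a₂ • (f (1, 0) + f (0, 1))

/-- The quadratic part of the equation, with the product of the fields at the corners `p` and `q`
replaced by `f p q`. -/
def quadraticPart (f : Fin 2 × Fin 2 → Fin 2 × Fin 2 → M) : M :=
  (c .α₁ - c .α₂) • f (0, 0) (1, 0) + (c .α₁ + c .α₂) • f (0, 1) (1, 1)
    + (c .β₁ - c .β₂) • f (0, 0) (0, 1) + (c .β₁ + c .β₂) • f (1, 0) (1, 1)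
    + c .γ₁ • f (0, 0) (1, 1) + c .γ₂ • f (1, 0) (0, 1)

/-- The cubic part of the equation, with the product of the fields at the corners `p`, `q` and `r`
replaced by `f p q r`. -/
def cubicPart (f : Fin 2 × Fin 2 → Fin 2 × Fin 2 → Fin 2 × Fin 2 → M) : M :=
  (c .ξ₁ - c .ξ₃) • f (0, 0) (1, 0) (0, 1) + (c .ξ₁ + c .ξ₃) • f (0, 0) (1, 0) (1, 1)
    + (c .ξ₂ - c .ξ₄) • f (1, 0) (0, 1) (1, 1) + (c .ξ₂ + c .ξ₄) • f (0, 0) (0, 1) (1, 1)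

theorem lhs_eq_parts {A : Type*} [CommRing A] [Algebra ℝ A] (e : Fin 2 × Fin 2 → A) :
    c.lhs (e (0, 0)) (e (1, 0)) (e (0, 1)) (e (1, 1)) =
      c.linearPart e + c.quadraticPart (fun p q => e p * e q)
        + c.cubicPart (fun p q r => e p * e q * e r)
        + c .ζ • (e (0, 0) * e (1, 0) * e (0, 1) * e (1, 1)) := by
  simp only [lhs, linearPart, quadraticPart, cubicPart, ← add_assoc]

theorem map_linearPart (φ : M →ₗ[ℝ] N) (f : Fin 2 × Fin 2 → M) :
    φ (c.linearPart f) = c.linearPart fun p => φ (f p) := by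
  simp only [linearPart, map_add, map_smul]

theorem map_quadraticPart (φ : M →ₗ[ℝ] N) (f : Fin 2 × Fin 2 → Fin 2 × Fin 2 → M) :
    φ (c.quadraticPart f) = c.quadraticPart fun p q => φ (f p q) := by
  simp only [quadraticPart, map_add, map_smul]

theorem map_cubicPart (φ : M →ₗ[ℝ] N) (f : Fin 2 × Fin 2 → Fin 2 × Fin 2 → Fin 2 × Fin 2 → M) :
    φ (c.cubicPart f) = c.cubicPart fun p q r => φ (f p q r) := by
  simp only [cubicPart, map_add, map_smul]

theorem linearPart_zero : c.linearPart (fun _ => (0 : M)) = 0 := by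
  simp only [linearPart, smul_zero, add_zero]

theorem quadraticPart_zero : c.quadraticPart (fun _ _ => (0 : M)) = 0 := by
  simp only [quadraticPart, smul_zero, add_zero]

theorem cubicPart_zero : c.cubicPart (fun _ _ _ => (0 : M)) = 0 := by
  simp only [cubicPart, smul_zero, add_zero]

theorem linearPart_smul (g : Fin 2 × Fin 2 → ℂ) (f : Slow) :
    c.linearPart (fun p => g p • f) = c.linearPart g • f := by
  simp only [linearPart, ← add_smul, ← smul_assoc]

theorem quadraticPart_smul (g : Fin 2 × Fin 2 → Fin 2 × Fin 2 → ℂ) (f : Slow) :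
    c.quadraticPart (fun p q => g p q • f) = c.quadraticPart g • f := by
  simp only [quadraticPart, ← add_smul, ← smul_assoc]

theorem quadraticPart_add (f g : Fin 2 × Fin 2 → Fin 2 × Fin 2 → M) :
    c.quadraticPart (fun p q => f p q + g p q) = c.quadraticPart f + c.quadraticPart g := by
  simp only [quadraticPart, smul_add]
  abel

theorem cubicPart_smul (g : Fin 2 × Fin 2 → Fin 2 × Fin 2 → Fin 2 × Fin 2 → ℂ) (f : Slow) :
    c.cubicPart (fun p q r => g p q r • f) = c.cubicPart g • f := by
  simp only [cubicPart, ← add_smul, ← smul_assoc]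

end Parts

theorem linearPart_cornerPhase (c : QPlus) (K Ω : ℂ) :
    c.linearPart (cornerPhase K Ω) = c.symbol K Ω := by
  simp only [linearPart, cornerPhase_eq, symbol, Matrix.cons_val_zero, Matrix.cons_val_one,
    Complex.real_smul]

/-- Coefficient of `|u_1^{(1)}|²` in the zeroth harmonic. -/
def meanCoeff (c : QPlus) (K Ω : ℂ) : ℂ :=
  c.quadraticPart fun p q =>
    (cornerPhase K Ω p)⁻¹ * cornerPhase K Ω q + cornerPhase K Ω p * (cornerPhase K Ω q)⁻¹

/-- Coefficient of `(u_1^{(1)})²` in the second harmonic. -/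
def secondCoeff (c : QPlus) (K Ω : ℂ) : ℂ :=
  c.quadraticPart fun p q => cornerPhase K Ω p * cornerPhase K Ω q

/-- Coefficient of `u_2^{(0)} u_1^{(1)}` in the first harmonic. -/
def meanCoupling (c : QPlus) (K Ω : ℂ) : ℂ :=
  c.quadraticPart fun p q => cornerPhase K Ω p + cornerPhase K Ω q

/-- Coefficient of `u_2^{(2)} u_1^{(-1)}` in the first harmonic. -/
def secondCoupling (c : QPlus) (K Ω : ℂ) : ℂ :=
  c.quadraticPart fun p q =>
    (cornerPhase K Ω p)⁻¹ * cornerPhase K Ω q ^ 2 + cornerPhase K Ω p ^ 2 * (cornerPhase K Ω q)⁻¹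

/-- Coefficient of `(u_1^{(1)})² u_1^{(-1)}` in the first harmonic. -/
def cubicCoeff (c : QPlus) (K Ω : ℂ) : ℂ :=
  c.cubicPart fun p q r =>
    (cornerPhase K Ω p)⁻¹ * cornerPhase K Ω q * cornerPhase K Ω r
      + cornerPhase K Ω p * (cornerPhase K Ω q)⁻¹ * cornerPhase K Ω r
      + cornerPhase K Ω p * cornerPhase K Ω q * (cornerPhase K Ω r)⁻¹

variable {c : QPlus} {κ w : ℝ} {u : Amplitudes}

theorem W_eq_amplitude (j : ℕ) (α : ℤ) :
    c.W κ w u j α = amplitude j α (c.lhs ((cornerShift κ w (0, 0)).field u)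
      ((cornerShift κ w (1, 0)).field u) ((cornerShift κ w (0, 1)).field u)
      ((cornerShift κ w (1, 1)).field u)) := by
  simp [W, amplitude_apply, LatticeShift.field, cornerShift, cornerPhase, cornerOp]

theorem W_eq_parts {j : ℕ} (hj : j < 4) (α : ℤ) :
    c.W κ w u j α =
      c.linearPart (fun p => amplitude j α ((cornerShift κ w p).field u))
        + c.quadraticPart (fun p q =>
            amplitude j α ((cornerShift κ w p).field u * (cornerShift κ w q).field u))
        + c.cubicPart (fun p q r => amplitude j α ((cornerShift κ w p).field u *
            (cornerShift κ w q).field u * (cornerShift κ w r).field u)) := by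
  rw [W_eq_amplitude, c.lhs_eq_parts fun p => (cornerShift κ w p).field u, map_add, map_add,
    map_add, map_linearPart, map_quadraticPart, map_cubicPart, map_smul,
    amplitude_eq_zero_of_X_pow_dvd (LatticeShift.X_pow_four_dvd_mul _ _ _ _ _) hj, smul_zero,
    add_zero]

theorem W_one_eq (α : ℤ) :
    c.W κ w u 1 α = c.linearPart fun p => amplitude 1 α ((cornerShift κ w p).field u) := by
  simp only [W_eq_parts (show 1 < 4 by decide),
    amplitude_eq_zero_of_X_pow_dvd (LatticeShift.X_sq_dvd_mul _ _ _) one_lt_two,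
    amplitude_eq_zero_of_X_pow_dvd (LatticeShift.X_pow_three_dvd_mul _ _ _ _)
      (show 1 < 3 by decide), quadraticPart_zero, cubicPart_zero, add_zero]

theorem W_two_eq (α : ℤ) :
    c.W κ w u 2 α = c.linearPart (fun p => amplitude 2 α ((cornerShift κ w p).field u))
      + c.quadraticPart fun p q =>
          amplitude 2 α ((cornerShift κ w p).field u * (cornerShift κ w q).field u) := by
  simp only [W_eq_parts (show 2 < 4 by decide),
    amplitude_eq_zero_of_X_pow_dvd (LatticeShift.X_pow_three_dvd_mul _ _ _ _)
      (show 2 < 3 by decide), cubicPart_zero, add_zero]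

theorem cornerPhase_zpow (K Ω : ℂ) (p : Fin 2 × Fin 2) (α : ℤ) :
    cornerPhase K Ω p ^ α = cornerPhase (K ^ α) (Ω ^ α) p := by
  simp only [cornerPhase, mul_zpow, ← zpow_natCast, zpow_comm]

theorem linearPart_phase_zpow_smul (α : ℤ) (f : Slow) :
    c.linearPart (fun p => (cornerShift κ w p).phase ^ α • f) =
      c.symbol (bigK κ ^ α) (bigOmega w ^ α) • f := by
  rw [linearPart_smul, ← linearPart_cornerPhase]
  simp only [cornerShift, cornerPhase_zpow]

theorem W_one {α : ℤ} (hα : α.natAbs ≤ 1) :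
    c.W κ w u 1 α = c.symbol (bigK κ ^ α) (bigOmega w ^ α) • u 1 α := by
  simp only [W_one_eq, LatticeShift.amplitude_one_field _ u hα, linearPart_phase_zpow_smul]

theorem W_one_of_lt {α : ℤ} (hα : 1 < α.natAbs) : c.W κ w u 1 α = 0 := by
  simp only [W_one_eq, LatticeShift.amplitude_field, if_neg hα.not_ge, linearPart_zero]

theorem W_two_zero (hu : u 1 0 = 0) :
    c.W κ w u 2 0 = (2 * (c .a₁ + c .a₂) : ℂ) • u 2 0
      + c.meanCoeff (bigK κ) (bigOmega w) • (u 1 1 * u 1 (-1)) := by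
  have hfield (p : Fin 2 × Fin 2) : amplitude 2 0 ((cornerShift κ w p).field u) =
      (cornerShift κ w p).phase ^ (0 : ℤ) • u 2 0 := by
    rw [LatticeShift.amplitude_two_field _ u (by decide), hu, LatticeShift.op_map_zero, zero_add]
  simp only [W_two_eq, hfield, LatticeShift.amplitude_two_zero_mul _ _ hu, quadraticPart_smul,
    linearPart_phase_zpow_smul]
  congr 2
  simp only [symbol, zpow_zero]
  ring

theorem W_two_one (hu : u 1 0 = 0) {α : ℤ} (hα : α.natAbs = 1) :
    c.W κ w u 2 α = c.symbol (bigK κ ^ α) (bigOmega w ^ α) • u 2 α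
      + (bigK κ ^ α * (c .a₁ * bigOmega w ^ α + c .a₂)) • dn₁ (u 1 α)
      + (bigOmega w ^ α * (c .a₁ * bigK κ ^ α + c .a₂)) • dm₁ (u 1 α) := by
  simp only [W_two_eq, LatticeShift.amplitude_two_field _ u hα.le,
    LatticeShift.amplitude_two_one_mul _ _ hu hα, quadraticPart_zero, add_zero]
  simp only [linearPart, cornerShift, cornerPhase_eq, cornerOp_one, nabla, symbol, one_zpow,
    mul_zpow, Matrix.cons_val_zero, Matrix.cons_val_one]
  module

theorem W_two_two {α : ℤ} (hα : α.natAbs = 1) :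
    c.W κ w u 2 (2 * α) = c.symbol (bigK κ ^ (2 * α)) (bigOmega w ^ (2 * α)) • u 2 (2 * α)
      + c.secondCoeff (bigK κ ^ α) (bigOmega w ^ α) • (u 1 α ^ 2) := by
  have habs : (2 * α).natAbs = 2 := by omega
  simp only [W_two_eq, LatticeShift.amplitude_two_field_of_natAbs_eq_two _ u habs,
    LatticeShift.amplitude_two_two_mul _ _ u hα, quadraticPart_smul, linearPart_phase_zpow_smul]
  simp only [secondCoeff, cornerShift, cornerPhase_zpow]

theorem W_two_of_lt {α : ℤ} (hα : 2 < α.natAbs) : c.W κ w u 2 α = 0 := by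
  simp only [W_two_eq, LatticeShift.amplitude_field, if_neg hα.not_ge,
    LatticeShift.amplitude_two_mul_of_lt _ _ u hα, linearPart_zero, quadraticPart_zero, add_zero]

theorem linearPart_amplitude_three_one :
    c.linearPart (fun p => amplitude 3 1 ((cornerShift κ w p).field u)) =
      c.symbol (bigK κ) (bigOmega w) • u 3 1
        + (bigK κ * (c .a₁ * bigOmega w + c .a₂)) • dn₁ (u 2 1)
        + (bigOmega w * (c .a₁ * bigK κ + c .a₂)) • (dm₁ (u 2 1) + dm₂ (u 1 1))
        + (1 / 2 : ℂ) • ((c .a₁ * (bigK κ * bigOmega w)) • nabla (nabla (u 1 1))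
          + (c .a₂ * bigK κ) • dn₁ (dn₁ (u 1 1)) + (c .a₂ * bigOmega w) • dm₁ (dm₁ (u 1 1))) := by
  simp only [LatticeShift.amplitude_three_one_field]
  have hnabla : nabla (u 2 1) = dm₁ (u 2 1) + dn₁ (u 2 1) := rfl
  simp only [linearPart, cornerShift, cornerPhase_eq, cornerOp_one, cornerOp_two, hnabla, symbol,
    Matrix.cons_val_zero, Matrix.cons_val_one]
  module

theorem W_three_one (hu : u 1 0 = 0) :
    c.W κ w u 3 1 = c.symbol (bigK κ) (bigOmega w) • u 3 1
      + (bigK κ * (c .a₁ * bigOmega w + c .a₂)) • dn₁ (u 2 1)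
      + (bigOmega w * (c .a₁ * bigK κ + c .a₂)) • (dm₁ (u 2 1) + dm₂ (u 1 1))
      + (1 / 2 : ℂ) • ((c .a₁ * (bigK κ * bigOmega w)) • nabla (nabla (u 1 1))
        + (c .a₂ * bigK κ) • dn₁ (dn₁ (u 1 1)) + (c .a₂ * bigOmega w) • dm₁ (dm₁ (u 1 1)))
      + c.meanCoupling (bigK κ) (bigOmega w) • (u 2 0 * u 1 1)
      + c.secondCoupling (bigK κ) (bigOmega w) • (u 2 2 * u 1 (-1))
      + c.cubicCoeff (bigK κ) (bigOmega w) • (u 1 1 ^ 2 * u 1 (-1)) := by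
  simp only [W_eq_parts (show 3 < 4 by decide), linearPart_amplitude_three_one,
    LatticeShift.amplitude_three_one_mul _ _ hu, LatticeShift.amplitude_three_one_mul_mul _ _ _ hu,
    quadraticPart_add]
  simp only [quadraticPart_smul, cubicPart_smul, ← add_assoc]
  rfl

end QPlus

/-! ### Transport equations in the slow variables -/

section SlowVariables

/-- Smoothness in the three slow variables jointly, for the curried functions of `Slow`. -/
def SmoothSlow (f : Slow) : Prop :=
  ContDiff ℝ ((⊤ : ℕ∞) : WithTop ℕ∞) (fun p : ℝ × ℝ × ℝ => f p.1 p.2.1 p.2.2)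

/-- The total derivative of a function of the slow variables. -/
def slowFDeriv (f : Slow) (n m t : ℝ) : ℝ × ℝ × ℝ →L[ℝ] ℂ :=
  fderiv ℝ (fun p : ℝ × ℝ × ℝ => f p.1 p.2.1 p.2.2) (n, m, t)

namespace SmoothSlow

variable {f : Slow}

theorem hasDerivAt_comp_slowFDeriv (hf : SmoothSlow f) {x y t : ℝ → ℝ} {x' y' t' s : ℝ}
    (hx : HasDerivAt x x' s) (hy : HasDerivAt y y' s) (ht : HasDerivAt t t' s) :
    HasDerivAt (fun s => f (x s) (y s) (t s))
      (slowFDeriv f (x s) (y s) (t s) (x', y', t')) s := by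
  have hfderiv : HasFDerivAt (fun p : ℝ × ℝ × ℝ => f p.1 p.2.1 p.2.2)
      (slowFDeriv f (x s) (y s) (t s)) (x s, y s, t s) :=
    (ContDiff.differentiable hf (by simp) _).hasFDerivAt
  exact hfderiv.comp_hasDerivAt s (hx.prodMk (hy.prodMk ht))

theorem dn₁_eq_slowFDeriv (hf : SmoothSlow f) (n m t : ℝ) :
    dn₁ f n m t = slowFDeriv f n m t (1, 0, 0) :=
  (hf.hasDerivAt_comp_slowFDeriv (hasDerivAt_id' n) (hasDerivAt_const n m)
    (hasDerivAt_const n t)).deriv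

theorem dm₁_eq_slowFDeriv (hf : SmoothSlow f) (n m t : ℝ) :
    dm₁ f n m t = slowFDeriv f n m t (0, 1, 0) :=
  (hf.hasDerivAt_comp_slowFDeriv (hasDerivAt_const m n) (hasDerivAt_id' m)
    (hasDerivAt_const m t)).deriv

theorem dm₂_eq_slowFDeriv (hf : SmoothSlow f) (n m t : ℝ) :
    dm₂ f n m t = slowFDeriv f n m t (0, 0, 1) :=
  (hf.hasDerivAt_comp_slowFDeriv (hasDerivAt_const t n) (hasDerivAt_const t m)
    (hasDerivAt_id' t)).deriv

theorem slowFDeriv_apply (hf : SmoothSlow f) (n m t a b d : ℝ) :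
    slowFDeriv f n m t (a, b, d) = a * dn₁ f n m t + b * dm₁ f n m t + d * dm₂ f n m t := by
  have hbasis : ((a, b, d) : ℝ × ℝ × ℝ) = a • ((1, 0, 0) : ℝ × ℝ × ℝ)
      + b • ((0, 1, 0) : ℝ × ℝ × ℝ) + d • ((0, 0, 1) : ℝ × ℝ × ℝ) := by simp
  rw [hf.dn₁_eq_slowFDeriv, hf.dm₁_eq_slowFDeriv, hf.dm₂_eq_slowFDeriv, hbasis]
  simp only [map_add, map_smul, Complex.real_smul]

theorem hasDerivAt_comp (hf : SmoothSlow f) {x y t : ℝ → ℝ} {x' y' t' s : ℝ}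
    (hx : HasDerivAt x x' s) (hy : HasDerivAt y y' s) (ht : HasDerivAt t t' s) :
    HasDerivAt (fun s => f (x s) (y s) (t s))
      (x' * dn₁ f (x s) (y s) (t s) + y' * dm₁ f (x s) (y s) (t s)
        + t' * dm₂ f (x s) (y s) (t s)) s :=
  hf.slowFDeriv_apply _ _ _ x' y' t' ▸ hf.hasDerivAt_comp_slowFDeriv hx hy ht

protected theorem dn₁ (hf : SmoothSlow f) : SmoothSlow (dn₁ f) := by
  simp only [SmoothSlow, hf.dn₁_eq_slowFDeriv]
  exact (hf.fderiv_right (by simp)).clm_apply contDiff_const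

theorem eq_add_mul_of_transport (hf : SmoothSlow f) {v : ℝ} {g : ℝ → ℝ → ℂ}
    (htransport : ∀ n m t, v * dn₁ f n m t + dm₁ f n m t = g (n - v * m) t) (n m t : ℝ) :
    f n m t = f (n - v * m) 0 t + m * g (n - v * m) t := by
  generalize hx : n - v * m = x
  obtain rfl : n = x + v * m := by rw [← hx]; ring
  have hchar (s : ℝ) : HasDerivAt (fun s : ℝ => f (x + v * s) s t) (g x t) s := by
    refine (hf.hasDerivAt_comp (((hasDerivAt_id' s).const_mul v).const_add x) (hasDerivAt_id' s)
      (hasDerivAt_const s t)).congr_deriv ?_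
    rw [show g x t = g (x + v * s - v * s) t by rw [add_sub_cancel_right], ← htransport]
    simp
  have hlin (s : ℝ) : HasDerivAt (fun s : ℝ => (s : ℂ) * g x t) (g x t) s := by
    simpa using Complex.ofRealCLM.hasDerivAt.mul_const (g x t)
  have hconst := is_const_of_deriv_eq_zero (fun s => ((hchar s).sub (hlin s)).differentiableAt)
    (fun s => ((hchar s).sub (hlin s)).deriv.trans (sub_self _)) m 0
  simp only [Pi.sub_apply, mul_zero, add_zero, Complex.ofReal_zero, zero_mul, sub_zero] at hconst
  exact sub_eq_iff_eq_add.1 hconst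

theorem hasProfile_of_transport (hf : SmoothSlow f) {v : ℝ}
    (htransport : ∀ n m t, v * dn₁ f n m t + dm₁ f n m t = 0) :
    HasProfile v f (fun x t => f x 0 t) := fun n m t => by
  simpa using hf.eq_add_mul_of_transport (g := fun _ _ => 0) htransport n m t

theorem transport_eq_zero_of_bounded (hf : SmoothSlow f) {v : ℝ} {g : ℝ → ℝ → ℂ}
    (htransport : ∀ n m t, v * dn₁ f n m t + dm₁ f n m t = g (n - v * m) t)
    {M : ℝ} (hM : ∀ n m t, ‖f n m t‖ ≤ M) (x t : ℝ) : g x t = 0 := by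
  have hgrowth (m : ℝ) : |m| * ‖g x t‖ ≤ M + M := by
    have hsol := hf.eq_add_mul_of_transport htransport (x + v * m) m t
    rw [add_sub_cancel_right] at hsol
    rw [← Real.norm_eq_abs, ← Complex.norm_real, ← norm_mul, eq_sub_of_add_eq' hsol.symm]
    exact norm_sub_le_of_le (hM _ _ _) (hM _ _ _)
  by_contra hne
  have hpos : 0 < ‖g x t‖ := norm_pos_iff.2 hne
  have hle := hgrowth ((M + M + 1) / ‖g x t‖)
  rw [abs_div, abs_norm, div_mul_cancel₀ _ hpos.ne'] at hle
  linarith [le_abs_self (M + M + 1)]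

end SmoothSlow

theorem dn₁_smul (a : ℂ) (f : Slow) : dn₁ (a • f) = a • dn₁ f := by
  funext n m t
  exact deriv_const_mul_field (v := fun s => f s m t) a

theorem dm₁_smul (a : ℂ) (f : Slow) : dm₁ (a • f) = a • dm₁ f := by
  funext n m t
  exact deriv_const_mul_field (v := fun s => f n s t) a

namespace HasProfile

variable {v : ℝ} {f : Slow} {φ : ℝ → ℝ → ℂ}

theorem eq_zero_slice (h : HasProfile v f φ) : φ = fun x t => f x 0 t := by
  funext x t
  simpa using (h x 0 t).symm

protected theorem dn₁ (h : HasProfile v f φ) :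
    HasProfile v (dn₁ f) (fun x t => deriv (fun y => φ y t) x) := by
  intro n m t
  have hslice : (fun s => f s m t) = fun s => φ (s - v * m) t := funext fun s => h s m t
  rw [Multiscale.dn₁, hslice]
  exact deriv_comp_sub_const (f := fun y => φ y t) (v * m) n

protected theorem dm₂ (h : HasProfile v f φ) :
    HasProfile v (dm₂ f) (fun x t => deriv (fun s => φ x s) t) := by
  intro n m t
  have hslice : (fun s => f n m s) = fun s => φ (n - v * m) s := funext fun s => h n m s
  rw [Multiscale.dm₂, hslice]

theorem dm₁_eq (h : HasProfile v f φ) (hf : SmoothSlow f) : dm₁ f = (-v : ℂ) • dn₁ f := by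
  funext n m t
  have hconst : (fun s => f (n - v * m + v * s) s t) = fun _ => φ (n - v * m) t :=
    funext fun s => by rw [h, add_sub_cancel_right]
  have hderiv := hf.hasDerivAt_comp (((hasDerivAt_id' m).const_mul v).const_add (n - v * m))
    (hasDerivAt_id' m) (hasDerivAt_const m t)
  rw [hconst, sub_add_cancel] at hderiv
  have hzero := hderiv.unique (hasDerivAt_const m _)
  simp only [mul_one, Complex.ofReal_one, one_mul, Complex.ofReal_zero, zero_mul, add_zero]
    at hzero
  simp only [Pi.smul_apply, smul_eq_mul]
  linear_combination hzero

theorem nabla_eq (h : HasProfile v f φ) (hf : SmoothSlow f) :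
    nabla f = (1 - v : ℂ) • dn₁ f := by
  rw [nabla, h.dm₁_eq hf]
  module

theorem dn₁_dn₁ (h : HasProfile v f φ) (n m t : ℝ) :
    Multiscale.dn₁ (Multiscale.dn₁ f) n m t
      = iteratedDeriv 2 (fun y => φ y t) (n - v * m) := by
  rw [h.dn₁.dn₁ n m t, iteratedDeriv_succ, iteratedDeriv_one]

theorem dm₁_dm₁ (h : HasProfile v f φ) (hf : SmoothSlow f) (n m t : ℝ) :
    dm₁ (dm₁ f) n m t = v ^ 2 * iteratedDeriv 2 (fun y => φ y t) (n - v * m) := by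
  rw [h.dm₁_eq hf, dm₁_smul, h.dn₁.dm₁_eq hf.dn₁, smul_smul, Pi.smul_apply, Pi.smul_apply,
    Pi.smul_apply, h.dn₁_dn₁, smul_eq_mul]
  ring

theorem nabla_nabla (h : HasProfile v f φ) (hf : SmoothSlow f) (n m t : ℝ) :
    nabla (nabla f) n m t = (1 - v) ^ 2 * iteratedDeriv 2 (fun y => φ y t) (n - v * m) := by
  have hsmul : nabla ((1 - v : ℂ) • Multiscale.dn₁ f)
      = (1 - v : ℂ) • nabla (Multiscale.dn₁ f) := by
    simp only [nabla, dn₁_smul, dm₁_smul, smul_add]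
  rw [h.nabla_eq hf, hsmul, h.dn₁.nabla_eq hf.dn₁, smul_smul, Pi.smul_apply, Pi.smul_apply,
    Pi.smul_apply, h.dn₁_dn₁, smul_eq_mul]
  ring

end HasProfile

end SlowVariables

/-! ### The NLS equation at third order -/

section CarrierWave

open ComplexConjugate

theorem bigK_ne_zero (κ : ℝ) : bigK κ ≠ 0 := Complex.exp_ne_zero _

theorem bigOmega_ne_zero (w : ℝ) : bigOmega w ≠ 0 := Complex.exp_ne_zero _

theorem bigK_eq (κ : ℝ) : bigK κ = Complex.cos κ + Complex.sin κ * Complex.I := by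
  rw [bigK, mul_comm, Complex.exp_mul_I]

theorem conj_bigK (κ : ℝ) : conj (bigK κ) = (bigK κ)⁻¹ := by
  rw [bigK, ← Complex.exp_conj, ← Complex.exp_neg]
  simp

theorem conj_bigOmega (w : ℝ) : conj (bigOmega w) = (bigOmega w)⁻¹ := by
  rw [bigOmega, ← Complex.exp_conj, ← Complex.exp_neg]
  simp

theorem norm_bigK (κ : ℝ) : ‖bigK κ‖ = 1 := by
  rw [bigK, mul_comm, Complex.norm_exp_ofReal_mul_I]

theorem hasDerivAt_bigK (κ : ℝ) : HasDerivAt bigK (Complex.I * bigK κ) κ := by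
  have hlin : HasDerivAt (fun κ : ℝ => Complex.I * (κ : ℂ)) Complex.I κ := by
    simpa using Complex.ofRealCLM.hasDerivAt.const_mul Complex.I
  exact hlin.cexp.congr_deriv (mul_comm _ _)

theorem hasDerivAt_bigOmega_comp {ω : ℝ → ℝ} {κ : ℝ} (hω : DifferentiableAt ℝ ω κ) :
    HasDerivAt (fun κ => bigOmega (ω κ)) (-(Complex.I * deriv ω κ) * bigOmega (ω κ)) κ := by
  have hlin : HasDerivAt (fun κ : ℝ => -(Complex.I * (ω κ : ℂ))) (-(Complex.I * deriv ω κ)) κ :=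
    (hω.hasDerivAt.ofReal_comp.const_mul Complex.I).neg
  exact hlin.cexp.congr_deriv (mul_comm _ _)

namespace QPlus

variable {c : QPlus} {ω : ℝ → ℝ} {κ : ℝ}

namespace IsDispersive

theorem add_ne_zero (hc : c.IsDispersive) : c .a₁ + c .a₂ ≠ 0 := fun h =>
  hc.2.2 (by rw [eq_neg_of_add_eq_zero_left h, abs_neg])

theorem sub_ne_zero (hc : c.IsDispersive) : c .a₁ - c .a₂ ≠ 0 := fun h =>
  hc.2.2 (by rw [_root_.sub_eq_zero.1 h])

theorem two_mul_add_ne_zero (hc : c.IsDispersive) : (2 * (c .a₁ + c .a₂) : ℂ) ≠ 0 :=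
  mul_ne_zero two_ne_zero (by exact_mod_cast hc.add_ne_zero)

theorem mul_add_ne_zero (hc : c.IsDispersive) {z : ℂ} (hz : ‖z‖ = 1) :
    (c .a₁ * z + c .a₂ : ℂ) ≠ 0 := fun h =>
  hc.2.2 (by simpa [hz] using congrArg norm (eq_neg_of_add_eq_zero_left h))

theorem add_mul_ne_zero (hc : c.IsDispersive) {z : ℂ} (hz : ‖z‖ = 1) :
    (c .a₁ + c .a₂ * z : ℂ) ≠ 0 := fun h =>
  hc.2.2 (by simpa [hz] using congrArg norm (eq_neg_of_add_eq_zero_left h))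

end IsDispersive

theorem conj_symbol (c : QPlus) (κ w : ℝ) (α : ℤ) :
    conj (c.symbol (bigK κ ^ α) (bigOmega w ^ α)) =
      c.symbol (bigK κ ^ (-α)) (bigOmega w ^ (-α)) := by
  simp only [symbol, map_add, map_mul, map_zpow₀, conj_bigK, conj_bigOmega, Complex.conj_ofReal,
    map_one, inv_zpow']

theorem IsDispersionRelation.group_velocity (hω : c.IsDispersionRelation ω) (κ : ℝ) :
    bigK κ * (c .a₁ * bigOmega (ω κ) + c .a₂)
      = deriv ω κ * (bigOmega (ω κ) * (c .a₁ * bigK κ + c .a₂)) := by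
  have hK := hasDerivAt_bigK κ
  have hΩ := hasDerivAt_bigOmega_comp (hω.1 κ)
  have hsymbol : HasDerivAt (fun κ => c.symbol (bigK κ) (bigOmega (ω κ))) _ κ :=
    (((hK.mul hΩ).const_add (1 : ℂ)).const_mul (c .a₁ : ℂ)).add
      ((hK.add hΩ).const_mul (c .a₂ : ℂ))
  simp only [hω.2] at hsymbol
  apply mul_left_cancel₀ Complex.I_ne_zero
  linear_combination hsymbol.unique (hasDerivAt_const κ (0 : ℂ))

theorem IsDispersionRelation.symbol_zpow (hω : c.IsDispersionRelation ω) (κ : ℝ) {α : ℤ}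
    (hα : α.natAbs = 1) : c.symbol (bigK κ ^ α) (bigOmega (ω κ) ^ α) = 0 := by
  obtain rfl | rfl := Int.natAbs_eq_iff.1 hα
  · simpa using hω.2 κ
  · rw [← conj_symbol, Nat.cast_one, zpow_one, zpow_one, hω.2, map_zero]

theorem IsDispersionRelation.group_velocity_zpow (hω : c.IsDispersionRelation ω) (κ : ℝ) {α : ℤ}
    (hα : α.natAbs = 1) :
    bigK κ ^ α * (c .a₁ * bigOmega (ω κ) ^ α + c .a₂)
      = deriv ω κ * (bigOmega (ω κ) ^ α * (c .a₁ * bigK κ ^ α + c .a₂)) := by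
  obtain rfl | rfl := Int.natAbs_eq_iff.1 hα
  · simpa using hω.group_velocity κ
  · simpa only [map_mul, map_add, conj_bigK, conj_bigOmega, Complex.conj_ofReal, Nat.cast_one,
      zpow_neg_one] using congrArg conj (hω.group_velocity κ)

end QPlus

end CarrierWave

section ThirdOrder

theorem smul_add_smul_eq_zero_iff {k M : Type*} [Field k] [AddCommGroup M] [Module k M] {a b : k}
    (ha : a ≠ 0) {x y : M} : a • x + b • y = 0 ↔ x = -(b / a) • y := by
  rw [neg_smul, eq_neg_iff_add_eq_zero, ← smul_eq_zero_iff_right (m := x + _) ha, smul_add,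
    smul_smul, mul_div_cancel₀ _ ha]

open ComplexConjugate

namespace QPlus

/-- The factor `A` with `u_2^{(0)} = A |u_1^{(1)}|²` forced by the order `ε²`. -/
def meanResponse (c : QPlus) (K Ω : ℂ) : ℂ :=
  -(c.meanCoeff K Ω / (2 * (c .a₁ + c .a₂)))

/-- The factor `B` with `u_2^{(2)} = B (u_1^{(1)})²` forced by the order `ε²`. -/
def secondResponse (c : QPlus) (K Ω : ℂ) : ℂ :=
  -(c.secondCoeff K Ω / c.symbol (K ^ 2) (Ω ^ 2))

/-- The coefficient of `u_1^{(1)} |u_1^{(1)}|²` in `W_3^{(1)}` once `u_2^{(0)}` and `u_2^{(2)}` are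
eliminated. -/
def cubicTotal (c : QPlus) (K Ω : ℂ) : ℂ :=
  c.cubicCoeff K Ω + c.meanCoupling K Ω * c.meanResponse K Ω
    + c.secondCoupling K Ω * c.secondResponse K Ω

/-- The constant `λ` in front of the NLS expression, normalised by the coefficient `i` of
`∂_{m₂} φ`. -/
def nlsFactor (c : QPlus) (ω : ℝ → ℝ) (κ : ℝ) : ℂ :=
  -Complex.I * (bigOmega (ω κ) * (c .a₁ * bigK κ + c .a₂))

/-- The coefficient `ρ₁` as it comes out of the expansion; `ω'(κ)` is still unevaluated. -/
def nlsDispersion (c : QPlus) (ω : ℝ → ℝ) (κ : ℝ) : ℂ :=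
  1 / 2 * (c .a₁ * (bigK κ * bigOmega (ω κ)) * (1 - deriv ω κ) ^ 2
    + c .a₂ * (bigK κ + deriv ω κ ^ 2 * bigOmega (ω κ))) / c.nlsFactor ω κ

/-- The coefficient `ρ₂` as it comes out of the expansion. -/
def nlsNonlinearity (c : QPlus) (ω : ℝ → ℝ) (κ : ℝ) : ℂ :=
  c.cubicTotal (bigK κ) (bigOmega (ω κ)) / c.nlsFactor ω κ

variable {c : QPlus} {ω : ℝ → ℝ} {κ w : ℝ} {u : Amplitudes}

theorem nlsFactor_ne_zero (hc : c.IsDispersive) : c.nlsFactor ω κ ≠ 0 :=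
  mul_ne_zero (neg_ne_zero.2 Complex.I_ne_zero)
    (mul_ne_zero (bigOmega_ne_zero _) (hc.mul_add_ne_zero (norm_bigK κ)))

theorem nlsFactor_mul_I :
    c.nlsFactor ω κ * Complex.I = bigOmega (ω κ) * (c .a₁ * bigK κ + c .a₂) := by
  rw [nlsFactor]
  linear_combination -(bigOmega (ω κ) * (c .a₁ * bigK κ + c .a₂)) * Complex.I_mul_I

theorem amplitude_one_zero_eq_zero (hc : c.IsDispersive) (hW : c.W κ w u 1 0 = 0) :
    u 1 0 = 0 := by
  rw [W_one (by decide)] at hW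
  refine (smul_eq_zero.1 hW).resolve_left fun hsymbol => hc.two_mul_add_ne_zero ?_
  rw [← hsymbol, symbol]
  simp only [zpow_zero]
  ring

theorem W_two_zero_eq_zero_iff (hc : c.IsDispersive) (hu : u 1 0 = 0) :
    c.W κ w u 2 0 = 0 ↔
      u 2 0 = c.meanResponse (bigK κ) (bigOmega w) • (u 1 1 * u 1 (-1)) := by
  rw [W_two_zero hu, meanResponse, smul_add_smul_eq_zero_iff hc.two_mul_add_ne_zero]

theorem W_two_two_eq_zero_iff {α : ℤ} (hα : α.natAbs = 1)
    (hr : c.symbol ((bigK κ ^ α) ^ 2) ((bigOmega w ^ α) ^ 2) ≠ 0) :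
    c.W κ w u 2 (2 * α) = 0 ↔
      u 2 (2 * α) = c.secondResponse (bigK κ ^ α) (bigOmega w ^ α) • u 1 α ^ 2 := by
  have hpow (z : ℂ) : z ^ (2 * α) = (z ^ α) ^ 2 := by rw [mul_comm, zpow_mul, zpow_ofNat]
  rw [W_two_two hα, hpow, hpow, secondResponse, smul_add_smul_eq_zero_iff hr]

theorem W_two_one_eq_transport (hω : c.IsDispersionRelation ω) (hu : u 1 0 = 0) {α : ℤ}
    (hα : α.natAbs = 1) :
    c.W κ (ω κ) u 2 α = (bigOmega (ω κ) ^ α * (c .a₁ * bigK κ ^ α + c .a₂)) •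
      (((deriv ω κ : ℝ) : ℂ) • dn₁ (u 1 α) + dm₁ (u 1 α)) := by
  rw [W_two_one hu hα, hω.symbol_zpow κ hα, hω.group_velocity_zpow κ hα]
  module

theorem hasProfile_amplitude_one_one (hc : c.IsDispersive) (hω : c.IsDispersionRelation ω)
    (hu : u.Admissible) (hW₁ : ∀ α, c.W κ (ω κ) u 1 α = 0)
    (hW₂ : ∀ α, c.W κ (ω κ) u 2 α = 0) :
    HasProfile (deriv ω κ) (u 1 1) (fun x t => u 1 1 x 0 t) := by
  have htransport := hW₂ 1
  rw [W_two_one_eq_transport hω (amplitude_one_zero_eq_zero hc (hW₁ 0)) rfl, smul_eq_zero,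
    zpow_one, zpow_one] at htransport
  have htransport := htransport.resolve_left
    (mul_ne_zero (bigOmega_ne_zero _) (hc.mul_add_ne_zero (norm_bigK κ)))
  exact SmoothSlow.hasProfile_of_transport (hu.1 1 1) fun n m t =>
    congrFun (congrFun (congrFun htransport n) m) t

theorem W_three_one_eq_cubicTotal (hc : c.IsDispersive) (hω : c.IsDispersionRelation ω)
    (hr : c.NonResonant ω κ) (hW₁ : ∀ α, c.W κ (ω κ) u 1 α = 0)
    (hW₂ : ∀ α, c.W κ (ω κ) u 2 α = 0) :
    c.W κ (ω κ) u 3 1 = (bigOmega (ω κ) * (c .a₁ * bigK κ + c .a₂)) •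
        (((deriv ω κ : ℝ) : ℂ) • dn₁ (u 2 1) + dm₁ (u 2 1) + dm₂ (u 1 1))
      + (1 / 2 : ℂ) • ((c .a₁ * (bigK κ * bigOmega (ω κ))) • nabla (nabla (u 1 1))
        + (c .a₂ * bigK κ) • dn₁ (dn₁ (u 1 1)) + (c .a₂ * bigOmega (ω κ)) • dm₁ (dm₁ (u 1 1)))
      + c.cubicTotal (bigK κ) (bigOmega (ω κ)) • (u 1 1 * (u 1 1 * u 1 (-1))) := by
  have hu := amplitude_one_zero_eq_zero hc (hW₁ 0)
  have hmean := (W_two_zero_eq_zero_iff hc hu).1 (hW₂ 0)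
  have hsecond := (W_two_two_eq_zero_iff (α := 1) rfl (by simpa [NonResonant] using hr)).1
    (hW₂ (2 * 1))
  simp only [mul_one, zpow_one] at hsecond
  rw [W_three_one hu, hω.2, hω.group_velocity, hmean, hsecond, cubicTotal]
  simp only [smul_mul_assoc, pow_two]
  rw [show u 1 1 * u 1 1 * u 1 (-1) = u 1 1 * (u 1 1 * u 1 (-1)) by ring,
    mul_comm (u 1 1 * u 1 (-1)) (u 1 1)]
  module

/-- The second derivatives in `W_3^{(1)}` collapse to `∂_ξ²` because the first harmonic is a
travelling profile, and the NLS expression appears. -/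
theorem W_three_one_eq (hc : c.IsDispersive) (hω : c.IsDispersionRelation ω)
    (hr : c.NonResonant ω κ) (hu : u.Admissible) (hW₁ : ∀ α, c.W κ (ω κ) u 1 α = 0)
    (hW₂ : ∀ α, c.W κ (ω κ) u 2 α = 0) (n m t : ℝ) :
    c.W κ (ω κ) u 3 1 n m t = c.nlsFactor ω κ *
      (Complex.I * (deriv ω κ * dn₁ (u 2 1) n m t + dm₁ (u 2 1) n m t) +
        nls (c.nlsDispersion ω κ) (c.nlsNonlinearity ω κ) (fun x t => u 1 1 x 0 t)
          (n - deriv ω κ * m) t) := by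
  have hprofile := hasProfile_amplitude_one_one hc hω hu hW₁ hW₂
  have hsmooth : SmoothSlow (u 1 1) := hu.1 1 1
  have hvalue : u 1 1 n m t = u 1 1 (n - deriv ω κ * m) 0 t := hprofile n m t
  have hdm₂ : dm₂ (u 1 1) n m t = deriv (fun s => u 1 1 (n - deriv ω κ * m) 0 s) t :=
    hprofile.dm₂ n m t
  have hnorm : u 1 1 n m t * u 1 (-1) n m t = ((‖u 1 1 n m t‖ ^ 2 : ℝ) : ℂ) := by
    rw [hu.2, Complex.mul_conj, Complex.normSq_eq_norm_sq]
  have hdispersion := mul_div_cancel₀ (1 / 2 * (c .a₁ * (bigK κ * bigOmega (ω κ))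
    * (1 - deriv ω κ) ^ 2 + c .a₂ * (bigK κ + deriv ω κ ^ 2 * bigOmega (ω κ))))
    (nlsFactor_ne_zero (ω := ω) (κ := κ) hc)
  have hcubic := mul_div_cancel₀ (c.cubicTotal (bigK κ) (bigOmega (ω κ)))
    (nlsFactor_ne_zero (ω := ω) (κ := κ) hc)
  rw [← nlsDispersion] at hdispersion
  rw [← nlsNonlinearity] at hcubic
  rw [W_three_one_eq_cubicTotal hc hω hr hW₁ hW₂, nls, ← hvalue, ← hdm₂, ← hnorm,
    ← nlsFactor_mul_I, ← hcubic]
  simp only [Pi.add_apply, Pi.smul_apply, smul_eq_mul, Pi.mul_apply, hprofile.dn₁_dn₁,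
    hprofile.dm₁_dm₁ hsmooth, hprofile.nabla_nabla hsmooth]
  linear_combination -hdispersion * iteratedDeriv 2 (fun y => u 1 1 y 0 t) (n - deriv ω κ * m)

theorem reducesToNLS_nlsDispersion_nlsNonlinearity (hc : c.IsDispersive)
    (hω : c.IsDispersionRelation ω) (hr : c.NonResonant ω κ) :
    c.ReducesToNLS ω κ (c.nlsDispersion ω κ) (c.nlsNonlinearity ω κ) := by
  refine ⟨c.nlsFactor ω κ, nlsFactor_ne_zero hc, fun u hu hW₁ hW₂ ⟨ψ, hψ⟩ =>
    ⟨_, hasProfile_amplitude_one_one hc hω hu hW₁ hW₂, fun n m t => ?_⟩⟩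
  rw [W_three_one_eq hc hω hr hu hW₁ hW₂, hψ.dm₁_eq (hu.1 2 1), Pi.smul_apply, Pi.smul_apply,
    Pi.smul_apply, smul_eq_mul]
  ring

/-- The order `ε³` makes the NLS expression a source in the transport equation for `u_2^{(1)}`; it
would produce secular growth. -/
theorem hasProfile_of_bounded (hc : c.IsDispersive) (hω : c.IsDispersionRelation ω)
    (hr : c.NonResonant ω κ) (hu : u.Admissible) (hb : u.Bounded)
    (hW₁ : ∀ α, c.W κ (ω κ) u 1 α = 0) (hW₂ : ∀ α, c.W κ (ω κ) u 2 α = 0)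
    (hW₃ : c.W κ (ω κ) u 3 1 = 0) :
    (∃ ψ, HasProfile (deriv ω κ) (u 2 1) ψ) ∧
      ∃ φ, HasProfile (deriv ω κ) (u 1 1) φ ∧
        ∀ x t, nls (c.nlsDispersion ω κ) (c.nlsNonlinearity ω κ) φ x t = 0 := by
  have hsmooth : SmoothSlow (u 2 1) := hu.1 2 1
  have htransport (n m t : ℝ) : (deriv ω κ : ℝ) * dn₁ (u 2 1) n m t + dm₁ (u 2 1) n m t
      = Complex.I * nls (c.nlsDispersion ω κ) (c.nlsNonlinearity ω κ) (fun x t => u 1 1 x 0 t)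
        (n - deriv ω κ * m) t := by
    have hW := W_three_one_eq hc hω hr hu hW₁ hW₂ n m t
    rw [hW₃] at hW
    have hfactor := (mul_eq_zero.1 hW.symm).resolve_left (nlsFactor_ne_zero hc)
    linear_combination -Complex.I * hfactor +
      ((deriv ω κ : ℝ) * dn₁ (u 2 1) n m t + dm₁ (u 2 1) n m t) * Complex.I_mul_I
  obtain ⟨M, hM⟩ := hb 2 1
  have hnls (x t : ℝ) := hsmooth.transport_eq_zero_of_bounded
    (g := fun x t => Complex.I * nls _ _ _ x t) htransport hM x t
  refine ⟨⟨_, hsmooth.hasProfile_of_transport fun n m t => ?_⟩,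
    _, hasProfile_amplitude_one_one hc hω hu hW₁ hW₂, fun x t => ?_⟩
  · rw [htransport, hnls]
  · exact (mul_eq_zero.1 (hnls x t)).resolve_left Complex.I_ne_zero

end QPlus

end ThirdOrder

section PrescribedFirstHarmonic

open ComplexConjugate

/-- The factors `slavedCoeff A B ℓ α` of `f ^ ℓ` in the amplitudes `u_ℓ^{(α)}` determined by a real
first harmonic `f` when the responses of the zeroth and second harmonics are `A` and `B`. -/
def slavedCoeff (A B : ℂ) : ℕ → ℤ → ℂ
  | 1, α => if α.natAbs = 1 then 1 else 0
  | 2, α => if α = 0 then A else if α = 2 then B else if α = -2 then conj B else 0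
  | _, _ => 0

theorem slavedCoeff_neg {A : ℂ} (hA : conj A = A) (B : ℂ) (ℓ : ℕ) (α : ℤ) :
    slavedCoeff A B ℓ (-α) = conj (slavedCoeff A B ℓ α) := by
  unfold slavedCoeff
  split
  · rw [Int.natAbs_neg, apply_ite conj, map_one, map_zero]
  · rcases eq_or_ne α 0 with rfl | h₀
    · simp [hA]
    rcases eq_or_ne α 2 with rfl | h₂
    · simp
    rcases eq_or_ne α (-2) with rfl | hneg
    · simp
    · simp [h₀, h₂, hneg, neg_eq_iff_eq_neg]
  · rw [map_zero]

/-- Amplitudes with the real first harmonic `f`, zeroth harmonic `A f²` and second harmonic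
`B f²`. -/
def slavedAmplitudes (A B : ℂ) (f : Slow) : Amplitudes := fun ℓ α => slavedCoeff A B ℓ α • f ^ ℓ

theorem slavedAmplitudes_admissible {A : ℂ} (hA : conj A = A) (B : ℂ) {f : Slow}
    (hf : SmoothSlow f) (hreal : ∀ n m t, conj (f n m t) = f n m t) :
    (slavedAmplitudes A B f).Admissible :=
  ⟨fun ℓ α => (ContDiff.pow hf ℓ).const_smul (slavedCoeff A B ℓ α), fun ℓ α n m t => by
    simp [slavedAmplitudes, slavedCoeff_neg hA, hreal]⟩

namespace QPlus

variable {c : QPlus} {ω : ℝ → ℝ} {κ w : ℝ}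

theorem conj_quadraticPart (f : Fin 2 × Fin 2 → Fin 2 × Fin 2 → ℂ) :
    conj (c.quadraticPart f) = c.quadraticPart fun p q => conj (f p q) :=
  c.map_quadraticPart Complex.conjAe.toLinearMap f

theorem conj_cornerPhase (κ w : ℝ) (p : Fin 2 × Fin 2) :
    conj (cornerPhase (bigK κ) (bigOmega w) p) = cornerPhase (bigK κ)⁻¹ (bigOmega w)⁻¹ p := by
  simp only [cornerPhase, map_mul, map_pow, conj_bigK, conj_bigOmega]

theorem conj_meanResponse :
    conj (c.meanResponse (bigK κ) (bigOmega w)) = c.meanResponse (bigK κ) (bigOmega w) := by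
  have hcorner (p : Fin 2 × Fin 2) : cornerPhase (bigK κ)⁻¹ (bigOmega w)⁻¹ p
      = (cornerPhase (bigK κ) (bigOmega w) p)⁻¹ := by
    simp only [cornerPhase, mul_inv, inv_pow]
  have hmean : conj (c.meanCoeff (bigK κ) (bigOmega w)) = c.meanCoeff (bigK κ) (bigOmega w) := by
    simp only [meanCoeff, conj_quadraticPart, map_add, map_mul, map_inv₀, conj_cornerPhase, hcorner,
      inv_inv]
    simp only [add_comm]
  simp only [meanResponse, map_neg, map_div₀, hmean, map_mul, map_add, Complex.conj_ofReal,
    Complex.conj_ofNat]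

theorem conj_secondResponse :
    conj (c.secondResponse (bigK κ) (bigOmega w))
      = c.secondResponse (bigK κ)⁻¹ (bigOmega w)⁻¹ := by
  simp only [secondResponse, secondCoeff, symbol, conj_quadraticPart, conj_cornerPhase, map_neg,
    map_div₀, map_add, map_mul, map_pow, map_one, conj_bigK, conj_bigOmega, Complex.conj_ofReal]

theorem NonResonant.zpow (hr : c.NonResonant ω κ) {α : ℤ} (hα : α.natAbs = 1) :
    c.symbol ((bigK κ ^ α) ^ 2) ((bigOmega (ω κ) ^ α) ^ 2) ≠ 0 := by
  obtain rfl | rfl := Int.natAbs_eq_iff.1 hα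
  · simpa [NonResonant] using hr
  · have hconj := conj_symbol c κ (ω κ) 2
    simp only [zpow_ofNat, zpow_neg] at hconj
    simpa only [Nat.cast_one, zpow_neg_one, inv_pow, ← hconj] using (map_ne_zero conj).2 hr

theorem W_one_slavedAmplitudes (hω : c.IsDispersionRelation ω) (A B : ℂ) (f : Slow) (α : ℤ) :
    c.W κ (ω κ) (slavedAmplitudes A B f) 1 α = 0 := by
  rcases lt_or_ge 1 α.natAbs with hα | hα
  · exact W_one_of_lt hα
  rw [W_one hα]
  rcases hα.eq_or_lt with hα | hα
  · rw [hω.symbol_zpow κ hα, zero_smul]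
  · simp [slavedAmplitudes, slavedCoeff, hα.ne]

theorem W_two_slavedAmplitudes (hc : c.IsDispersive) (hω : c.IsDispersionRelation ω)
    (hr : c.NonResonant ω κ) {f : Slow} (hf : SmoothSlow f) {φ : ℝ → ℝ → ℂ}
    (hp : HasProfile (deriv ω κ) f φ) (α : ℤ) :
    c.W κ (ω κ) (slavedAmplitudes (c.meanResponse (bigK κ) (bigOmega (ω κ)))
      (c.secondResponse (bigK κ) (bigOmega (ω κ))) f) 2 α = 0 := by
  have hzero (A B : ℂ) : slavedAmplitudes A B f 1 0 = 0 := by simp [slavedAmplitudes, slavedCoeff]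
  have hfirst (A B : ℂ) {α : ℤ} (hα : α.natAbs = 1) : slavedAmplitudes A B f 1 α = f := by
    simp [slavedAmplitudes, slavedCoeff, hα]
  rcases lt_or_ge 2 α.natAbs with hα | hα
  · exact W_two_of_lt hα
  obtain rfl | hα | rfl | rfl : α = 0 ∨ α.natAbs = 1 ∨ α = 2 * 1 ∨ α = 2 * -1 := by omega
  · rw [W_two_zero_eq_zero_iff hc (hzero _ _), hfirst _ _ rfl, hfirst _ _ rfl, ← pow_two]
    rfl
  · rw [W_two_one_eq_transport hω (hzero _ _) hα, hfirst _ _ hα, hp.dm₁_eq hf, neg_smul,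
      add_neg_cancel, smul_zero]
  · rw [W_two_two_eq_zero_iff rfl (hr.zpow rfl), hfirst _ _ rfl, zpow_one, zpow_one]
    rfl
  · rw [W_two_two_eq_zero_iff rfl (hr.zpow rfl), hfirst _ _ rfl, zpow_neg_one, zpow_neg_one,
      ← conj_secondResponse]
    rfl

theorem exists_amplitudes_of_real_profile (hc : c.IsDispersive) (hω : c.IsDispersionRelation ω)
    (hr : c.NonResonant ω κ) {g : ℝ → ℝ → ℝ}
    (hg : ContDiff ℝ ((⊤ : ℕ∞) : WithTop ℕ∞) (fun p : ℝ × ℝ => g p.1 p.2)) :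
    ∃ u : Amplitudes, u.Admissible ∧ (∀ α, c.W κ (ω κ) u 1 α = 0) ∧
      (∀ α, c.W κ (ω κ) u 2 α = 0) ∧ HasProfile (deriv ω κ) (u 1 1) (fun x t => g x t) ∧
      u 2 1 = 0 := by
  have hf : SmoothSlow fun n m t => (g (n - deriv ω κ * m) t : ℂ) := by
    have hchar : ContDiff ℝ ((⊤ : ℕ∞) : WithTop ℕ∞)
        (fun p : ℝ × ℝ × ℝ => (p.1 - deriv ω κ * p.2.1, p.2.2)) := by fun_prop
    exact Complex.ofRealCLM.contDiff.comp (hg.comp hchar)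
  refine ⟨slavedAmplitudes _ _ _, slavedAmplitudes_admissible conj_meanResponse _ hf
    fun n m t => Complex.conj_ofReal _, W_one_slavedAmplitudes hω _ _ _,
    W_two_slavedAmplitudes hc hω hr hf (φ := fun x t => g x t) fun n m t => rfl,
    fun n m t => ?_, ?_⟩
  · simp [slavedAmplitudes, slavedCoeff]
  · simp [slavedAmplitudes, slavedCoeff]

end QPlus

end PrescribedFirstHarmonic

section Uniqueness

variable {ρ₁ ρ₂ : ℂ}

theorem nls_time : nls ρ₁ ρ₂ (fun _ t => (t : ℂ)) 0 0 = Complex.I := by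
  have hderiv : deriv (fun s : ℝ => (s : ℂ)) 0 = 1 := by
    rw [(hasDerivAt_id' (0 : ℝ)).ofReal_comp.deriv, Complex.ofReal_one]
  simp [nls, hderiv]

theorem nls_sq : nls ρ₁ ρ₂ (fun x _ => ((x ^ 2 : ℝ) : ℂ)) 0 0 = 2 * ρ₁ := by
  have hderiv : deriv (fun y : ℝ => ((y ^ 2 : ℝ) : ℂ)) = fun y : ℝ => 2 * (y : ℂ) := by
    funext y
    simpa using (hasDerivAt_pow 2 y).ofReal_comp.deriv
  have hderiv₂ : deriv (fun y : ℝ => 2 * (y : ℂ)) 0 = 2 := by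
    simpa using ((hasDerivAt_id' (0 : ℝ)).ofReal_comp.const_mul (2 : ℂ)).deriv
  simp only [nls, iteratedDeriv_succ, iteratedDeriv_zero, hderiv, hderiv₂, deriv_const]
  simp [mul_comm]

theorem nls_one : nls ρ₁ ρ₂ (fun _ _ => 1) 0 0 = ρ₂ := by
  simp [nls, iteratedDeriv_succ]

theorem nls_coeff_unique {l l' σ₁ σ₂ : ℂ} (hl : l ≠ 0)
    (h : ∀ g : ℝ → ℝ → ℝ, ContDiff ℝ ((⊤ : ℕ∞) : WithTop ℕ∞) (fun p : ℝ × ℝ => g p.1 p.2) →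
      l * nls ρ₁ ρ₂ (fun x t => g x t) 0 0 = l' * nls σ₁ σ₂ (fun x t => g x t) 0 0) :
    ρ₁ = σ₁ ∧ ρ₂ = σ₂ := by
  have htime := h (fun _ t => t) (by fun_prop)
  have hsq := h (fun x _ => x ^ 2) (by fun_prop)
  have hone := h (fun _ _ => 1) (by fun_prop)
  simp only [nls_time, mul_left_inj' Complex.I_ne_zero] at htime
  subst htime
  simp only [Complex.ofReal_one, nls_one, mul_right_inj' hl] at hone
  simp only [nls_sq, mul_right_inj' hl, mul_right_inj' (two_ne_zero' ℂ)] at hsq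
  exact ⟨hsq, hone⟩

theorem QPlus.ReducesToNLS.unique {c : QPlus} {ω : ℝ → ℝ} {κ : ℝ} (hc : c.IsDispersive)
    (hω : c.IsDispersionRelation ω) (hr : c.NonResonant ω κ) {σ₁ σ₂ : ℂ}
    (hρ : c.ReducesToNLS ω κ ρ₁ ρ₂) (hσ : c.ReducesToNLS ω κ σ₁ σ₂) : ρ₁ = σ₁ ∧ ρ₂ = σ₂ := by
  obtain ⟨l, hl, hρ⟩ := hρ
  obtain ⟨l', -, hσ⟩ := hσ
  refine nls_coeff_unique (l' := l') hl fun g hg => ?_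
  obtain ⟨u, hu, hW₁, hW₂, hg, hu₂⟩ := exists_amplitudes_of_real_profile hc hω hr hg
  have hψ : ∃ ψ, HasProfile (deriv ω κ) (u 2 1) ψ := ⟨0, fun n m t => by rw [hu₂]; rfl⟩
  obtain ⟨φ, hφ, hWρ⟩ := hρ u hu hW₁ hW₂ hψ
  obtain ⟨φ', hφ', hWσ⟩ := hσ u hu hW₁ hW₂ hψ
  rw [hg.eq_zero_slice]
  rw [hφ.eq_zero_slice] at hWρ
  rw [hφ'.eq_zero_slice] at hWσ
  simpa using (hWρ 0 0 0).symm.trans (hWσ 0 0 0)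

end Uniqueness

section DispersionRelation

open ComplexConjugate

namespace QPlus

variable {c : QPlus} {ω : ℝ → ℝ} {κ : ℝ}

theorem IsDispersionRelation.bigOmega_mul (hω : c.IsDispersionRelation ω) (κ : ℝ) :
    bigOmega (ω κ) * (c .a₁ * bigK κ + c .a₂) = -(c .a₁ + c .a₂ * bigK κ) := by
  have hsymbol := hω.2 κ
  rw [symbol] at hsymbol
  linear_combination hsymbol

theorem IsDispersionRelation.deriv_eq (hc : c.IsDispersive) (hω : c.IsDispersionRelation ω)
    (κ : ℝ) : ((deriv ω κ : ℝ) : ℂ) = bigK κ * (c .a₁ ^ 2 - c .a₂ ^ 2) /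
      ((c .a₁ * bigK κ + c .a₂) * (c .a₁ + c .a₂ * bigK κ)) := by
  have hΩ := hω.bigOmega_mul κ
  have hv := hω.group_velocity κ
  rw [eq_div_iff (mul_ne_zero (hc.mul_add_ne_zero (norm_bigK κ))
    (hc.add_mul_ne_zero (norm_bigK κ)))]
  rw [hΩ] at hv
  linear_combination (c .a₁ * bigK κ + c .a₂) * hv - bigK κ * c .a₁ * hΩ

theorem nlsDispersion_eq (hc : c.IsDispersive) (hω : c.IsDispersionRelation ω) :
    c.nlsDispersion ω κ = ((c .a₁ * c .a₂ * (c .a₁ ^ 2 - c .a₂ ^ 2) * Real.sin κ /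
      (c .a₁ ^ 2 + c .a₂ ^ 2 + 2 * c .a₁ * c .a₂ * Real.cos κ) ^ 2 : ℝ) : ℂ) := by
  have hA := hc.mul_add_ne_zero (norm_bigK κ)
  have hB := hc.add_mul_ne_zero (norm_bigK κ)
  have hK := bigK_ne_zero κ
  have hI := Complex.I_ne_zero
  have hinv : (bigK κ)⁻¹ = Complex.cos κ - Complex.sin κ * Complex.I := by
    rw [← conj_bigK, bigK_eq]
    simp [← Complex.ofReal_cos, ← Complex.ofReal_sin, sub_eq_add_neg]
  have hcos : Complex.cos κ = (bigK κ + (bigK κ)⁻¹) / 2 := by rw [hinv, bigK_eq]; ring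
  have hsin : Complex.sin κ = (bigK κ - (bigK κ)⁻¹) / (2 * Complex.I) := by
    rw [hinv, bigK_eq]; field_simp; ring
  have hdenominator : (c .a₁ ^ 2 + c .a₂ ^ 2 + 2 * c .a₁ * c .a₂ * Complex.cos κ : ℂ) =
      (c .a₁ * bigK κ + c .a₂) * (c .a₁ + c .a₂ * bigK κ) / bigK κ := by
    rw [hcos]; field_simp; ring
  push_cast
  rw [hdenominator, hsin, nlsDispersion, nlsFactor, hω.deriv_eq hc,
    eq_div_of_mul_eq hA (hω.bigOmega_mul κ)]
  set A : ℂ := c .a₁ * bigK κ + c .a₂ with hA_def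
  set B : ℂ := c .a₁ + c .a₂ * bigK κ with hB_def
  field_simp
  rw [hA_def, hB_def]
  ring

end QPlus

theorem exp_two_mul_arg_mul_conj (z : ℂ) :
    Complex.exp (2 * (z.arg * Complex.I)) * conj z = z := by
  have hconj : conj z = ‖z‖ * Complex.exp (-(z.arg * Complex.I)) := by
    conv_lhs => rw [← Complex.norm_mul_exp_arg_mul_I z, map_mul, ← Complex.exp_conj]
    simp
  rw [hconj, mul_left_comm, ← Complex.exp_add]
  conv_rhs => rw [← Complex.norm_mul_exp_arg_mul_I z]
  ring_nf

/-- Since `|β| < 1`, the curve `1 + β e^{iκ}` stays in the right half plane, where the principal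
argument is smooth. -/
theorem exists_differentiable_arg {β : ℝ} (hβ : |β| < 1) :
    ∃ θ : ℝ → ℝ, Differentiable ℝ θ ∧ ∀ κ : ℝ,
      Complex.exp (2 * (θ κ * Complex.I)) * (1 + β * (bigK κ)⁻¹) = 1 + β * bigK κ := by
  have hre (κ : ℝ) : 0 < (1 + β * bigK κ : ℂ).re := by
    have hle : |(β * bigK κ : ℂ).re| ≤ |β| := by
      refine (Complex.abs_re_le_norm _).trans ?_
      rw [norm_mul, norm_bigK, mul_one, Complex.norm_real, Real.norm_eq_abs]
    rw [Complex.add_re, Complex.one_re]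
    linarith [(abs_le.1 hle).1]
  refine ⟨fun κ => (Complex.log (1 + β * bigK κ)).im, fun κ => ?_, fun κ => ?_⟩
  · have hcurve : HasDerivAt (fun κ => 1 + β * bigK κ) _ κ :=
      ((hasDerivAt_bigK κ).const_mul (β : ℂ)).const_add 1
    exact Complex.imCLM.differentiableAt.comp κ
      (hcurve.clog_real (Or.inl (hre κ))).differentiableAt
  · simp only [Complex.log_im]
    simpa [conj_bigK] using exp_two_mul_arg_mul_conj (1 + β * bigK κ)

namespace QPlus

theorem exists_dispersionRelation_of_lt {c : QPlus} (ha₂ : c .a₂ ≠ 0)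
    (hlt : |c .a₁| < |c .a₂|) : ∃ ω, c.IsDispersionRelation ω := by
  obtain ⟨θ, hθ, hexp⟩ := exists_differentiable_arg (β := c .a₁ / c .a₂)
    (by rwa [abs_div, div_lt_one (abs_pos.2 ha₂)])
  refine ⟨fun κ => -κ + Real.pi + 2 * θ κ, by fun_prop, fun κ => ?_⟩
  have hpi : Complex.exp (-(Complex.I * Real.pi)) = -1 := by
    rw [Complex.exp_neg, mul_comm, Complex.exp_pi_mul_I]
    norm_num
  have hΩ : bigOmega (-κ + Real.pi + 2 * θ κ) =
      -1 * (bigK κ * (Complex.exp (2 * (θ κ * Complex.I)))⁻¹) := by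
    rw [← hpi, bigK, ← Complex.exp_neg, ← Complex.exp_add, ← Complex.exp_add, bigOmega]
    congr 1
    push_cast
    ring
  have hE : Complex.exp (2 * (θ κ * Complex.I)) ≠ 0 := Complex.exp_ne_zero _
  have hK := bigK_ne_zero κ
  have ha₂' : (c .a₂ : ℂ) ≠ 0 := by exact_mod_cast ha₂
  have hexp := hexp κ
  rw [symbol, hΩ]
  push_cast at hexp
  generalize Complex.exp (2 * (θ κ * Complex.I)) = E at *
  field_simp at hexp ⊢
  linear_combination hexp

theorem IsDispersionRelation.neg_of_swap {c c' : QPlus} {ω : ℝ → ℝ}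
    (hω : c.IsDispersionRelation ω) (h₁ : c' .a₁ = c .a₂) (h₂ : c' .a₂ = c .a₁) :
    c'.IsDispersionRelation (-ω) := by
  refine ⟨hω.1.neg, fun κ => ?_⟩
  have hsymbol := hω.2 κ
  have hΩ : bigOmega (-ω κ) = (bigOmega (ω κ))⁻¹ := by
    rw [bigOmega, bigOmega, ← Complex.exp_neg]
    simp
  have hne := bigOmega_ne_zero (ω κ)
  rw [symbol] at hsymbol
  rw [symbol, Pi.neg_apply, hΩ, h₁, h₂]
  field_simp
  linear_combination hsymbol

theorem IsDispersive.exists_dispersionRelation {c : QPlus} (hc : c.IsDispersive) :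
    ∃ ω, c.IsDispersionRelation ω := by
  obtain ⟨ha₁, ha₂, hne⟩ := hc
  rcases lt_or_gt_of_ne hne with hlt | hlt
  · exact exists_dispersionRelation_of_lt ha₂ hlt
  · let swapped : QPlus := fun p => if p = .a₁ then c .a₂ else c .a₁
    obtain ⟨ω, hω⟩ := exists_dispersionRelation_of_lt (c := swapped) ha₁ hlt
    exact ⟨-ω, hω.neg_of_swap rfl rfl⟩

end QPlus

end DispersionRelation

/-! ### The reality condition as an algebraic system -/

section RealitySystem

theorem det_eq_zero_of_mul_eq_zero {m₁₁ m₁₂ m₁₃ m₂₁ m₂₂ m₂₃ m₃₁ m₃₂ m₃₃ a b g : ℝ}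
    (h₁ : m₁₁ * a + m₁₂ * b + m₁₃ * g = 0) (h₂ : m₂₁ * a + m₂₂ * b + m₂₃ * g = 0)
    (h₃ : m₃₁ * a + m₃₂ * b + m₃₃ * g = 0) (h : ¬(a = 0 ∧ b = 0 ∧ g = 0)) :
    m₁₁ * (m₂₂ * m₃₃ - m₂₃ * m₃₂) - m₁₂ * (m₂₁ * m₃₃ - m₂₃ * m₃₁)
      + m₁₃ * (m₂₁ * m₃₂ - m₂₂ * m₃₁) = 0 := by
  have hdet : !![m₁₁, m₁₂, m₁₃; m₂₁, m₂₂, m₂₃; m₃₁, m₃₂, m₃₃].det = 0 :=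
    Matrix.exists_mulVec_eq_zero_iff.1 ⟨![a, b, g], by simpa using h, by
      simp only [Matrix.cons_mulVec, Matrix.empty_mulVec, Matrix.vec3_dotProduct, Matrix.cons_val,
        h₁, h₂, h₃, Matrix.cons_eq_zero_iff, true_and, Matrix.zero_empty]⟩
  simp only [Matrix.det_fin_three, Matrix.of_apply, Matrix.cons_val] at hdet
  linear_combination hdet

/-- The bilinear equations between `(α₂, β₂) = (A, B)` and the Möbius-reduced coefficients
`a, b, g` that are left after elimination of the cubic coefficients. -/
structure BilinearSystem (r A B a b g : ℝ) : Prop where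
  eq₁ : (-A * (1 + r ^ 2) + 4 * B * r) * a + (4 * A - 6 * B * r) * b
    + (A * (4 + r ^ 2) - B * r) * g = 0
  eq₂ : (A * (3 - r ^ 4) + 4 * B * r) * a + (4 * A * r ^ 2 - B * r * (9 + r ^ 2)) * b
    + (A * (r ^ 4 - 6 * r ^ 2) + B * r * (7 + 2 * r ^ 2)) * g = 0
  eq₃ : (A * r * (9 + r ^ 2) - 4 * B * r ^ 2) * a + (-4 * A * r + B * (r ^ 4 - 3)) * b
    + (-A * r * (7 + 2 * r ^ 2) + B * (6 * r ^ 2 - r ^ 4)) * g = 0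
  eq₄ : (6 * A * r - 4 * B) * a + (-4 * A * r + B * (1 + r ^ 2)) * b
    + (A * r - B * (4 + r ^ 2)) * g = 0

namespace BilinearSystem

variable {r A B a b g : ℝ}

theorem swap (h : BilinearSystem r A B a b g) : BilinearSystem r B A b a g where
  eq₁ := by linear_combination -h.eq₄
  eq₂ := by linear_combination -h.eq₃
  eq₃ := by linear_combination -h.eq₂
  eq₄ := by linear_combination -h.eq₁

theorem neg (h : BilinearSystem r A B a b g) : BilinearSystem (-r) A (-B) a b g where
  eq₁ := by linear_combination h.eq₁
  eq₂ := by linear_combination h.eq₂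
  eq₃ := by linear_combination -h.eq₃
  eq₄ := by linear_combination -h.eq₄

theorem of_eq_mul (h : BilinearSystem r A (r * A) a b g) (hr : r ≠ 0) (hA : A ≠ 0) :
    (r ^ 2 - 1) * a = 2 * r ^ 2 * g ∧ (r ^ 2 - 1) * b = (r ^ 2 + 1) * g := by
  have hdet : 3 * r ^ 2 + 5 ≠ 0 := by positivity
  have heq₁ : (3 * r ^ 2 - 1) * a + (4 - 6 * r ^ 2) * b + 4 * g = 0 := by
    apply mul_left_cancel₀ hA
    linear_combination h.eq₁
  have heq₄ : 2 * a + (r ^ 2 - 3) * b - (3 + r ^ 2) * g = 0 := by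
    apply mul_left_cancel₀ (mul_ne_zero hA hr)
    linear_combination h.eq₄
  constructor <;> apply mul_left_cancel₀ hdet
  · linear_combination (r ^ 2 - 3) * heq₁ - (4 - 6 * r ^ 2) * heq₄
  · linear_combination -2 * heq₁ + (3 * r ^ 2 - 1) * heq₄

theorem minor₁₂₃ (h : BilinearSystem r A B a b g) (hv : ¬(a = 0 ∧ b = 0 ∧ g = 0))
    (hBA : B ≠ r * A) (hAB : A ≠ r * B) :
    (-9 + 74 * r ^ 2 - r ^ 4) * A + r * (-24 - 39 * r ^ 2 - 2 * r ^ 4 + r ^ 6) * B = 0 := by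
  apply mul_left_cancel₀ (mul_ne_zero (sub_ne_zero.2 hBA) (sub_ne_zero.2 hAB))
  linear_combination (1 / 4) * det_eq_zero_of_mul_eq_zero h.eq₁ h.eq₂ h.eq₃ hv

theorem minor₁₂₄ (h : BilinearSystem r A B a b g) (hv : ¬(a = 0 ∧ b = 0 ∧ g = 0))
    (hBA : B ≠ r * A) (hAB : A ≠ r * B) :
    (15 + 58 * r ^ 2 - 9 * r ^ 4) * A = r * (55 + 10 * r ^ 2 - r ^ 4) * B := by
  apply mul_left_cancel₀ (mul_ne_zero (sub_ne_zero.2 hBA) (sub_ne_zero.2 hAB))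
  linear_combination (1 / 4) * det_eq_zero_of_mul_eq_zero h.eq₁ h.eq₂ h.eq₄ hv

theorem eq_neg_three (h : BilinearSystem r A A a b g) (hr : r ≠ 1) (hA : A ≠ 0)
    (hv : ¬(a = 0 ∧ b = 0 ∧ g = 0)) : r = -3 := by
  have hne : A ≠ r * A := fun hrA =>
    hr (mul_right_cancel₀ hA (hrA.symm.trans (one_mul A).symm))
  have hminor : -9 + 74 * r ^ 2 - r ^ 4 + r * (-24 - 39 * r ^ 2 - 2 * r ^ 4 + r ^ 6) = 0 := by
    apply mul_left_cancel₀ hA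
    linear_combination h.minor₁₂₃ hv hne hne
  have hfactor : (r - 1) ^ 2 * ((r + 3) * (r ^ 2 - 10 * r + 5)) = 0 := by
    apply mul_left_cancel₀ hA
    linear_combination h.minor₁₂₄ hv hne hne
  have hfactor := (mul_eq_zero.1 hfactor).resolve_left (pow_ne_zero 2 (sub_ne_zero.2 hr))
  refine eq_neg_of_add_eq_zero_left ((mul_eq_zero.1 hfactor).resolve_right fun hquadratic => ?_)
  -- The remainder of the first minor modulo this quadratic is linear, and its root does not fit.
  have hroot : r = 392704 / 743936 := by
    rw [eq_div_iff (by norm_num)]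
    linear_combination hminor - (r ^ 5 + 10 * r ^ 4 + 93 * r ^ 3 + 879 * r ^ 2 + 8286 * r + 78539)
      * hquadratic
  norm_num [hroot] at hquadratic

theorem of_eq (h : BilinearSystem r A A a b g) (hr : r ≠ 1) (hA : A ≠ 0)
    (hv : ¬(a = 0 ∧ b = 0 ∧ g = 0)) : r = -3 ∧ a = b ∧ g = 0 := by
  obtain rfl := h.eq_neg_three hr hA hv
  have heq₁ : 22 * a - 22 * b - 16 * g = 0 := by
    apply mul_left_cancel₀ hA
    linear_combination -h.eq₁
  have heq₄ : 22 * a - 22 * b + 16 * g = 0 := by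
    apply mul_left_cancel₀ hA
    linear_combination -h.eq₄
  exact ⟨rfl, by linarith, by linarith⟩

theorem eq_or_eq_neg (h : BilinearSystem r A B a b g) (hr : r ≠ 0)
    (hv : ¬(a = 0 ∧ b = 0 ∧ g = 0)) (hBA : B ≠ r * A) (hAB : A ≠ r * B) : A = B ∨ A = -B := by
  by_contra! hne
  have hminor := h.minor₁₂₄ hv hBA hAB
  have hminor' := h.swap.minor₁₂₄ (by tauto) hAB hBA
  have hsub : 15 + 58 * r ^ 2 - 9 * r ^ 4 - r * (55 + 10 * r ^ 2 - r ^ 4) = 0 := by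
    refine (mul_eq_zero.1 ?_).resolve_right fun h => hne.2 (eq_neg_of_add_eq_zero_left h)
    linear_combination hminor + hminor'
  have hadd : 15 + 58 * r ^ 2 - 9 * r ^ 4 + r * (55 + 10 * r ^ 2 - r ^ 4) = 0 := by
    refine (mul_eq_zero.1 ?_).resolve_right (sub_ne_zero.2 hne.1)
    linear_combination hminor - hminor'
  have hodd : 55 + 10 * r ^ 2 - r ^ 4 = 0 := by
    apply mul_left_cancel₀ hr
    linarith
  nlinarith [sq_nonneg r]

theorem solutions (h : BilinearSystem r A B a b g) (hr₀ : r ≠ 0) (hr₁ : r ≠ 1) (hr₂ : r ≠ -1) :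
    (A = 0 ∧ B = 0) ∨ (r = -3 ∧ A = B ∧ a = b ∧ g = 0) ∨ (r = 3 ∧ A = -B ∧ a = b ∧ g = 0) ∨
    (a = 0 ∧ b = 0 ∧ g = 0) ∨
    (B = r * A ∧ (r ^ 2 - 1) * a = 2 * r ^ 2 * g ∧ (r ^ 2 - 1) * b = (r ^ 2 + 1) * g) ∨
    (A = r * B ∧ (r ^ 2 - 1) * a = (r ^ 2 + 1) * g ∧ (r ^ 2 - 1) * b = 2 * r ^ 2 * g) := by
  by_cases hAB₀ : A = 0 ∧ B = 0
  · exact .inl hAB₀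
  refine .inr ?_
  by_cases hv : a = 0 ∧ b = 0 ∧ g = 0
  · exact .inr (.inr (.inl hv))
  by_cases hBA : B = r * A
  · subst hBA
    exact .inr (.inr (.inr (.inl ⟨rfl, h.of_eq_mul hr₀ fun hA => hAB₀ (by simp [hA])⟩)))
  by_cases hAB : A = r * B
  · subst hAB
    exact .inr (.inr (.inr (.inr
      ⟨rfl, (h.swap.of_eq_mul hr₀ fun hB => hAB₀ (by simp [hB])).symm⟩)))
  rcases h.eq_or_eq_neg hr₀ hv hBA hAB with rfl | rfl
  · obtain ⟨hr, hab, hg⟩ := h.of_eq hr₁ (by simpa using hAB₀) hv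
    exact .inl ⟨hr, rfl, hab, hg⟩
  · obtain ⟨hr, hab, hg⟩ := h.neg.of_eq (fun h => hr₂ (by linarith)) (by simpa using hAB₀) hv
    exact .inr (.inl ⟨neg_injective hr, rfl, hab, hg⟩)

end BilinearSystem

theorem bilinearSystem_mul {r A a b g : ℝ} (hr : r ^ 2 - 1 ≠ 0)
    (ha : (r ^ 2 - 1) * a = 2 * r ^ 2 * g) (hb : (r ^ 2 - 1) * b = (r ^ 2 + 1) * g) :
    BilinearSystem r A (r * A) a b g := by
  constructor <;> apply mul_left_cancel₀ hr
  · linear_combination (A * (3 * r ^ 2 - 1)) * ha + (A * (4 - 6 * r ^ 2)) * hb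
  · linear_combination (A * (3 - r ^ 4 + 4 * r ^ 2)) * ha + (A * (-5 * r ^ 2 - r ^ 4)) * hb
  · linear_combination (A * r * (9 - 3 * r ^ 2)) * ha + (A * r * (r ^ 4 - 7)) * hb
  · linear_combination (A * r * 2) * ha + (A * r * (r ^ 2 - 3)) * hb

theorem bilinearSystem_iff {r A B a b g : ℝ} (hr₀ : r ≠ 0) (hr₁ : r ≠ 1) (hr₂ : r ≠ -1) :
    BilinearSystem r A B a b g ↔
    (A = 0 ∧ B = 0) ∨ (r = -3 ∧ A = B ∧ a = b ∧ g = 0) ∨ (r = 3 ∧ A = -B ∧ a = b ∧ g = 0) ∨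
    (a = 0 ∧ b = 0 ∧ g = 0) ∨
    (B = r * A ∧ (r ^ 2 - 1) * a = 2 * r ^ 2 * g ∧ (r ^ 2 - 1) * b = (r ^ 2 + 1) * g) ∨
    (A = r * B ∧ (r ^ 2 - 1) * a = (r ^ 2 + 1) * g ∧ (r ^ 2 - 1) * b = 2 * r ^ 2 * g) := by
  have hr : r ^ 2 - 1 ≠ 0 := sub_ne_zero.2 (by simp [hr₁, hr₂])
  refine ⟨fun h => h.solutions hr₀ hr₁ hr₂, ?_⟩
  rintro (⟨rfl, rfl⟩ | ⟨rfl, rfl, rfl, rfl⟩ | ⟨rfl, rfl, rfl, rfl⟩ | ⟨rfl, rfl, rfl⟩ |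
    ⟨rfl, ha, hb⟩ | ⟨rfl, ha, hb⟩)
  · constructor <;> ring
  · constructor <;> ring
  · constructor <;> ring
  · constructor <;> ring
  · exact bilinearSystem_mul hr ha hb
  · exact (bilinearSystem_mul hr hb ha).swap

open Polynomial

/-- The coefficients of `numeratorPoly`. -/
def numeratorCoeff (r A B a b g X Y : ℝ) : Fin 6 → ℝ :=
  ![3 * r ^ 5 * (A * (a - b - g) - X),
    r ^ 3 * (A * (6 * (1 - r ^ 2) * a + 4 * r ^ 2 * b + 6 * r ^ 2 * g)
      + B * r * (3 * a - 7 * b - 7 * g) + 4 * X * (r ^ 2 - 2) + 5 * Y * r),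
    r * (A * ((3 - 4 * r ^ 2 - r ^ 4) * a + (3 + 12 * r ^ 2 - r ^ 4) * b
        + (3 - 8 * r ^ 2 + r ^ 4) * g)
      + 2 * B * r * ((2 * r ^ 2 - 4) * a - (1 + 3 * r ^ 2) * b + (4 * r ^ 2 - 1) * g)
      + X * (3 + 4 * r ^ 2 - r ^ 4) + 4 * Y * r * (4 - r ^ 2)),
    2 * A * r * ((1 + 3 * r ^ 2) * a + (4 - 2 * r ^ 2) * b + (1 - 4 * r ^ 2) * g)
      + B * ((r ^ 4 - 12 * r ^ 2 - 3) * a + (r ^ 4 + 4 * r ^ 2 - 3) * b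
        + (8 * r ^ 2 - r ^ 4 - 3) * g)
      + 4 * X * r * (4 - r ^ 2) + Y * (3 + 4 * r ^ 2 - r ^ 4),
    A * r * (7 * a - 3 * b + 7 * g) + B * (-4 * r ^ 2 * a + 6 * (r ^ 2 - 1) * b - 6 * r ^ 2 * g)
      + 5 * X * r + 4 * Y * (r ^ 2 - 2),
    3 * (B * (a - b + g) - Y)]

/-- The numerator of `Im ρ₂` as a polynomial in `tan² (κ / 2)`. -/
def numeratorPoly (r A B a b g X Y : ℝ) : ℝ[X] := ofFn 6 (numeratorCoeff r A B a b g X Y)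

theorem numeratorPoly_eval (r A B a b g X Y x : ℝ) : (numeratorPoly r A B a b g X Y).eval x =
    ∑ i, numeratorCoeff r A B a b g X Y i * x ^ (i : ℕ) := by
  simp only [numeratorPoly, ofFn_eq_sum_monomial, eval_finsetSum, eval_monomial]

theorem numeratorPoly_eq_zero_iff {r A B a b g X Y : ℝ} (hr : r ≠ 0) :
    numeratorPoly r A B a b g X Y = 0 ↔
      BilinearSystem r A B a b g ∧ X = A * (a - b - g) ∧ Y = B * (a - b + g) := by
  rw [numeratorPoly, (injective_iff_map_eq_zero' _).1 (injective_ofFn 6), funext_iff]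
  refine ⟨fun h => ?_, ?_⟩
  · have h₀ := h 0
    have h₁ := h 1
    have h₂ := h 2
    have h₃ := h 3
    have h₄ := h 4
    have h₅ := h 5
    simp only [numeratorCoeff, Fin.isValue, Matrix.cons_val, Pi.zero_apply] at h₀ h₁ h₂ h₃ h₄ h₅
    obtain rfl : X = A * (a - b - g) := by
      apply mul_left_cancel₀ (mul_ne_zero three_ne_zero (pow_ne_zero 5 hr))
      linear_combination -h₀
    obtain rfl : Y = B * (a - b + g) := by linarith
    refine ⟨⟨?_, ?_, ?_, ?_⟩, rfl, rfl⟩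
    · apply mul_left_cancel₀ (pow_ne_zero 3 hr)
      linear_combination (1 / 2) * h₁
    · apply mul_left_cancel₀ hr
      linear_combination (1 / 2) * h₂
    · linear_combination (1 / 2) * h₃
    · linear_combination (1 / 2) * h₄
  · rintro ⟨h, rfl, rfl⟩ i
    fin_cases i <;> simp only [numeratorCoeff, Fin.isValue, Fin.mk_one, Fin.zero_eta,
      Fin.reduceFinMk, Matrix.cons_val, Pi.zero_apply]
    · ring
    · linear_combination 2 * r ^ 3 * h.eq₁
    · linear_combination 2 * r * h.eq₂
    · linear_combination 2 * h.eq₃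
    · linear_combination 2 * h.eq₄
    · ring

/-- The denominator of the second harmonic, as a polynomial in `tan² (κ / 2)`. -/
def resonancePoly (r : ℝ) : ℝ[X] := X ^ 2 + C (3 - r ^ 2) * X + C (r ^ 2)

theorem resonancePoly_ne_zero (r : ℝ) : resonancePoly r ≠ 0 := by
  have hmonic : (resonancePoly r).Monic := by
    rw [resonancePoly]
    monicity!
  exact hmonic.ne_zero

theorem eq_zero_of_forall_pos {P Q : ℝ[X]} (hQ : Q ≠ 0)
    (h : ∀ x : ℝ, 0 < x → Q.eval x ≠ 0 → P.eval x = 0) : P = 0 := by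
  refine (mul_eq_zero.1 ?_).resolve_right hQ
  refine eq_zero_of_infinite_isRoot _ ((Set.Ioi_infinite (0 : ℝ)).mono fun x hx => ?_)
  rw [Set.mem_ofPred_eq, IsRoot, eval_mul, mul_eq_zero, or_iff_not_imp_right]
  exact h x hx

end RealitySystem

/-! ### Half angles -/

section HalfAngles

theorem bigK_add (x y : ℝ) : bigK (x + y) = bigK x * bigK y := by
  rw [bigK, bigK, bigK, ← Complex.exp_add, Complex.ofReal_add, mul_add]

theorem bigK_neg (x : ℝ) : bigK (-x) = (bigK x)⁻¹ := by
  rw [bigK, bigK, ← Complex.exp_neg, Complex.ofReal_neg, mul_neg]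

theorem bigK_sub (x y : ℝ) : bigK (x - y) = bigK x * (bigK y)⁻¹ := by
  rw [sub_eq_add_neg, bigK_add, bigK_neg]

theorem bigK_two_mul (x : ℝ) : bigK (2 * x) = bigK x ^ 2 := by
  rw [two_mul, bigK_add, sq]

theorem bigOmega_two_mul (w : ℝ) : bigOmega (2 * w) = bigOmega w ^ 2 := by
  rw [bigOmega, bigOmega, ← Complex.exp_nat_mul]
  push_cast
  ring_nf

theorem bigOmega_eq_inv_bigK (w : ℝ) : bigOmega w = (bigK w)⁻¹ := by
  rw [bigOmega, bigK, ← Complex.exp_neg]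

theorem bigK_re (x : ℝ) : (bigK x).re = Real.cos x := by
  rw [bigK, mul_comm, Complex.exp_ofReal_mul_I_re]

theorem bigK_im (x : ℝ) : (bigK x).im = Real.sin x := by
  rw [bigK, mul_comm, Complex.exp_ofReal_mul_I_im]

/-- The phase of the carrier wave at the corner `p` of the elementary square relative to its centre,
in the half angles `θ = κ / 2` and `φ = ω / 2`. -/
def cornerAngle (θ φ : ℝ) (p : Fin 2 × Fin 2) : ℝ :=
  (2 * (p.1 : ℕ) - 1) * θ - (2 * (p.2 : ℕ) - 1) * φ

theorem cornerPhase_two_mul (θ φ : ℝ) (p : Fin 2 × Fin 2) :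
    cornerPhase (bigK (2 * θ)) (bigOmega (2 * φ)) p = bigK (θ - φ) * bigK (cornerAngle θ φ p) := by
  rw [cornerPhase, cornerAngle, bigOmega_eq_inv_bigK, bigK, bigK, bigK, bigK, ← Complex.exp_neg,
    ← Complex.exp_nat_mul, ← Complex.exp_nat_mul, ← Complex.exp_add, ← Complex.exp_add]
  push_cast
  ring_nf

namespace QPlus

variable (c : QPlus) (θ φ : ℝ)

theorem mul_quadraticPart (z : ℂ) (f : Fin 2 × Fin 2 → Fin 2 × Fin 2 → ℂ) :
    z * c.quadraticPart f = c.quadraticPart fun p q => z * f p q :=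
  c.map_quadraticPart (LinearMap.mulLeft ℝ z) f

theorem mul_cubicPart (z : ℂ) (f : Fin 2 × Fin 2 → Fin 2 × Fin 2 → Fin 2 × Fin 2 → ℂ) :
    z * c.cubicPart f = c.cubicPart fun p q r => z * f p q r :=
  c.map_cubicPart (LinearMap.mulLeft ℝ z) f

theorem ofReal_quadraticPart (f : Fin 2 × Fin 2 → Fin 2 × Fin 2 → ℝ) :
    ((c.quadraticPart f : ℝ) : ℂ) = c.quadraticPart fun p q => (f p q : ℂ) :=
  c.map_quadraticPart Complex.ofRealAm.toLinearMap f

theorem quadraticPart_re (f : Fin 2 × Fin 2 → Fin 2 × Fin 2 → ℂ) :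
    (c.quadraticPart f).re = c.quadraticPart fun p q => (f p q).re :=
  c.map_quadraticPart Complex.reLm f

theorem quadraticPart_im (f : Fin 2 × Fin 2 → Fin 2 × Fin 2 → ℂ) :
    (c.quadraticPart f).im = c.quadraticPart fun p q => (f p q).im :=
  c.map_quadraticPart Complex.imLm f

theorem cubicPart_im (f : Fin 2 × Fin 2 → Fin 2 × Fin 2 → Fin 2 × Fin 2 → ℂ) :
    (c.cubicPart f).im = c.cubicPart fun p q r => (f p q r).im :=
  c.map_cubicPart Complex.imLm f

/-- `symbol (K²) (Ω²)`, multiplied by `(K Ω)⁻¹`. -/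
def halfResonance : ℝ := 2 * (c .a₁ * Real.cos (2 * θ - 2 * φ) + c .a₂ * Real.cos (2 * θ + 2 * φ))

/-- `meanCoeff`, which is real. -/
def halfMean : ℝ := c.quadraticPart fun p q => 2 * Real.cos (cornerAngle θ φ p - cornerAngle θ φ q)

/-- `secondCoeff`, multiplied by `(K Ω)⁻¹`. -/
def halfSecond : ℂ := c.quadraticPart fun p q => bigK (cornerAngle θ φ p + cornerAngle θ φ q)

/-- `meanCoupling`, multiplied by `(K Ω)^(-1/2)`. -/
def halfMeanCoupling : ℂ :=
  c.quadraticPart fun p q => bigK (cornerAngle θ φ p) + bigK (cornerAngle θ φ q)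

/-- `secondCoupling`, multiplied by `(K Ω)^(-1/2)`. -/
def halfSecondCoupling : ℂ :=
  c.quadraticPart fun p q => bigK (2 * cornerAngle θ φ q - cornerAngle θ φ p)
    + bigK (2 * cornerAngle θ φ p - cornerAngle θ φ q)

/-- `cubicCoeff`, multiplied by `(K Ω)^(-1/2)`. -/
def halfCubic : ℂ :=
  c.cubicPart fun p q r => bigK (-cornerAngle θ φ p + cornerAngle θ φ q + cornerAngle θ φ r)
    + bigK (cornerAngle θ φ p - cornerAngle θ φ q + cornerAngle θ φ r)
    + bigK (cornerAngle θ φ p + cornerAngle θ φ q - cornerAngle θ φ r)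

/-- `cubicTotal`, multiplied by `(K Ω)^(-1/2)`. -/
def halfTotal : ℂ :=
  c.halfCubic θ φ - c.halfMeanCoupling θ φ * (c.halfMean θ φ / (2 * (c .a₁ + c .a₂)) : ℝ)
    - c.halfSecondCoupling θ φ * c.halfSecond θ φ * ((c.halfResonance θ φ)⁻¹ : ℝ)

theorem cornerPhase_two_mul_eq : cornerPhase (bigK (2 * θ)) (bigOmega (2 * φ)) =
    fun p => bigK (θ - φ) * bigK (cornerAngle θ φ p) :=
  funext (cornerPhase_two_mul θ φ)

theorem linearPart_bigK_cornerAngle : c.linearPart (fun p => bigK (cornerAngle θ φ p)) =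
    (2 * (c .a₁ * Real.cos (θ - φ) + c .a₂ * Real.cos (θ + φ)) : ℝ) := by
  simp only [linearPart, cornerAngle, bigK_eq, Complex.real_smul]
  push_cast
  simp only [Fin.isValue, Fin.val_zero, Fin.val_one]
  ring_nf
  simp only [Complex.cos_add, Complex.cos_sub, Complex.sin_add, Complex.sin_sub, Complex.cos_neg,
    Complex.sin_neg]
  ring

theorem symbol_two_mul : c.symbol (bigK (2 * θ)) (bigOmega (2 * φ)) =
    bigK (θ - φ) * (2 * (c .a₁ * Real.cos (θ - φ) + c .a₂ * Real.cos (θ + φ)) : ℝ) := by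
  rw [← linearPart_cornerPhase, ← linearPart_bigK_cornerAngle, cornerPhase_two_mul_eq]
  exact (c.map_linearPart (LinearMap.mulLeft ℝ (bigK (θ - φ))) _).symm

theorem symbol_sq_two_mul : c.symbol (bigK (2 * θ) ^ 2) (bigOmega (2 * φ) ^ 2) =
    bigK (θ - φ) ^ 2 * c.halfResonance θ φ := by
  rw [← bigK_two_mul, ← bigOmega_two_mul, symbol_two_mul, halfResonance, ← mul_sub, bigK_two_mul]

theorem meanCoeff_two_mul :
    c.meanCoeff (bigK (2 * θ)) (bigOmega (2 * φ)) = c.halfMean θ φ := by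
  have hE := bigK_ne_zero (θ - φ)
  simp only [meanCoeff, halfMean, ofReal_quadraticPart, cornerPhase_two_mul]
  generalize bigK (θ - φ) = E at hE ⊢
  congr! 3 with p q
  generalize cornerAngle θ φ p = x
  generalize cornerAngle θ φ q = y
  calc (E * bigK x)⁻¹ * (E * bigK y) + E * bigK x * (E * bigK y)⁻¹
      = bigK (x - y) + bigK (-(x - y)) := by
        rw [neg_sub, bigK_sub, bigK_sub]
        field_simp
        ring
    _ = (2 * Real.cos (x - y) : ℝ) := by
        rw [bigK_eq, bigK_eq]
        push_cast
        rw [Complex.cos_neg, Complex.sin_neg]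
        ring

theorem secondCoeff_two_mul : c.secondCoeff (bigK (2 * θ)) (bigOmega (2 * φ)) =
    bigK (θ - φ) ^ 2 * c.halfSecond θ φ := by
  simp only [secondCoeff, halfSecond, mul_quadraticPart, cornerPhase_two_mul, bigK_add]
  ring_nf

theorem meanCoupling_two_mul : c.meanCoupling (bigK (2 * θ)) (bigOmega (2 * φ)) =
    bigK (θ - φ) * c.halfMeanCoupling θ φ := by
  simp only [meanCoupling, halfMeanCoupling, mul_quadraticPart, cornerPhase_two_mul, mul_add]

theorem secondCoupling_two_mul : c.secondCoupling (bigK (2 * θ)) (bigOmega (2 * φ)) =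
    bigK (θ - φ) * c.halfSecondCoupling θ φ := by
  have hE := bigK_ne_zero (θ - φ)
  simp only [secondCoupling, halfSecondCoupling, mul_quadraticPart, cornerPhase_two_mul]
  generalize bigK (θ - φ) = E at hE ⊢
  simp only [bigK_sub, bigK_two_mul]
  congr! 3 with p q
  field_simp

theorem cubicCoeff_two_mul : c.cubicCoeff (bigK (2 * θ)) (bigOmega (2 * φ)) =
    bigK (θ - φ) * c.halfCubic θ φ := by
  have hE := bigK_ne_zero (θ - φ)
  simp only [cubicCoeff, halfCubic, mul_cubicPart, cornerPhase_two_mul]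
  generalize bigK (θ - φ) = E at hE ⊢
  simp only [bigK_add, bigK_sub, bigK_neg]
  congr! 4 with p q r
  field_simp

theorem cubicTotal_two_mul : c.cubicTotal (bigK (2 * θ)) (bigOmega (2 * φ)) =
    bigK (θ - φ) * c.halfTotal θ φ := by
  have hE := bigK_ne_zero (θ - φ)
  rw [cubicTotal, meanResponse, secondResponse, cubicCoeff_two_mul, meanCoupling_two_mul,
    secondCoupling_two_mul, meanCoeff_two_mul, secondCoeff_two_mul, symbol_sq_two_mul,
    mul_div_mul_left _ _ (pow_ne_zero 2 hE), halfTotal]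
  push_cast
  ring

variable {c} {ω : ℝ → ℝ} {κ : ℝ}

theorem IsDispersionRelation.half_angles (hω : c.IsDispersionRelation ω) (κ : ℝ) :
    c .a₁ * Real.cos (κ / 2 - ω κ / 2) + c .a₂ * Real.cos (κ / 2 + ω κ / 2) = 0 := by
  have hsymbol := c.symbol_two_mul (κ / 2) (ω κ / 2)
  rw [mul_div_cancel₀ _ two_ne_zero, mul_div_cancel₀ _ two_ne_zero, hω.2 κ] at hsymbol
  have hreal := (mul_eq_zero.1 hsymbol.symm).resolve_left (bigK_ne_zero _)
  exact (mul_eq_zero.1 (Complex.ofReal_eq_zero.1 hreal)).resolve_left two_ne_zero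

theorem nonResonant_iff : c.NonResonant ω κ ↔ c.halfResonance (κ / 2) (ω κ / 2) ≠ 0 := by
  have hsymbol := c.symbol_sq_two_mul (κ / 2) (ω κ / 2)
  rw [mul_div_cancel₀ _ two_ne_zero, mul_div_cancel₀ _ two_ne_zero] at hsymbol
  rw [NonResonant, hsymbol, mul_ne_zero_iff, and_iff_right (pow_ne_zero 2 (bigK_ne_zero _)),
    Complex.ofReal_ne_zero]

theorem IsDispersionRelation.nlsFactor_eq (hω : c.IsDispersionRelation ω) (κ : ℝ) :
    c.nlsFactor ω κ = bigK (κ / 2 - ω κ / 2) *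
      (c .a₁ * Real.sin (κ / 2 - ω κ / 2) - c .a₂ * Real.sin (κ / 2 + ω κ / 2) : ℝ) := by
  have hdispersion := hω.half_angles κ
  set θ := κ / 2 with hθ
  set φ := ω κ / 2 with hφ
  have hK : bigK κ = bigK (θ - φ) * bigK (θ + φ) := by
    rw [← bigK_add, hθ]
    ring_nf
  have hΩ : bigOmega (ω κ) = bigK (θ - φ) * (bigK (θ + φ))⁻¹ := by
    rw [← bigK_sub, bigOmega_eq_inv_bigK, ← bigK_neg, hφ]
    ring_nf
  have hplus := bigK_ne_zero (θ + φ)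
  have hsum : -Complex.I * (c .a₁ * bigK (θ - φ) + c .a₂ * (bigK (θ + φ))⁻¹) =
      (c .a₁ * Real.sin (θ - φ) - c .a₂ * Real.sin (θ + φ) : ℝ) := by
    rw [← bigK_neg]
    apply Complex.ext
    · simp only [Complex.add_re, Complex.add_im, Complex.mul_re, Complex.mul_im, Complex.neg_re,
        Complex.neg_im, Complex.I_re, Complex.I_im, Complex.ofReal_re, Complex.ofReal_im, bigK_re,
        bigK_im, Real.sin_neg]
      ring
    · simp only [Complex.add_re, Complex.add_im, Complex.mul_re, Complex.mul_im, Complex.neg_re,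
        Complex.neg_im, Complex.I_re, Complex.I_im, Complex.ofReal_re, Complex.ofReal_im, bigK_re,
        bigK_im, Real.cos_neg]
      linear_combination -hdispersion
  rw [← hsum, nlsFactor, hK, hΩ]
  field_simp

theorem nlsNonlinearity_im_eq_zero_iff (hc : c.IsDispersive) (hω : c.IsDispersionRelation ω) :
    (c.nlsNonlinearity ω κ).im = 0 ↔ (c.halfTotal (κ / 2) (ω κ / 2)).im = 0 := by
  have hE := bigK_ne_zero (κ / 2 - ω κ / 2)
  have htotal := c.cubicTotal_two_mul (κ / 2) (ω κ / 2)
  rw [mul_div_cancel₀ _ two_ne_zero, mul_div_cancel₀ _ two_ne_zero] at htotal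
  have hne := nlsFactor_ne_zero (ω := ω) (κ := κ) hc
  rw [hω.nlsFactor_eq] at hne
  rw [nlsNonlinearity, htotal, hω.nlsFactor_eq, mul_div_mul_left _ _ hE, Complex.div_ofReal_im,
    div_eq_zero_iff, or_iff_left (Complex.ofReal_ne_zero.1 (right_ne_zero_of_mul hne))]

end QPlus

end HalfAngles

section HalfAngleFormulas

namespace QPlus

variable (c : QPlus) (θ φ : ℝ)

theorem halfResonance_eq : c.halfResonance θ φ =
    2 * ((c .a₁ + c .a₂) * (Real.cos (2 * θ) * Real.cos (2 * φ))
      + (c .a₁ - c .a₂) * (Real.sin (2 * θ) * Real.sin (2 * φ))) := by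
  rw [halfResonance, Real.cos_add, Real.cos_sub]
  ring

theorem halfMean_eq : c.halfMean θ φ =
    4 * c .α₁ * Real.cos (2 * θ) + 4 * c .β₁ * Real.cos (2 * φ)
      + 2 * (c .γ₁ + c .γ₂) * (Real.cos (2 * θ) * Real.cos (2 * φ))
      + 2 * (c .γ₁ - c .γ₂) * (Real.sin (2 * θ) * Real.sin (2 * φ)) := by
  simp only [halfMean, quadraticPart, cornerAngle, smul_eq_mul, Fin.isValue, Fin.val_zero,
    Fin.val_one]
  push_cast
  ring_nf
  simp only [Real.cos_add, Real.cos_neg, Real.sin_neg]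
  ring

theorem halfSecond_re : (c.halfSecond θ φ).re =
    2 * c .α₁ * Real.cos (2 * φ) + 2 * c .β₁ * Real.cos (2 * θ) + (c .γ₁ + c .γ₂) := by
  rw [halfSecond, quadraticPart_re]
  simp only [bigK_re, quadraticPart, cornerAngle, smul_eq_mul, Fin.isValue, Fin.val_zero,
    Fin.val_one]
  push_cast
  ring_nf
  simp only [Real.cos_neg, Real.cos_zero]
  ring

theorem halfSecond_im : (c.halfSecond θ φ).im =
    2 * c .β₂ * Real.sin (2 * θ) - 2 * c .α₂ * Real.sin (2 * φ) := by
  rw [halfSecond, quadraticPart_im]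
  simp only [bigK_im, quadraticPart, cornerAngle, smul_eq_mul, Fin.isValue, Fin.val_zero,
    Fin.val_one]
  push_cast
  ring_nf
  simp only [Real.sin_neg, Real.sin_zero]
  ring

theorem halfSecondCoupling_re : (c.halfSecondCoupling θ φ).re =
    4 * c .α₁ * (Real.cos (3 * θ) * Real.cos φ) + 4 * c .β₁ * (Real.cos θ * Real.cos (3 * φ))
      + 2 * (c .γ₁ + c .γ₂) * (Real.cos (3 * θ) * Real.cos (3 * φ))
      + 2 * (c .γ₁ - c .γ₂) * (Real.sin (3 * θ) * Real.sin (3 * φ)) := by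
  rw [halfSecondCoupling, quadraticPart_re]
  simp only [bigK_re, Complex.add_re, quadraticPart, cornerAngle, smul_eq_mul, Fin.isValue,
    Fin.val_zero, Fin.val_one]
  push_cast
  ring_nf
  simp only [Real.cos_add, Real.cos_sub, Real.cos_neg, Real.sin_neg]
  ring

theorem halfSecondCoupling_im : (c.halfSecondCoupling θ φ).im =
    4 * c .β₂ * (Real.sin θ * Real.cos (3 * φ)) - 4 * c .α₂ * (Real.cos (3 * θ) * Real.sin φ) := by
  rw [halfSecondCoupling, quadraticPart_im]
  simp only [bigK_im, Complex.add_im, quadraticPart, cornerAngle, smul_eq_mul, Fin.isValue,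
    Fin.val_zero, Fin.val_one]
  push_cast
  ring_nf
  simp only [Real.sin_add, Real.sin_sub, Real.cos_neg, Real.sin_neg]
  ring

theorem halfMeanCoupling_im : (c.halfMeanCoupling θ φ).im =
    4 * (c .β₂ * (Real.sin θ * Real.cos φ) - c .α₂ * (Real.cos θ * Real.sin φ)) := by
  rw [halfMeanCoupling, quadraticPart_im]
  simp only [bigK_im, Complex.add_im, quadraticPart, cornerAngle, smul_eq_mul, Fin.isValue,
    Fin.val_zero, Fin.val_one]
  push_cast
  ring_nf
  simp only [Real.sin_add, Real.sin_sub, Real.cos_neg, Real.sin_neg]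
  ring

theorem halfCubic_im : (c.halfCubic θ φ).im =
    2 * (c .ξ₁ - c .ξ₂) * (Real.cos θ * Real.sin (3 * φ) - Real.cos (3 * θ) * Real.sin φ
        - Real.cos θ * Real.sin φ)
      + 2 * (c .ξ₃ - c .ξ₄) * (Real.sin (3 * θ) * Real.cos φ - Real.sin θ * Real.cos (3 * φ)
        - Real.sin θ * Real.cos φ) := by
  rw [halfCubic, cubicPart_im]
  simp only [bigK_im, Complex.add_im, cubicPart, cornerAngle, smul_eq_mul, Fin.isValue,
    Fin.val_zero, Fin.val_one]
  push_cast
  ring_nf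
  simp only [Real.sin_add, Real.sin_sub, Real.cos_neg, Real.sin_neg]
  ring

theorem halfTotal_im : (c.halfTotal θ φ).im =
    (c.halfCubic θ φ).im - (c.halfMeanCoupling θ φ).im * (c.halfMean θ φ / (2 * (c .a₁ + c .a₂)))
      - ((c.halfSecondCoupling θ φ).re * (c.halfSecond θ φ).im
        + (c.halfSecondCoupling θ φ).im * (c.halfSecond θ φ).re) / c.halfResonance θ φ := by
  rw [halfTotal, Complex.sub_im, Complex.sub_im, Complex.im_mul_ofReal, Complex.im_mul_ofReal,
    Complex.mul_im, ← div_eq_mul_inv]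

end QPlus

theorem cos_two_mul_of_tan {θ : ℝ} (hθ : Real.cos θ ≠ 0) :
    Real.cos (2 * θ) = (1 - Real.tan θ ^ 2) / (1 + Real.tan θ ^ 2) := by
  rw [div_eq_mul_inv, Real.inv_one_add_tan_sq hθ, Real.cos_two_mul', ← Real.tan_mul_cos hθ]
  ring

theorem sin_two_mul_of_tan {θ : ℝ} (hθ : Real.cos θ ≠ 0) :
    Real.sin (2 * θ) = 2 * Real.tan θ / (1 + Real.tan θ ^ 2) := by
  rw [div_eq_mul_inv, Real.inv_one_add_tan_sq hθ, Real.sin_two_mul, ← Real.tan_mul_cos hθ]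
  ring

theorem cos_three_mul_of_tan {θ : ℝ} (hθ : Real.cos θ ≠ 0) :
    Real.cos (3 * θ) = Real.cos θ * ((1 - 3 * Real.tan θ ^ 2) / (1 + Real.tan θ ^ 2)) := by
  rw [div_eq_mul_inv, Real.inv_one_add_tan_sq hθ, Real.cos_three_mul, Real.tan_eq_sin_div_cos]
  field_simp
  linear_combination (3 : ℝ) * Real.cos_sq_add_sin_sq θ

theorem sin_three_mul_of_tan {θ : ℝ} (hθ : Real.cos θ ≠ 0) :
    Real.sin (3 * θ) =
      Real.cos θ * (Real.tan θ * (3 - Real.tan θ ^ 2) / (1 + Real.tan θ ^ 2)) := by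
  rw [div_eq_mul_inv, Real.inv_one_add_tan_sq hθ, Real.sin_three_mul, Real.tan_eq_sin_div_cos]
  field_simp
  linear_combination -3 * Real.sin θ * Real.cos_sq_add_sin_sq θ

end HalfAngleFormulas

section ReducedCoordinates

open Polynomial

/-- Coordinates adapted to the reality condition: `a₁ = (r - 1) τ`, `a₂ = (r + 1) τ`, and
`a, b, g, X, Y` are the coefficients after a Möbius transformation with parameter `m` which makes
the two diagonal quadratic coefficients equal. -/
structure ReducedCoordinates (c : QPlus) (r τ m a b g X Y : ℝ) : Prop where
  a₁_eq : c .a₁ = (r - 1) * τ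
  a₂_eq : c .a₂ = (r + 1) * τ
  α₁_eq : c .α₁ = a + 2 * r * τ * m
  β₁_eq : c .β₁ = b + 2 * r * τ * m
  γ₁_eq : c .γ₁ = g + 2 * (r - 1) * τ * m
  γ₂_eq : c .γ₂ = g + 2 * (r + 1) * τ * m
  ξ₁_sub_ξ₂ : c .ξ₁ - c .ξ₂ = X / (r * τ) - 2 * m * c .α₂
  ξ₃_sub_ξ₄ : c .ξ₃ - c .ξ₄ = Y / (r * τ) + 2 * m * c .β₂
  r_ne_zero : r ≠ 0
  r_ne_one : r ≠ 1
  r_ne_neg_one : r ≠ -1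
  τ_ne_zero : τ ≠ 0

theorem exists_reducedCoordinates {c : QPlus} (hc : c.IsDispersive) :
    ∃ r τ m a b g X Y, ReducedCoordinates c r τ m a b g X Y := by
  have hsum := hc.add_ne_zero
  have hdiff : c .a₂ - c .a₁ ≠ 0 := fun h => hc.sub_ne_zero (by linarith)
  set τ := (c .a₂ - c .a₁) / 2 with hτ
  set r := (c .a₁ + c .a₂) / (c .a₂ - c .a₁) with hr
  set m := (c .γ₂ - c .γ₁) / (4 * τ) with hm
  have hτ₀ : τ ≠ 0 := div_ne_zero hdiff two_ne_zero
  have hr₀ : r ≠ 0 := div_ne_zero hsum hdiff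
  have hrτ : r * τ = (c .a₁ + c .a₂) / 2 := by rw [hr, hτ]; field_simp
  have hτm : τ * m = (c .γ₂ - c .γ₁) / 4 := by rw [hm]; field_simp
  refine ⟨r, τ, m, c .α₁ - 2 * r * τ * m, c .β₁ - 2 * r * τ * m, c .γ₁ - 2 * (r - 1) * τ * m,
    r * τ * (c .ξ₁ - c .ξ₂ + 2 * m * c .α₂), r * τ * (c .ξ₃ - c .ξ₄ - 2 * m * c .β₂),
    ?_, ?_, by ring, by ring, by ring, ?_, ?_, ?_, hr₀, fun h => ?_, fun h => ?_, hτ₀⟩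
  · linear_combination hτ - hrτ
  · linear_combination -hrτ - hτ
  · linear_combination -4 * hτm
  · rw [mul_div_cancel_left₀ _ (mul_ne_zero hr₀ hτ₀)]
    ring
  · rw [mul_div_cancel_left₀ _ (mul_ne_zero hr₀ hτ₀)]
    ring
  · rw [h] at hrτ
    exact hc.1 (by linarith)
  · rw [h] at hrτ
    exact hc.2.1 (by linarith)

namespace ReducedCoordinates

variable {c : QPlus} {r τ m a b g X Y θ φ : ℝ}

theorem add_eq (h : ReducedCoordinates c r τ m a b g X Y) : c .a₁ + c .a₂ = 2 * r * τ := by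
  rw [h.a₁_eq, h.a₂_eq]
  ring

theorem dispersion_iff (h : ReducedCoordinates c r τ m a b g X Y) :
    c .a₁ * Real.cos (θ - φ) + c .a₂ * Real.cos (θ + φ) = 0 ↔
      Real.sin θ * Real.sin φ = r * (Real.cos θ * Real.cos φ) := by
  have hexpand : c .a₁ * Real.cos (θ - φ) + c .a₂ * Real.cos (θ + φ) =
      2 * τ * (r * (Real.cos θ * Real.cos φ) - Real.sin θ * Real.sin φ) := by
    rw [h.a₁_eq, h.a₂_eq, Real.cos_sub, Real.cos_add]
    ring
  rw [hexpand, mul_eq_zero_iff_left (mul_ne_zero two_ne_zero h.τ_ne_zero), sub_eq_zero, eq_comm]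

theorem halfResonance_eq_of_tan (h : ReducedCoordinates c r τ m a b g X Y)
    (hθ : Real.cos θ ≠ 0) (hφ : Real.cos φ ≠ 0) (htan : Real.tan θ * Real.tan φ = r) :
    c.halfResonance θ φ = -4 * r * τ * (resonancePoly r).eval (Real.tan θ ^ 2) /
      ((1 + Real.tan θ ^ 2) * (Real.tan θ ^ 2 + r ^ 2)) := by
  have hp : Real.tan θ ≠ 0 := left_ne_zero_of_mul (htan ▸ h.r_ne_zero)
  rw [c.halfResonance_eq, cos_two_mul_of_tan hθ, cos_two_mul_of_tan hφ, sin_two_mul_of_tan hθ,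
    sin_two_mul_of_tan hφ, h.a₁_eq, h.a₂_eq, eq_div_of_mul_eq hp ((mul_comm _ _).trans htan)]
  simp only [resonancePoly, eval_add, eval_pow, eval_X, eval_mul, eval_C]
  generalize Real.tan θ = p at hp ⊢
  field_simp
  ring

theorem halfTotal_im_eq_of_tan (h : ReducedCoordinates c r τ m a b g X Y)
    (hθ : Real.cos θ ≠ 0) (hφ : Real.cos φ ≠ 0) (htan : Real.tan θ * Real.tan φ = r)
    (hres : (resonancePoly r).eval (Real.tan θ ^ 2) ≠ 0) :
    (c.halfTotal θ φ).im = Real.cos θ * Real.cos φ *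
      (2 * (numeratorPoly r (c .α₂) (c .β₂) a b g X Y).eval (Real.tan θ ^ 2)) /
        (Real.tan θ * r * τ * (resonancePoly r).eval (Real.tan θ ^ 2) *
          ((1 + Real.tan θ ^ 2) * (Real.tan θ ^ 2 + r ^ 2))) := by
  have hr := h.r_ne_zero
  have hτ := h.τ_ne_zero
  have hp : Real.tan θ ≠ 0 := left_ne_zero_of_mul (htan ▸ hr)
  have hresonance : (resonancePoly r).eval (Real.tan θ ^ 2) =
      (Real.tan θ ^ 2) ^ 2 + (3 - r ^ 2) * Real.tan θ ^ 2 + r ^ 2 := by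
    simp only [resonancePoly, eval_add, eval_pow, eval_X, eval_mul, eval_C]
  rw [c.halfTotal_im, h.halfResonance_eq_of_tan hθ hφ htan, c.halfCubic_im, c.halfMeanCoupling_im,
    c.halfMean_eq, c.halfSecondCoupling_re, c.halfSecondCoupling_im, c.halfSecond_re,
    c.halfSecond_im, cos_two_mul_of_tan hθ, cos_two_mul_of_tan hφ, sin_two_mul_of_tan hθ,
    sin_two_mul_of_tan hφ, cos_three_mul_of_tan hθ, cos_three_mul_of_tan hφ,
    sin_three_mul_of_tan hθ, sin_three_mul_of_tan hφ, ← Real.tan_mul_cos hθ,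
    ← Real.tan_mul_cos hφ, h.add_eq, h.α₁_eq, h.β₁_eq, h.γ₁_eq, h.γ₂_eq, h.ξ₁_sub_ξ₂, h.ξ₃_sub_ξ₄,
    eq_div_of_mul_eq hp ((mul_comm _ _).trans htan), numeratorPoly_eval]
  generalize (resonancePoly r).eval (Real.tan θ ^ 2) = D at hres hresonance ⊢
  generalize Real.tan θ = p at hp hresonance ⊢
  simp only [numeratorCoeff, Fin.sum_univ_six, Fin.isValue, Matrix.cons_val, Fin.coe_ofNat_eq_mod,
    Nat.reduceMod, Nat.zero_mod, Nat.one_mod]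
  field_simp
  rw [hresonance]
  ring

theorem tan_mul_tan (h : ReducedCoordinates c r τ m a b g X Y)
    (hdisp : c .a₁ * Real.cos (θ - φ) + c .a₂ * Real.cos (θ + φ) = 0)
    (hθ : Real.cos θ ≠ 0) (hφ : Real.cos φ ≠ 0) : Real.tan θ * Real.tan φ = r := by
  rw [Real.tan_eq_sin_div_cos, Real.tan_eq_sin_div_cos, div_mul_div_comm,
    h.dispersion_iff.1 hdisp, mul_div_cancel_right₀ _ (mul_ne_zero hθ hφ)]

theorem halfTotal_im_of_cos_left_eq_zero (h : ReducedCoordinates c r τ m a b g X Y)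
    (hY : Y = c .β₂ * (a - b + g)) (hθ : Real.cos θ = 0) (hφ : Real.sin φ = 0) :
    (c.halfTotal θ φ).im = 0 := by
  have hr := h.r_ne_zero
  have hτ := h.τ_ne_zero
  have hsin : Real.sin θ ^ 2 = 1 := by rw [Real.sin_sq, hθ]; ring
  have hcos : Real.cos φ ^ 2 = 1 := by rw [Real.cos_sq', hφ]; ring
  have hcos_two_θ : Real.cos (2 * θ) = -1 := by rw [Real.cos_two_mul, hθ]; ring
  have hsin_two_θ : Real.sin (2 * θ) = 0 := by rw [Real.sin_two_mul, hθ, mul_zero]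
  have hcos_three_θ : Real.cos (3 * θ) = 0 := by rw [Real.cos_three_mul, hθ]; ring
  have hsin_three_θ : Real.sin (3 * θ) = -Real.sin θ := by
    rw [Real.sin_three_mul]
    linear_combination -4 * Real.sin θ * hsin
  have hcos_two_φ : Real.cos (2 * φ) = 1 := by rw [Real.cos_two_mul, hcos]; norm_num
  have hsin_two_φ : Real.sin (2 * φ) = 0 := by rw [Real.sin_two_mul, hφ]; ring
  have hcos_three_φ : Real.cos (3 * φ) = Real.cos φ := by
    rw [Real.cos_three_mul]
    linear_combination 4 * Real.cos φ * hcos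
  have hsin_three_φ : Real.sin (3 * φ) = 0 := by rw [Real.sin_three_mul, hφ]; ring
  rw [c.halfTotal_im, c.halfResonance_eq, c.halfCubic_im, c.halfMeanCoupling_im, c.halfMean_eq,
    c.halfSecondCoupling_re, c.halfSecondCoupling_im, c.halfSecond_re, c.halfSecond_im,
    hcos_two_θ, hsin_two_θ, hcos_three_θ, hsin_three_θ, hcos_two_φ, hsin_two_φ, hcos_three_φ,
    hsin_three_φ, hθ, hφ, h.add_eq, h.α₁_eq, h.β₁_eq, h.γ₁_eq, h.γ₂_eq, h.ξ₃_sub_ξ₄, hY]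
  field_simp
  ring

theorem halfTotal_im_of_cos_right_eq_zero (h : ReducedCoordinates c r τ m a b g X Y)
    (hX : X = c .α₂ * (a - b - g)) (hθ : Real.sin θ = 0) (hφ : Real.cos φ = 0) :
    (c.halfTotal θ φ).im = 0 := by
  have hr := h.r_ne_zero
  have hτ := h.τ_ne_zero
  have hcos : Real.cos θ ^ 2 = 1 := by rw [Real.cos_sq', hθ]; ring
  have hsin : Real.sin φ ^ 2 = 1 := by rw [Real.sin_sq, hφ]; ring
  have hcos_two_θ : Real.cos (2 * θ) = 1 := by rw [Real.cos_two_mul, hcos]; norm_num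
  have hsin_two_θ : Real.sin (2 * θ) = 0 := by rw [Real.sin_two_mul, hθ]; ring
  have hcos_three_θ : Real.cos (3 * θ) = Real.cos θ := by
    rw [Real.cos_three_mul]
    linear_combination 4 * Real.cos θ * hcos
  have hsin_three_θ : Real.sin (3 * θ) = 0 := by rw [Real.sin_three_mul, hθ]; ring
  have hcos_two_φ : Real.cos (2 * φ) = -1 := by rw [Real.cos_two_mul, hφ]; ring
  have hsin_two_φ : Real.sin (2 * φ) = 0 := by rw [Real.sin_two_mul, hφ, mul_zero]
  have hcos_three_φ : Real.cos (3 * φ) = 0 := by rw [Real.cos_three_mul, hφ]; ring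
  have hsin_three_φ : Real.sin (3 * φ) = -Real.sin φ := by
    rw [Real.sin_three_mul]
    linear_combination -4 * Real.sin φ * hsin
  rw [c.halfTotal_im, c.halfResonance_eq, c.halfCubic_im, c.halfMeanCoupling_im, c.halfMean_eq,
    c.halfSecondCoupling_re, c.halfSecondCoupling_im, c.halfSecond_re, c.halfSecond_im,
    hcos_two_θ, hsin_two_θ, hcos_three_θ, hsin_three_θ, hcos_two_φ, hsin_two_φ, hcos_three_φ,
    hsin_three_φ, hθ, hφ, h.add_eq, h.α₁_eq, h.β₁_eq, h.γ₁_eq, h.γ₂_eq, h.ξ₁_sub_ξ₂, hX]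
  field_simp
  ring

theorem halfTotal_im_eq_zero (h : ReducedCoordinates c r τ m a b g X Y)
    (hpoly : numeratorPoly r (c .α₂) (c .β₂) a b g X Y = 0)
    (hdisp : c .a₁ * Real.cos (θ - φ) + c .a₂ * Real.cos (θ + φ) = 0)
    (hres : c.halfResonance θ φ ≠ 0) : (c.halfTotal θ φ).im = 0 := by
  obtain ⟨-, hX, hY⟩ := (numeratorPoly_eq_zero_iff h.r_ne_zero).1 hpoly
  have hprod := h.dispersion_iff.1 hdisp
  by_cases hθ : Real.cos θ = 0
  · rw [hθ, zero_mul, mul_zero, mul_eq_zero] at hprod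
    refine h.halfTotal_im_of_cos_left_eq_zero hY hθ (hprod.resolve_left fun hsin => ?_)
    simpa [hθ, hsin] using Real.cos_sq_add_sin_sq θ
  by_cases hφ : Real.cos φ = 0
  · rw [hφ, mul_zero, mul_zero, mul_eq_zero] at hprod
    refine h.halfTotal_im_of_cos_right_eq_zero hX (hprod.resolve_right fun hsin => ?_) hφ
    simpa [hφ, hsin] using Real.cos_sq_add_sin_sq φ
  have htan := h.tan_mul_tan hdisp hθ hφ
  have hpoly_ne : (resonancePoly r).eval (Real.tan θ ^ 2) ≠ 0 := fun hzero =>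
    hres (by rw [h.halfResonance_eq_of_tan hθ hφ htan, hzero, mul_zero, zero_div])
  rw [h.halfTotal_im_eq_of_tan hθ hφ htan hpoly_ne, hpoly, eval_zero, mul_zero, mul_zero, zero_div]

theorem numeratorPoly_eval_eq_zero (h : ReducedCoordinates c r τ m a b g X Y)
    (hθ : Real.cos θ ≠ 0) (hsin : Real.sin θ ≠ 0)
    (hdisp : c .a₁ * Real.cos (θ - φ) + c .a₂ * Real.cos (θ + φ) = 0)
    (hres : (resonancePoly r).eval (Real.tan θ ^ 2) ≠ 0)
    (hreal : c.halfResonance θ φ ≠ 0 → (c.halfTotal θ φ).im = 0) :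
    (numeratorPoly r (c .α₂) (c .β₂) a b g X Y).eval (Real.tan θ ^ 2) = 0 := by
  have hr := h.r_ne_zero
  have hτ := h.τ_ne_zero
  have hφ : Real.cos φ ≠ 0 := fun hφ => by
    have hprod := h.dispersion_iff.1 hdisp
    rw [hφ, mul_zero, mul_zero, mul_eq_zero, or_iff_right hsin] at hprod
    simpa [hφ, hprod] using Real.cos_sq_add_sin_sq φ
  have htan := h.tan_mul_tan hdisp hθ hφ
  have hp : Real.tan θ ≠ 0 := left_ne_zero_of_mul (htan ▸ hr)
  have hden : (1 + Real.tan θ ^ 2) * (Real.tan θ ^ 2 + r ^ 2) ≠ 0 := by positivity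
  have him := hreal <| by
    rw [h.halfResonance_eq_of_tan hθ hφ htan]
    exact div_ne_zero (by simp [hr, hτ, hres]) hden
  rw [h.halfTotal_im_eq_of_tan hθ hφ htan hres, div_eq_zero_iff] at him
  simpa [hθ, hφ, hp, hr, hτ, hres, hden] using him

theorem forall_nlsNonlinearity_im_eq_zero_iff {ω : ℝ → ℝ} (hc : c.IsDispersive)
    (hω : c.IsDispersionRelation ω) (h : ReducedCoordinates c r τ m a b g X Y) :
    (∀ κ, c.NonResonant ω κ → (c.nlsNonlinearity ω κ).im = 0) ↔
      numeratorPoly r (c .α₂) (c .β₂) a b g X Y = 0 := by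
  simp only [QPlus.nonResonant_iff, QPlus.nlsNonlinearity_im_eq_zero_iff hc hω]
  refine ⟨fun hreal => ?_, fun hpoly κ => h.halfTotal_im_eq_zero hpoly (hω.half_angles κ)⟩
  refine eq_zero_of_forall_pos (resonancePoly_ne_zero r) fun x hx hres => ?_
  have hκ : 2 * Real.arctan √x / 2 = Real.arctan √x := mul_div_cancel_left₀ _ two_ne_zero
  have hx_eq : Real.tan (Real.arctan √x) ^ 2 = x := by rw [Real.tan_arctan, Real.sq_sqrt hx.le]
  have hdisp := hω.half_angles (2 * Real.arctan √x)
  have hreal := hreal (2 * Real.arctan √x)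
  rw [hκ] at hdisp hreal
  rw [← hx_eq] at hres ⊢
  refine h.numeratorPoly_eval_eq_zero (Real.cos_arctan_pos _).ne' ?_ hdisp hres hreal
  rw [Real.sin_arctan]
  positivity

end ReducedCoordinates

end ReducedCoordinates

/-! ### The six cases -/

section Cases

namespace ReducedCoordinates

variable {c : QPlus} {r τ m a b g X Y : ℝ}

theorem X_eq (h : ReducedCoordinates c r τ m a b g X Y) :
    X = r * τ * (c .ξ₁ - c .ξ₂ + 2 * m * c .α₂) := by
  rw [h.ξ₁_sub_ξ₂, sub_add_cancel, mul_div_cancel₀ _ (mul_ne_zero h.r_ne_zero h.τ_ne_zero)]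

theorem Y_eq (h : ReducedCoordinates c r τ m a b g X Y) :
    Y = r * τ * (c .ξ₃ - c .ξ₄ - 2 * m * c .β₂) := by
  rw [h.ξ₃_sub_ξ₄, add_sub_cancel_right,
    mul_div_cancel₀ _ (mul_ne_zero h.r_ne_zero h.τ_ne_zero)]

theorem case1_iff (h : ReducedCoordinates c r τ m a b g X Y) :
    c.Case1 ↔ c .α₂ = 0 ∧ c .β₂ = 0 ∧ X = 0 ∧ Y = 0 := by
  have hrτ := mul_ne_zero h.r_ne_zero h.τ_ne_zero
  rw [QPlus.Case1, h.X_eq, h.Y_eq]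
  refine and_congr_right fun hα₂ => and_congr_right fun hβ₂ => ?_
  rw [hα₂, hβ₂, mul_zero, add_zero, sub_zero, mul_eq_zero_iff_left hrτ, mul_eq_zero_iff_left hrτ,
    sub_eq_zero, sub_eq_zero]

theorem case2_iff (h : ReducedCoordinates c r τ m a b g X Y) :
    c.Case2 ↔ r = -3 ∧ c .α₂ = c .β₂ ∧ a = b ∧ g = 0 ∧ X = 0 ∧ Y = 0 := by
  have hτ := h.τ_ne_zero
  rw [QPlus.Case2, h.X_eq, h.Y_eq, h.a₁_eq, h.a₂_eq, h.α₁_eq, h.β₁_eq, h.γ₁_eq, h.γ₂_eq]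
  constructor
  · rintro ⟨hα₂, hα₁, ha₁, hγ₁, hξ₁, hξ₃⟩
    obtain rfl : r = -3 := by
      apply mul_left_cancel₀ hτ
      linear_combination -ha₁
    obtain rfl : g = 0 := by linear_combination -hγ₁
    refine ⟨rfl, hα₂, by linarith, rfl, ?_, ?_⟩
    · linear_combination 3 / 4 * hξ₁
    · linear_combination -3 / 4 * hξ₃ - 6 * τ * m * hα₂
  · rintro ⟨rfl, hα₂, rfl, rfl, hX, hY⟩
    refine ⟨hα₂, rfl, by ring, by ring, ?_, ?_⟩
    · linear_combination 4 / 3 * hX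
    · linear_combination -4 / 3 * hY - 8 * τ * m * hα₂

theorem case3_iff (h : ReducedCoordinates c r τ m a b g X Y) :
    c.Case3 ↔ r = 3 ∧ c .α₂ = -c .β₂ ∧ a = b ∧ g = 0 ∧ X = 0 ∧ Y = 0 := by
  have hτ := h.τ_ne_zero
  rw [QPlus.Case3, h.X_eq, h.Y_eq, h.a₁_eq, h.a₂_eq, h.α₁_eq, h.β₁_eq, h.γ₁_eq, h.γ₂_eq]
  constructor
  · rintro ⟨hα₂, hα₁, ha₂, hγ₂, hξ₁, hξ₃⟩
    obtain rfl : r = 3 := by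
      apply mul_left_cancel₀ hτ
      linear_combination -ha₂
    obtain rfl : g = 0 := by linear_combination -hγ₂
    refine ⟨rfl, hα₂, by linarith, rfl, ?_, ?_⟩
    · linear_combination 3 / 2 * hξ₁
    · linear_combination 3 / 2 * hξ₃ - 6 * τ * m * hα₂
  · rintro ⟨rfl, hα₂, rfl, rfl, hX, hY⟩
    refine ⟨hα₂, rfl, by ring, by ring, ?_, ?_⟩
    · linear_combination 2 / 3 * hX
    · linear_combination 2 / 3 * hY + 4 * τ * m * hα₂

theorem case4_iff (h : ReducedCoordinates c r τ m a b g X Y) :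
    c.Case4 ↔ a = 0 ∧ b = 0 ∧ g = 0 ∧ X = 0 ∧ Y = 0 := by
  have hτ := h.τ_ne_zero
  have hr := h.r_ne_zero
  have hr_sub : r - 1 ≠ 0 := sub_ne_zero.2 h.r_ne_one
  have hr_add : r + 1 ≠ 0 := fun hr => h.r_ne_neg_one (eq_neg_of_add_eq_zero_left hr)
  rw [QPlus.Case4, h.X_eq, h.Y_eq, h.a₁_eq, h.a₂_eq, h.α₁_eq, h.β₁_eq, h.γ₁_eq, h.γ₂_eq]
  constructor
  · rintro ⟨hα₁, hβ₁, hγ₁, hξ₁, hξ₃⟩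
    obtain rfl : g = 0 := by
      apply mul_left_cancel₀ hτ
      linear_combination 1 / 2 * hγ₁
    refine ⟨?_, ?_, rfl, ?_, ?_⟩
    · apply mul_left_cancel₀ (mul_ne_zero hr_add hτ)
      linear_combination hα₁
    · apply mul_left_cancel₀ (mul_ne_zero hr_add hτ)
      linear_combination hβ₁
    · apply mul_left_cancel₀ hr_sub
      linear_combination r * hξ₁
    · apply mul_left_cancel₀ hr_sub
      linear_combination r * hξ₃
  · rintro ⟨rfl, rfl, rfl, hX, hY⟩
    refine ⟨by ring, by ring, by ring, ?_, ?_⟩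
    · apply mul_left_cancel₀ hr
      linear_combination (r - 1) * hX
    · apply mul_left_cancel₀ hr
      linear_combination (r - 1) * hY

theorem case5_iff (h : ReducedCoordinates c r τ m a b g X Y) :
    c.Case5 ↔ c .β₂ = r * c .α₂ ∧ (r ^ 2 - 1) * a = 2 * r ^ 2 * g ∧
      (r ^ 2 - 1) * b = (r ^ 2 + 1) * g ∧ X = 0 ∧ Y = 2 * r * c .α₂ * g := by
  have hτ := h.τ_ne_zero
  have hr := h.r_ne_zero
  rw [QPlus.Case5, h.X_eq, h.Y_eq, h.a₁_eq, h.a₂_eq, h.α₁_eq, h.β₁_eq, h.γ₁_eq, h.γ₂_eq]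
  constructor
  · rintro ⟨hβ₂, hα₁, hβ₁, hξ₁, hξ₃⟩
    have hβ₂_eq : c .β₂ = r * c .α₂ := by
      apply mul_left_cancel₀ hτ
      linear_combination 1 / 2 * hβ₂
    refine ⟨hβ₂_eq, ?_, ?_, ?_, ?_⟩
    · apply mul_left_cancel₀ (pow_ne_zero 3 hτ)
      linear_combination -1 / 4 * hα₁
    · apply mul_left_cancel₀ (pow_ne_zero 2 hτ)
      linear_combination 1 / 2 * hβ₁
    · linear_combination r / 2 * hξ₁
    · apply mul_left_cancel₀ hτ
      linear_combination r / 4 * hξ₃ - 2 * r * τ ^ 2 * m * hβ₂_eq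
  · rintro ⟨hβ₂, ha, hb, hX, hY⟩
    refine ⟨?_, ?_, ?_, ?_, ?_⟩
    · linear_combination 2 * τ * hβ₂
    · linear_combination -4 * τ ^ 3 * ha
    · linear_combination 2 * τ ^ 2 * hb
    · apply mul_left_cancel₀ hr
      linear_combination 2 * hX
    · apply mul_left_cancel₀ hr
      linear_combination 4 * τ * hY + 8 * r * τ ^ 2 * m * hβ₂

theorem case6_iff (h : ReducedCoordinates c r τ m a b g X Y) :
    c.Case6 ↔ c .α₂ = r * c .β₂ ∧ (r ^ 2 - 1) * a = (r ^ 2 + 1) * g ∧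
      (r ^ 2 - 1) * b = 2 * r ^ 2 * g ∧ X = -2 * c .α₂ * g ∧ Y = 0 := by
  have hτ := h.τ_ne_zero
  rw [QPlus.Case6, h.X_eq, h.Y_eq, h.a₁_eq, h.a₂_eq, h.α₁_eq, h.β₁_eq, h.γ₁_eq, h.γ₂_eq]
  constructor
  · rintro ⟨hβ₂, hα₁, hβ₁, hξ₁, hξ₃⟩
    have hα₂_eq : c .α₂ = r * c .β₂ := by
      apply mul_left_cancel₀ hτ
      linear_combination -1 / 2 * hβ₂
    refine ⟨hα₂_eq, ?_, ?_, ?_, ?_⟩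
    · apply mul_left_cancel₀ (pow_ne_zero 2 hτ)
      linear_combination 1 / 2 * hα₁
    · apply mul_left_cancel₀ (pow_ne_zero 3 hτ)
      linear_combination -1 / 4 * hβ₁
    · apply mul_left_cancel₀ hτ
      linear_combination 1 / 4 * hξ₁
    · linear_combination 1 / 2 * hξ₃ + 2 * τ * m * hα₂_eq
  · rintro ⟨hα₂, ha, hb, hX, hY⟩
    refine ⟨?_, ?_, ?_, ?_, ?_⟩
    · linear_combination -2 * τ * hα₂
    · linear_combination 2 * τ ^ 2 * ha
    · linear_combination -4 * τ ^ 3 * hb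
    · linear_combination 4 * τ * hX
    · linear_combination 2 * hY - 4 * τ * m * hα₂

theorem sq_sub_one_ne_zero (h : ReducedCoordinates c r τ m a b g X Y) : r ^ 2 - 1 ≠ 0 :=
  sub_ne_zero.2 (by simp [h.r_ne_one, h.r_ne_neg_one])

theorem numeratorPoly_eq_zero_iff_cases (h : ReducedCoordinates c r τ m a b g X Y) :
    numeratorPoly r (c .α₂) (c .β₂) a b g X Y = 0 ↔
      c.Case1 ∨ c.Case2 ∨ c.Case3 ∨ c.Case4 ∨ c.Case5 ∨ c.Case6 := by
  have hr := h.sq_sub_one_ne_zero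
  rw [numeratorPoly_eq_zero_iff h.r_ne_zero,
    bilinearSystem_iff h.r_ne_zero h.r_ne_one h.r_ne_neg_one, h.case1_iff, h.case2_iff, h.case3_iff,
    h.case4_iff, h.case5_iff, h.case6_iff]
  simp only [or_and_right, and_assoc]
  refine or_congr ?_ (or_congr ?_ (or_congr ?_ (or_congr ?_ (or_congr ?_ ?_))))
  · refine and_congr_right fun hα₂ => and_congr_right fun hβ₂ => ?_
    rw [hα₂, hβ₂, zero_mul, zero_mul]
  · refine and_congr_right' (and_congr_right' (and_congr_right fun hab => and_congr_right ?_))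
    rintro rfl
    rw [hab, sub_self, sub_zero, add_zero, mul_zero, mul_zero]
  · refine and_congr_right' (and_congr_right' (and_congr_right fun hab => and_congr_right ?_))
    rintro rfl
    rw [hab, sub_self, sub_zero, add_zero, mul_zero, mul_zero]
  · refine and_congr_right fun ha => and_congr_right fun hb => and_congr_right fun hg => ?_
    rw [ha, hb, hg, sub_self, sub_zero, add_zero, mul_zero, mul_zero]
  · refine and_congr_right fun hβ₂ => and_congr_right fun ha => and_congr_right fun hb => ?_
    have hab : a - b = g := mul_left_cancel₀ hr (by linear_combination ha - hb)
    rw [hab, hβ₂, sub_self, mul_zero, show r * c .α₂ * (g + g) = 2 * r * c .α₂ * g by ring]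
  · refine and_congr_right' (and_congr_right fun ha => and_congr_right fun hb => ?_)
    have hab : a - b = -g := mul_left_cancel₀ hr (by linear_combination ha - hb)
    rw [hab, neg_add_cancel, mul_zero, show c .α₂ * (-g - g) = -2 * c .α₂ * g by ring]

end ReducedCoordinates

theorem QPlus.forall_nlsNonlinearity_im_eq_zero_iff {c : QPlus} {ω : ℝ → ℝ} (hc : c.IsDispersive)
    (hω : c.IsDispersionRelation ω) :
    (∀ κ, c.NonResonant ω κ → (c.nlsNonlinearity ω κ).im = 0) ↔
      c.Case1 ∨ c.Case2 ∨ c.Case3 ∨ c.Case4 ∨ c.Case5 ∨ c.Case6 := by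
  obtain ⟨r, τ, m, a, b, g, X, Y, h⟩ := exists_reducedCoordinates hc
  rw [h.forall_nlsNonlinearity_im_eq_zero_iff hc hω, h.numeratorPoly_eq_zero_iff_cases]

end Cases

/-! ### Möbius substitutions -/

section Mobius

/-- The coefficients of the equation obtained from `c` by the substitution `u ↦ u / (C u + D)`. -/
def QPlus.mobius (c : QPlus) (C D : ℝ) : QPlus
  | .a₁ => D ^ 3 * c .a₁
  | .a₂ => D ^ 3 * c .a₂
  | .α₁ => D ^ 2 * (c .α₁ + C * (c .a₁ + c .a₂))
  | .α₂ => D ^ 2 * c .α₂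
  | .β₁ => D ^ 2 * (c .β₁ + C * (c .a₁ + c .a₂))
  | .β₂ => D ^ 2 * c .β₂
  | .γ₁ => D ^ 2 * (c .γ₁ + 2 * C * c .a₁)
  | .γ₂ => D ^ 2 * (c .γ₂ + 2 * C * c .a₂)
  | .ξ₁ => D * (c .ξ₁ + C / 2 * (2 * (c .α₁ - c .α₂) + 2 * c .β₁ + c .γ₁ + c .γ₂)
      + 3 / 2 * C ^ 2 * (c .a₁ + c .a₂))
  | .ξ₂ => D * (c .ξ₂ + C / 2 * (2 * (c .α₁ + c .α₂) + 2 * c .β₁ + c .γ₁ + c .γ₂)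
      + 3 / 2 * C ^ 2 * (c .a₁ + c .a₂))
  | .ξ₃ => D * (c .ξ₃ + C / 2 * (2 * c .β₂ + c .γ₁ - c .γ₂) + C ^ 2 / 2 * (c .a₁ - c .a₂))
  | .ξ₄ => D * (c .ξ₄ + C / 2 * (-2 * c .β₂ + c .γ₁ - c .γ₂) + C ^ 2 / 2 * (c .a₁ - c .a₂))
  | .ζ => c .ζ + 2 * C * (c .ξ₁ + c .ξ₂) + C ^ 2 * (2 * c .α₁ + 2 * c .β₁ + c .γ₁ + c .γ₂)
      + 2 * C ^ 3 * (c .a₁ + c .a₂)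

variable {c c' : QPlus} {C D : ℝ}

theorem QPlus.mul_lhs_div {K : Type*} [Field K] [Algebra ℝ K] (c : QPlus) {x y z w p q s t : K}
    (hp : p ≠ 0) (hq : q ≠ 0) (hs : s ≠ 0) (ht : t ≠ 0) :
    p * q * s * t * c.lhs (x / p) (y / q) (z / s) (w / t) =
      c .a₁ • (x * (q * s * t) + w * (p * q * s)) + c .a₂ • (y * (p * s * t) + z * (p * q * t))
      + (c .α₁ - c .α₂) • (x * y * (s * t)) + (c .α₁ + c .α₂) • (z * w * (p * q))
      + (c .β₁ - c .β₂) • (x * z * (q * t)) + (c .β₁ + c .β₂) • (y * w * (p * s))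
      + c .γ₁ • (x * w * (q * s)) + c .γ₂ • (y * z * (p * t))
      + (c .ξ₁ - c .ξ₃) • (x * y * z * t) + (c .ξ₁ + c .ξ₃) • (x * y * w * s)
      + (c .ξ₂ - c .ξ₄) • (y * z * w * p) + (c .ξ₂ + c .ξ₄) • (x * z * w * q)
      + c .ζ • (x * y * z * w) := by
  simp only [QPlus.lhs, Algebra.smul_def]
  field_simp

theorem QPlus.isMobiusImage_mobius (c : QPlus) (C D : ℝ) : IsMobiusImage C D c (c.mobius C D) := by
  intro x y z w hx hy hz hw
  rw [c.mul_lhs_div hx hy hz hw]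
  simp only [QPlus.lhs, smul_eq_mul, mobius]
  ring

theorem QPlus.lhs_sub {A : Type*} [CommRing A] [Algebra ℝ A] (c c' : QPlus) (x y z w : A) :
    (c - c').lhs x y z w = c.lhs x y z w - c'.lhs x y z w := by
  simp only [QPlus.lhs, Pi.sub_apply, Algebra.smul_def, map_sub, map_add]
  ring

theorem QPlus.eq_zero_of_lhs_eq_zero {s : Set ℝ} {t : ℝ} (h₀ : 0 ∈ s) (ht : t ∈ s) (ht₀ : t ≠ 0)
    (h : ∀ x ∈ s, ∀ y ∈ s, ∀ z ∈ s, ∀ w ∈ s, c.lhs x y z w = 0) : c = 0 := by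
  simp only [QPlus.lhs, smul_eq_mul] at h
  have ha₁ : c .a₁ = 0 := by simpa [ht₀] using h t ht 0 h₀ 0 h₀ 0 h₀
  have ha₂ : c .a₂ = 0 := by simpa [ht₀] using h 0 h₀ t ht 0 h₀ 0 h₀
  have hα_sub : c .α₁ - c .α₂ = 0 := by simpa [ht₀, ha₁, ha₂] using h t ht t ht 0 h₀ 0 h₀
  have hα_add : c .α₁ + c .α₂ = 0 := by simpa [ht₀, ha₁, ha₂] using h 0 h₀ 0 h₀ t ht t ht
  have hβ_sub : c .β₁ - c .β₂ = 0 := by simpa [ht₀, ha₁, ha₂] using h t ht 0 h₀ t ht 0 h₀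
  have hβ_add : c .β₁ + c .β₂ = 0 := by simpa [ht₀, ha₁, ha₂] using h 0 h₀ t ht 0 h₀ t ht
  have hγ₁ : c .γ₁ = 0 := by simpa [ht₀, ha₁] using h t ht 0 h₀ 0 h₀ t ht
  have hγ₂ : c .γ₂ = 0 := by simpa [ht₀, ha₂] using h 0 h₀ t ht t ht 0 h₀
  simp only [ha₁, ha₂, hα_sub, hα_add, hβ_sub, hβ_add, hγ₁, hγ₂, zero_mul, zero_add] at h
  have hξ₁₃_sub : c .ξ₁ - c .ξ₃ = 0 := by simpa [ht₀] using h t ht t ht t ht 0 h₀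
  have hξ₁₃_add : c .ξ₁ + c .ξ₃ = 0 := by simpa [ht₀] using h t ht t ht 0 h₀ t ht
  have hξ₂₄_sub : c .ξ₂ - c .ξ₄ = 0 := by simpa [ht₀] using h 0 h₀ t ht t ht t ht
  have hξ₂₄_add : c .ξ₂ + c .ξ₄ = 0 := by simpa [ht₀] using h t ht 0 h₀ t ht t ht
  have hζ : c .ζ = 0 := by
    simpa [ht₀, hξ₁₃_sub, hξ₁₃_add, hξ₂₄_sub, hξ₂₄_add] using h t ht t ht t ht t ht
  funext j
  cases j <;> simp only [Pi.zero_apply] <;> linarith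

theorem exists_ne_zero_mul_add_ne_zero (C : ℝ) (hD : D ≠ 0) : ∃ t : ℝ, t ≠ 0 ∧ C * t + D ≠ 0 := by
  by_cases h : C + D = 0
  · exact ⟨-1, by norm_num, fun h' => hD (by linarith)⟩
  · exact ⟨1, one_ne_zero, by rwa [mul_one]⟩

theorem IsMobiusImage.eq_mobius (hD : D ≠ 0) (h : IsMobiusImage C D c c') :
    c' = c.mobius C D := by
  obtain ⟨t, ht₀, ht⟩ := exists_ne_zero_mul_add_ne_zero C hD
  refine sub_eq_zero.1 (QPlus.eq_zero_of_lhs_eq_zero (s := {x | C * x + D ≠ 0}) ?_ ht ht₀ ?_)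
  · simpa using hD
  · intro x hx y hy z hz w hw
    rw [QPlus.lhs_sub, h x y z w hx hy hz hw, c.isMobiusImage_mobius C D x y z w hx hy hz hw,
      sub_self]

theorem QPlus.isDispersive_mobius_iff (hD : D ≠ 0) :
    (c.mobius C D).IsDispersive ↔ c.IsDispersive := by
  have hD₃ : D ^ 3 ≠ 0 := pow_ne_zero 3 hD
  simp only [IsDispersive, mobius, abs_mul, mul_ne_zero_iff, ne_eq, hD₃, not_false_eq_true,
    true_and, mul_right_inj' (abs_ne_zero.2 hD₃)]

theorem ReducedCoordinates.mobius {r τ m a b g X Y : ℝ}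
    (h : ReducedCoordinates c r τ m a b g X Y) (C : ℝ) (hD : D ≠ 0) :
    ReducedCoordinates (c.mobius C D) r (D ^ 3 * τ) ((m + C) / D) (D ^ 2 * a) (D ^ 2 * b)
      (D ^ 2 * g) (D ^ 4 * X) (D ^ 4 * Y) := by
  have hr := h.r_ne_zero
  have hτ := h.τ_ne_zero
  constructor
  case r_ne_zero => exact hr
  case r_ne_one => exact h.r_ne_one
  case r_ne_neg_one => exact h.r_ne_neg_one
  case τ_ne_zero => exact mul_ne_zero (pow_ne_zero 3 hD) hτ
  case ξ₁_sub_ξ₂ =>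
    have hX := h.ξ₁_sub_ξ₂
    simp only [QPlus.mobius]
    field_simp at hX ⊢
    linear_combination 2 * hX
  case ξ₃_sub_ξ₄ =>
    have hY := h.ξ₃_sub_ξ₄
    simp only [QPlus.mobius]
    field_simp at hY ⊢
    linear_combination 2 * hY
  all_goals
    simp only [QPlus.mobius, h.a₁_eq, h.a₂_eq, h.α₁_eq, h.β₁_eq, h.γ₁_eq, h.γ₂_eq]
    field_simp
    try ring

theorem eq_iff_eq_of_sub_eq_mul {K : Type*} [Field K] {k x y x' y' : K} (hk : k ≠ 0)
    (h : x' - y' = k * (x - y)) : x' = y' ↔ x = y := by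
  rw [← sub_eq_zero, h, mul_eq_zero_iff_left hk, sub_eq_zero]

namespace QPlus

theorem case1_mobius_iff (hc : c.IsDispersive) (hD : D ≠ 0) :
    (c.mobius C D).Case1 ↔ c.Case1 := by
  obtain ⟨r, τ, m, a, b, g, X, Y, h⟩ := exists_reducedCoordinates hc
  rw [(h.mobius C hD).case1_iff, h.case1_iff]
  simp only [mobius, mul_eq_zero_iff_left (pow_ne_zero _ hD)]

theorem case2_mobius_iff (hc : c.IsDispersive) (hD : D ≠ 0) :
    (c.mobius C D).Case2 ↔ c.Case2 := by
  obtain ⟨r, τ, m, a, b, g, X, Y, h⟩ := exists_reducedCoordinates hc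
  rw [(h.mobius C hD).case2_iff, h.case2_iff]
  simp only [mobius, mul_eq_zero_iff_left (pow_ne_zero _ hD), mul_right_inj' (pow_ne_zero _ hD)]

theorem case3_mobius_iff (hc : c.IsDispersive) (hD : D ≠ 0) :
    (c.mobius C D).Case3 ↔ c.Case3 := by
  obtain ⟨r, τ, m, a, b, g, X, Y, h⟩ := exists_reducedCoordinates hc
  rw [(h.mobius C hD).case3_iff, h.case3_iff]
  simp only [mobius, ← mul_neg, mul_eq_zero_iff_left (pow_ne_zero _ hD),
    mul_right_inj' (pow_ne_zero _ hD)]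

theorem case4_mobius_iff (hc : c.IsDispersive) (hD : D ≠ 0) :
    (c.mobius C D).Case4 ↔ c.Case4 := by
  obtain ⟨r, τ, m, a, b, g, X, Y, h⟩ := exists_reducedCoordinates hc
  rw [(h.mobius C hD).case4_iff, h.case4_iff]
  simp only [mul_eq_zero_iff_left (pow_ne_zero _ hD)]

theorem case5_mobius_iff (hc : c.IsDispersive) (hD : D ≠ 0) :
    (c.mobius C D).Case5 ↔ c.Case5 := by
  obtain ⟨r, τ, m, a, b, g, X, Y, h⟩ := exists_reducedCoordinates hc
  rw [(h.mobius C hD).case5_iff, h.case5_iff, mul_eq_zero_iff_left (pow_ne_zero 4 hD)]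
  simp only [mobius]
  refine and_congr ?_ <| and_congr ?_ <| and_congr ?_ <| and_congr_right fun _ => ?_
  · exact eq_iff_eq_of_sub_eq_mul (pow_ne_zero 2 hD) (by ring)
  · exact eq_iff_eq_of_sub_eq_mul (pow_ne_zero 2 hD) (by ring)
  · exact eq_iff_eq_of_sub_eq_mul (pow_ne_zero 2 hD) (by ring)
  · exact eq_iff_eq_of_sub_eq_mul (pow_ne_zero 4 hD) (by ring)

theorem case6_mobius_iff (hc : c.IsDispersive) (hD : D ≠ 0) :
    (c.mobius C D).Case6 ↔ c.Case6 := by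
  obtain ⟨r, τ, m, a, b, g, X, Y, h⟩ := exists_reducedCoordinates hc
  rw [(h.mobius C hD).case6_iff, h.case6_iff, mul_eq_zero_iff_left (pow_ne_zero 4 hD)]
  simp only [mobius]
  refine and_congr ?_ <| and_congr ?_ <| and_congr ?_ <| and_congr_left fun _ => ?_
  · exact eq_iff_eq_of_sub_eq_mul (pow_ne_zero 2 hD) (by ring)
  · exact eq_iff_eq_of_sub_eq_mul (pow_ne_zero 2 hD) (by ring)
  · exact eq_iff_eq_of_sub_eq_mul (pow_ne_zero 2 hD) (by ring)
  · exact eq_iff_eq_of_sub_eq_mul (pow_ne_zero 4 hD) (by ring)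

theorem mobius_mem_family_iff (hD : D ≠ 0) (i : Fin 6) :
    c.mobius C D ∈ family i ↔ c ∈ family i := by
  have hfamily {P : QPlus → Prop} (hP : c.IsDispersive → (P (c.mobius C D) ↔ P c)) :
      (c.mobius C D).IsDispersive ∧ P (c.mobius C D) ↔ c.IsDispersive ∧ P c := by
    rw [isDispersive_mobius_iff hD]
    exact and_congr_right hP
  fin_cases i
  · exact hfamily fun hc => case1_mobius_iff hc hD
  · exact hfamily fun hc => case2_mobius_iff hc hD
  · exact hfamily fun hc => case3_mobius_iff hc hD
  · exact hfamily fun hc => case4_mobius_iff hc hD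
  · exact hfamily fun hc => case5_mobius_iff hc hD
  · exact hfamily fun hc => case6_mobius_iff hc hD

end QPlus

end Mobius

/-! ### Free parameters -/

section FreeParameters

open scoped ContDiff

theorem forall_param {P : Param → Prop} :
    (∀ j, P j) ↔ P .a₁ ∧ P .a₂ ∧ P .α₁ ∧ P .α₂ ∧ P .β₁ ∧ P .β₂ ∧ P .γ₁ ∧ P .γ₂ ∧ P .ξ₁ ∧
      P .ξ₂ ∧ P .ξ₃ ∧ P .ξ₄ ∧ P .ζ := by
  refine ⟨fun h => ⟨h _, h _, h _, h _, h _, h _, h _, h _, h _, h _, h _, h _, h _⟩, ?_⟩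
  rintro ⟨_, _, _, _, _, _, _, _, _, _, _, _, _⟩ j
  cases j <;> assumption

/-- If `G` fills in the coefficients outside `J`, then the equations fixed by `G` form the graph of
the coefficients outside `J` over those in `J`. -/
theorem hasFreeParameters_of_fixedPoints {N : ℕ} (J : Finset Param) (hJ : J.card = N)
    {S V : Set QPlus} {G : QPlus → QPlus} (hV : IsOpen V) (hV_nonempty : V.Nonempty)
    (hG : ContDiffOn ℝ ∞ G V) (hG_eqOn : ∀ c, Set.EqOn (G c) c J)
    (hG_dep : DependsOn G (J : Set Param)) (hV_dep : DependsOn (· ∈ V) (J : Set Param))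
    (hS : ∀ c, c ∈ S ↔ c ∈ V ∧ G c = c) : HasFreeParameters S N := by
  let extend := (Function.ExtendByZero.linearMap ℝ (Subtype.val : J → Param)).toContinuousLinearMap
  have extend_apply (p : J → ℝ) (j : J) : extend p j = p j :=
    Subtype.val_injective.extend_apply p 0 j
  have eqOn_extend (c : QPlus) : ∀ j ∈ (J : Set Param), c j = extend (fun i => c i) j :=
    fun j hj => (extend_apply (fun i => c i) ⟨j, hj⟩).symm
  refine ⟨J, hJ, extend ⁻¹' V, hV.preimage extend.continuous, ?_, G ∘ extend,
    hG.comp extend.contDiff.contDiffOn fun _ hp => hp,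
    fun p _ j => (hG_eqOn _ j.2).trans (extend_apply p j), ?_⟩
  · obtain ⟨c, hc⟩ := hV_nonempty
    exact ⟨fun i => c i, (hV_dep (eqOn_extend c)).mp hc⟩
  ext c
  rw [hS]
  constructor
  · rintro ⟨hc, hGc⟩
    exact ⟨fun i => c i, (hV_dep (eqOn_extend c)).mp hc,
      (hG_dep (eqOn_extend c)).symm.trans hGc⟩
  · rintro ⟨p, hp, rfl⟩
    have hp_eqOn := hG_eqOn (extend p)
    exact ⟨(hV_dep hp_eqOn).mpr hp, hG_dep hp_eqOn⟩

theorem isOpen_isDispersive : IsOpen {c : QPlus | c.IsDispersive} := by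
  have ha₁ : Continuous fun c : QPlus => c .a₁ := continuous_apply _
  have ha₂ : Continuous fun c : QPlus => c .a₂ := continuous_apply _
  exact (isOpen_ne_fun ha₁ continuous_const).inter
    ((isOpen_ne_fun ha₂ continuous_const).inter (isOpen_ne_fun ha₁.abs ha₂.abs))

theorem nonempty_isDispersive : {c : QPlus | c.IsDispersive}.Nonempty :=
  ⟨fun j => if j = .a₁ then 1 else 2, by simp [QPlus.IsDispersive]⟩

theorem dependsOn_isDispersive {J : Set Param} (ha₁ : .a₁ ∈ J) (ha₂ : .a₂ ∈ J) :
    DependsOn (· ∈ {c : QPlus | c.IsDispersive}) J := by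
  intro c c' h
  simp only [QPlus.IsDispersive, Set.mem_ofPred_eq, h .a₁ ha₁, h .a₂ ha₂]

theorem isOpen_coeff_ne_zero (j : Param) : IsOpen {c : QPlus | c j ≠ 0} :=
  isOpen_ne_fun (continuous_apply j) continuous_const

theorem nonempty_coeff_ne_zero (j : Param) : {c : QPlus | c j ≠ 0}.Nonempty :=
  ⟨1, one_ne_zero⟩

theorem dependsOn_coeff_ne_zero {J : Set Param} {j : Param} (hj : j ∈ J) :
    DependsOn (· ∈ {c : QPlus | c j ≠ 0}) J := by
  intro c c' h
  simp only [Set.mem_ofPred_eq, h j hj]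

theorem div_eq_iff_mul_eq_left {K : Type*} [Field K] {d n y : K} (hd : d ≠ 0) :
    n / d = y ↔ d * y = n := by
  rw [div_eq_iff hd, mul_comm, eq_comm]

theorem add_div_eq_iff {K : Type*} [Field K] {d n x y : K} (hd : d ≠ 0) :
    x + n / d = y ↔ d * (y - x) = n := by
  rw [← eq_sub_iff_add_eq', div_eq_iff_mul_eq_left hd]

namespace QPlus

/-- The equation of Case 1 with the same free coefficients as `c`. -/
def completion₁ (c : QPlus) : QPlus
  | .α₂ => 0
  | .β₂ => 0
  | .ξ₁ => c .ξ₂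
  | .ξ₃ => c .ξ₄
  | j => c j

/-- The equation of Case 2 with the same free coefficients as `c`. -/
def completion₂ (c : QPlus) : QPlus
  | .a₁ => 2 * c .a₂
  | .α₁ => c .β₁
  | .β₂ => c .α₂
  | .γ₁ => 2 * c .γ₂
  | .ξ₁ => c .ξ₂ + -2 * c .α₂ * c .γ₂ / (2 * c .a₂)
  | .ξ₃ => c .ξ₄ + -2 * c .α₂ * c .γ₂ / -(2 * c .a₂)
  | j => c j

/-- The equation of Case 3 with the same free coefficients as `c`. -/
def completion₃ (c : QPlus) : QPlus
  | .a₂ => 2 * c .a₁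
  | .α₁ => c .β₁
  | .β₂ => -c .α₂
  | .γ₂ => 2 * c .γ₁
  | .ξ₁ => c .ξ₂ + -c .α₂ * c .γ₁ / c .a₁
  | .ξ₃ => c .ξ₄ + -c .α₂ * c .γ₁ / c .a₁
  | j => c j

/-- The equation of Case 4 with the same free coefficients as `c`. -/
def completion₄ (c : QPlus) : QPlus
  | .α₁ => 1 / 2 * (c .a₁ + c .a₂) * c .γ₂ / c .a₂
  | .β₁ => 1 / 2 * (c .a₁ + c .a₂) * c .γ₂ / c .a₂
  | .γ₁ => c .a₁ * c .γ₂ / c .a₂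
  | .ξ₁ => c .ξ₂ + -c .α₂ * (c .a₁ * c .γ₂ / c .a₂) / c .a₁
  | .ξ₃ => c .ξ₄ + c .β₂ * (c .a₁ * c .γ₂ / c .a₂) / c .a₁
  | j => c j

/-- The equation of Case 5 with the same free coefficients as `c`. -/
def completion₅ (c : QPlus) : QPlus
  | .α₁ => (c .a₁ + c .a₂) * (c .γ₂ * c .a₁ ^ 2 - c .γ₁ * c .a₂ ^ 2) /
      (2 * c .a₁ * c .a₂ * (c .a₁ - c .a₂))
  | .β₁ => (c .γ₁ * c .a₂ ^ 2 + c .γ₂ * c .a₁ ^ 2) / (2 * c .a₁ * c .a₂)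
  | .β₂ => (c .a₂ + c .a₁) * c .α₂ / (c .a₂ - c .a₁)
  | .ξ₁ => c .ξ₂ + (c .γ₁ - c .γ₂) * c .α₂ / (c .a₂ - c .a₁)
  | .ξ₃ => c .ξ₄ + (c .γ₂ * (c .a₂ - 3 * c .a₁) - c .γ₁ * (c .a₁ - 3 * c .a₂)) * c .α₂ /
      (c .a₂ - c .a₁) ^ 2
  | j => c j

/-- The equation of Case 6 with the same free coefficients as `c`. -/
def completion₆ (c : QPlus) : QPlus
  | .α₁ => (c .γ₁ * c .a₂ ^ 2 + c .γ₂ * c .a₁ ^ 2) / (2 * c .a₁ * c .a₂)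
  | .β₁ => (c .a₁ + c .a₂) * (c .γ₂ * c .a₁ ^ 2 - c .γ₁ * c .a₂ ^ 2) /
      (2 * c .a₁ * c .a₂ * (c .a₁ - c .a₂))
  | .β₂ => (c .a₂ - c .a₁) * c .α₂ / (c .a₂ + c .a₁)
  | .ξ₁ => c .ξ₂ + (c .γ₁ * (c .a₁ - 3 * c .a₂) - c .γ₂ * (c .a₂ - 3 * c .a₁)) * c .α₂ /
      (c .a₂ ^ 2 - c .a₁ ^ 2)
  | .ξ₃ => c .ξ₄ + (c .γ₂ - c .γ₁) * c .α₂ / (c .a₁ + c .a₂)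
  | j => c j

theorem contDiffOn_of_coeff {n : WithTop ℕ∞} {G : QPlus → QPlus} {V : Set QPlus}
    (h : ∀ c ∈ V, ∀ j, ContDiffAt ℝ n (fun c => G c j) c) : ContDiffOn ℝ n G V :=
  fun c hc => (contDiffAt_pi.2 (h c hc)).contDiffWithinAt

theorem contDiffOn_completion₁ {V : Set QPlus} : ContDiffOn ℝ ∞ completion₁ V := by
  refine contDiffOn_of_coeff fun c _ j => ?_
  cases j <;> simp only [completion₁] <;> fun_prop

theorem contDiffOn_completion₂ : ContDiffOn ℝ ∞ completion₂ {c | c .a₂ ≠ 0} := by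
  refine contDiffOn_of_coeff fun c ha₂ j => ?_
  have ha₂_two : 2 * c .a₂ ≠ 0 := mul_ne_zero two_ne_zero ha₂
  have ha₂_neg : -(2 * c .a₂) ≠ 0 := neg_ne_zero.2 ha₂_two
  cases j <;> simp only [completion₂] <;> fun_prop (disch := assumption)

theorem contDiffOn_completion₃ : ContDiffOn ℝ ∞ completion₃ {c | c .a₁ ≠ 0} := by
  refine contDiffOn_of_coeff fun c ha₁ j => ?_
  cases j <;> simp only [completion₃] <;> fun_prop (disch := assumption)

theorem contDiffOn_completion₄ : ContDiffOn ℝ ∞ completion₄ {c | c.IsDispersive} := by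
  refine contDiffOn_of_coeff fun c hc j => ?_
  obtain ⟨ha₁, ha₂, -⟩ := hc
  cases j <;> simp only [completion₄] <;> fun_prop (disch := assumption)

namespace IsDispersive

variable {c : QPlus}

theorem sub_ne_zero' (hc : c.IsDispersive) : c .a₂ - c .a₁ ≠ 0 := by
  rw [← neg_sub]
  exact neg_ne_zero.2 hc.sub_ne_zero

theorem add_ne_zero' (hc : c.IsDispersive) : c .a₂ + c .a₁ ≠ 0 := by
  rw [add_comm]
  exact hc.add_ne_zero

theorem sq_sub_sq_ne_zero (hc : c.IsDispersive) : c .a₂ ^ 2 - c .a₁ ^ 2 ≠ 0 := by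
  rw [sq_sub_sq]
  exact mul_ne_zero hc.add_ne_zero' hc.sub_ne_zero'

theorem two_mul_mul_ne_zero (hc : c.IsDispersive) : 2 * c .a₁ * c .a₂ ≠ 0 :=
  mul_ne_zero (mul_ne_zero two_ne_zero hc.1) hc.2.1

theorem two_mul_mul_sub_ne_zero (hc : c.IsDispersive) :
    2 * c .a₁ * c .a₂ * (c .a₁ - c .a₂) ≠ 0 :=
  mul_ne_zero hc.two_mul_mul_ne_zero hc.sub_ne_zero

end IsDispersive

theorem contDiffOn_completion₅ : ContDiffOn ℝ ∞ completion₅ {c | c.IsDispersive} := by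
  refine contDiffOn_of_coeff fun c hc j => ?_
  have hα₁_den := hc.two_mul_mul_sub_ne_zero
  have hβ₁_den := hc.two_mul_mul_ne_zero
  have hβ₂_den := hc.sub_ne_zero'
  have hξ₃_den := pow_ne_zero 2 hc.sub_ne_zero'
  cases j <;> simp only [completion₅] <;> fun_prop (disch := assumption)

theorem contDiffOn_completion₆ : ContDiffOn ℝ ∞ completion₆ {c | c.IsDispersive} := by
  refine contDiffOn_of_coeff fun c hc j => ?_
  have hα₁_den := hc.two_mul_mul_ne_zero
  have hβ₁_den := hc.two_mul_mul_sub_ne_zero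
  have hβ₂_den := hc.add_ne_zero'
  have hξ₁_den := hc.sq_sub_sq_ne_zero
  have hξ₃_den := hc.add_ne_zero
  cases j <;> simp only [completion₆] <;> fun_prop (disch := assumption)

variable {c : QPlus}

theorem completion₁_eq_self_iff : c.completion₁ = c ↔ c.Case1 := by
  simp only [funext_iff, forall_param, completion₁, Case1, true_and, and_true]
  rw [eq_comm, @eq_comm _ 0 (c .β₂), @eq_comm _ (c .ξ₂), @eq_comm _ (c .ξ₄)]

theorem completion₂_eq_self_iff (ha₂ : c .a₂ ≠ 0) : c.completion₂ = c ↔ c.Case2 := by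
  have ha₂_two : 2 * c .a₂ ≠ 0 := mul_ne_zero two_ne_zero ha₂
  simp only [funext_iff, forall_param, completion₂, Case2, true_and, and_true,
    add_div_eq_iff ha₂_two, add_div_eq_iff (neg_ne_zero.2 ha₂_two)]
  constructor
  · rintro ⟨ha₁, hα₁, hβ₂, hγ₁, hξ₁, hξ₃⟩
    exact ⟨hβ₂, hα₁.symm, ha₁.symm, hγ₁.symm, ha₁ ▸ hξ₁, ha₁ ▸ hξ₃⟩
  · rintro ⟨hβ₂, hα₁, ha₁, hγ₁, hξ₁, hξ₃⟩
    exact ⟨ha₁.symm, hα₁.symm, hβ₂, hγ₁.symm, ha₁ ▸ hξ₁, ha₁ ▸ hξ₃⟩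

theorem completion₃_eq_self_iff (ha₁ : c .a₁ ≠ 0) : c.completion₃ = c ↔ c.Case3 := by
  simp only [funext_iff, forall_param, completion₃, Case3, true_and, and_true,
    add_div_eq_iff ha₁, neg_eq_iff_eq_neg]
  constructor
  · rintro ⟨ha₂, hα₁, hβ₂, hγ₂, hξ⟩
    exact ⟨hβ₂, hα₁.symm, ha₂.symm, hγ₂.symm, hξ⟩
  · rintro ⟨hβ₂, hα₁, ha₂, hγ₂, hξ⟩
    exact ⟨ha₂.symm, hα₁.symm, hβ₂, hγ₂.symm, hξ⟩

theorem completion₄_eq_self_iff (hc : c.IsDispersive) : c.completion₄ = c ↔ c.Case4 := by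
  simp only [funext_iff, forall_param, completion₄, Case4, true_and, and_true,
    add_div_eq_iff hc.1, ← div_eq_iff_mul_eq_left hc.2.1]
  refine and_congr_right fun _ => and_congr_right fun _ => and_congr_right fun hγ₁ => ?_
  rw [hγ₁]

theorem completion₅_eq_self_iff (hc : c.IsDispersive) : c.completion₅ = c ↔ c.Case5 := by
  simp only [funext_iff, forall_param, completion₅, Case5, true_and, and_true,
    add_div_eq_iff hc.sub_ne_zero', add_div_eq_iff (pow_ne_zero 2 hc.sub_ne_zero'),
    div_eq_iff_mul_eq_left hc.sub_ne_zero', div_eq_iff_mul_eq_left hc.two_mul_mul_ne_zero,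
    div_eq_iff_mul_eq_left hc.two_mul_mul_sub_ne_zero]
  tauto

theorem completion₆_eq_self_iff (hc : c.IsDispersive) : c.completion₆ = c ↔ c.Case6 := by
  simp only [funext_iff, forall_param, completion₆, Case6, true_and, and_true,
    add_div_eq_iff hc.sq_sub_sq_ne_zero, add_div_eq_iff hc.add_ne_zero,
    div_eq_iff_mul_eq_left hc.add_ne_zero', div_eq_iff_mul_eq_left hc.two_mul_mul_ne_zero,
    div_eq_iff_mul_eq_left hc.two_mul_mul_sub_ne_zero]
  tauto

theorem isDispersive_iff_of_a₁_eq (h : c .a₁ = 2 * c .a₂) : c.IsDispersive ↔ c .a₂ ≠ 0 := by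
  rw [IsDispersive, h, abs_mul, abs_two]
  exact ⟨fun hc => hc.2.1, fun ha₂ => ⟨mul_ne_zero two_ne_zero ha₂, ha₂,
    fun habs => by linarith [abs_pos.2 ha₂]⟩⟩

theorem isDispersive_iff_of_a₂_eq (h : c .a₂ = 2 * c .a₁) : c.IsDispersive ↔ c .a₁ ≠ 0 := by
  rw [IsDispersive, h, abs_mul, abs_two]
  exact ⟨fun hc => hc.1, fun ha₁ => ⟨ha₁, mul_ne_zero two_ne_zero ha₁,
    fun habs => by linarith [abs_pos.2 ha₁]⟩⟩

end QPlus

theorem hasFreeParameters_case1 : HasFreeParameters {c | c.IsDispersive ∧ c.Case1} 9 := by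
  refine hasFreeParameters_of_fixedPoints {.a₁, .a₂, .α₁, .β₁, .γ₁, .γ₂, .ξ₂, .ξ₄, .ζ} (by decide)
    isOpen_isDispersive nonempty_isDispersive QPlus.contDiffOn_completion₁ (fun c j hj => ?_)
    (fun c c' h => ?_) (dependsOn_isDispersive (by simp) (by simp))
    fun c => ?_
  · cases j <;> simp [QPlus.completion₁] at hj ⊢
  · funext j
    cases j <;> simp [QPlus.completion₁, h]
  · exact and_congr_right fun _ => QPlus.completion₁_eq_self_iff.symm

theorem hasFreeParameters_case2 : HasFreeParameters {c | c.IsDispersive ∧ c.Case2} 7 := by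
  refine hasFreeParameters_of_fixedPoints {.a₂, .α₂, .β₁, .γ₂, .ξ₂, .ξ₄, .ζ} (by decide)
    (isOpen_coeff_ne_zero .a₂) (nonempty_coeff_ne_zero .a₂) QPlus.contDiffOn_completion₂
    (fun c j hj => ?_) (fun c c' h => ?_) (dependsOn_coeff_ne_zero (by simp))
    fun c => ?_
  · cases j <;> simp [QPlus.completion₂] at hj ⊢
  · funext j
    cases j <;> simp [QPlus.completion₂, h]
  · rw [Set.mem_ofPred_eq, Set.mem_ofPred_eq,
      and_congr_right fun ha₂ => QPlus.completion₂_eq_self_iff ha₂]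
    exact and_congr_left fun h => QPlus.isDispersive_iff_of_a₁_eq h.2.2.1

theorem hasFreeParameters_case3 : HasFreeParameters {c | c.IsDispersive ∧ c.Case3} 7 := by
  refine hasFreeParameters_of_fixedPoints {.a₁, .α₂, .β₁, .γ₁, .ξ₂, .ξ₄, .ζ} (by decide)
    (isOpen_coeff_ne_zero .a₁) (nonempty_coeff_ne_zero .a₁) QPlus.contDiffOn_completion₃
    (fun c j hj => ?_) (fun c c' h => ?_) (dependsOn_coeff_ne_zero (by simp))
    fun c => ?_
  · cases j <;> simp [QPlus.completion₃] at hj ⊢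
  · funext j
    cases j <;> simp [QPlus.completion₃, h]
  · rw [Set.mem_ofPred_eq, Set.mem_ofPred_eq,
      and_congr_right fun ha₁ => QPlus.completion₃_eq_self_iff ha₁]
    exact and_congr_left fun h => QPlus.isDispersive_iff_of_a₂_eq h.2.2.1

theorem hasFreeParameters_case4 : HasFreeParameters {c | c.IsDispersive ∧ c.Case4} 8 := by
  refine hasFreeParameters_of_fixedPoints {.a₁, .a₂, .α₂, .β₂, .γ₂, .ξ₂, .ξ₄, .ζ} (by decide)
    isOpen_isDispersive nonempty_isDispersive QPlus.contDiffOn_completion₄ (fun c j hj => ?_)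
    (fun c c' h => ?_) (dependsOn_isDispersive (by simp) (by simp))
    fun c => ?_
  · cases j <;> simp [QPlus.completion₄] at hj ⊢
  · funext j
    cases j <;> simp [QPlus.completion₄, h]
  · exact and_congr_right fun hc => (QPlus.completion₄_eq_self_iff hc).symm

theorem hasFreeParameters_case5 : HasFreeParameters {c | c.IsDispersive ∧ c.Case5} 8 := by
  refine hasFreeParameters_of_fixedPoints {.a₁, .a₂, .α₂, .γ₁, .γ₂, .ξ₂, .ξ₄, .ζ} (by decide)
    isOpen_isDispersive nonempty_isDispersive QPlus.contDiffOn_completion₅ (fun c j hj => ?_)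
    (fun c c' h => ?_) (dependsOn_isDispersive (by simp) (by simp))
    fun c => ?_
  · cases j <;> simp [QPlus.completion₅] at hj ⊢
  · funext j
    cases j <;> simp [QPlus.completion₅, h]
  · exact and_congr_right fun hc => (QPlus.completion₅_eq_self_iff hc).symm

theorem hasFreeParameters_case6 : HasFreeParameters {c | c.IsDispersive ∧ c.Case6} 8 := by
  refine hasFreeParameters_of_fixedPoints {.a₁, .a₂, .α₂, .γ₁, .γ₂, .ξ₂, .ξ₄, .ζ} (by decide)
    isOpen_isDispersive nonempty_isDispersive QPlus.contDiffOn_completion₆ (fun c j hj => ?_)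
    (fun c c' h => ?_) (dependsOn_isDispersive (by simp) (by simp))
    fun c => ?_
  · cases j <;> simp [QPlus.completion₆] at hj ⊢
  · funext j
    cases j <;> simp [QPlus.completion₆, h]
  · exact and_congr_right fun hc => (QPlus.completion₆_eq_self_iff hc).symm

theorem hasFreeParameters_family (i : Fin 6) : HasFreeParameters (family i) (numFree i) := by
  fin_cases i
  · exact hasFreeParameters_case1
  · exact hasFreeParameters_case2
  · exact hasFreeParameters_case3
  · exact hasFreeParameters_case4
  · exact hasFreeParameters_case5
  · exact hasFreeParameters_case6

end FreeParameters

end Multiscale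

end

open Multiscale in
theorem mainTheorem1 :
    -- the order `ε³` of the expansion is an NLS equation, and its nonlinear coefficient is real
    -- for all wave numbers exactly for the equations in the six families
    (∀ c : QPlus, c.IsDispersive →
      (∃ ω, c.IsDispersionRelation ω) ∧
      ∀ ω, c.IsDispersionRelation ω →
        (∀ κ, c.NonResonant ω κ → ∃! ρ : ℂ × ℂ, c.ReducesToNLS ω κ ρ.1 ρ.2) ∧
        (∀ κ, c.NonResonant ω κ → ∀ ρ₁ ρ₂ : ℂ, c.ReducesToNLS ω κ ρ₁ ρ₂ →
          ρ₁ = ((c .a₁ * c .a₂ * (c .a₁ ^ 2 - c .a₂ ^ 2) * Real.sin κ /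
            (c .a₁ ^ 2 + c .a₂ ^ 2 + 2 * c .a₁ * c .a₂ * Real.cos κ) ^ 2 : ℝ) : ℂ) ∧
          -- bounded amplitudes: `u_2^{(1)}` depends on `ξ`, and `u_1^{(1)}` solves the NLS equation
          ∀ u : Amplitudes, u.Admissible → u.Bounded →
            (∀ α, c.W κ (ω κ) u 1 α = 0) → (∀ α, c.W κ (ω κ) u 2 α = 0) →
            c.W κ (ω κ) u 3 1 = 0 →
            (∃ ψ, HasProfile (deriv ω κ) (u 2 1) ψ) ∧
            ∃ φ, HasProfile (deriv ω κ) (u 1 1) φ ∧ ∀ x t, nls ρ₁ ρ₂ φ x t = 0) ∧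
        ((∀ κ, c.NonResonant ω κ → ∀ ρ₁ ρ₂ : ℂ, c.ReducesToNLS ω κ ρ₁ ρ₂ → ρ₂.im = 0) ↔
          c.Case1 ∨ c.Case2 ∨ c.Case3 ∨ c.Case4 ∨ c.Case5 ∨ c.Case6)) ∧
    -- numbers of free parameters
    (∀ i, HasFreeParameters (family i) (numFree i)) ∧
    -- invariance under the restricted Möbius transformations
    (∀ C D : ℝ, D ≠ 0 →
      (∀ c : QPlus, ∃! c' : QPlus, IsMobiusImage C D c c') ∧
      ∀ c c' : QPlus, IsMobiusImage C D c c' → ∀ i, c ∈ family i ↔ c' ∈ family i) := by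
  refine ⟨fun c hc => ⟨hc.exists_dispersionRelation, fun ω hω => ?_⟩, hasFreeParameters_family,
    fun C D hD => ⟨fun c => ⟨c.mobius C D, c.isMobiusImage_mobius C D, fun c' h => h.eq_mobius hD⟩,
      fun c c' h i => h.eq_mobius hD ▸ (QPlus.mobius_mem_family_iff hD i).symm⟩⟩
  have hred {κ : ℝ} (hκ : c.NonResonant ω κ) :
      c.ReducesToNLS ω κ (c.nlsDispersion ω κ) (c.nlsNonlinearity ω κ) :=
    QPlus.reducesToNLS_nlsDispersion_nlsNonlinearity hc hω hκ
  have huniq {κ : ℝ} (hκ : c.NonResonant ω κ) {ρ₁ ρ₂ : ℂ} (hρ : c.ReducesToNLS ω κ ρ₁ ρ₂) :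
      ρ₁ = c.nlsDispersion ω κ ∧ ρ₂ = c.nlsNonlinearity ω κ :=
    QPlus.ReducesToNLS.unique hc hω hκ hρ (hred hκ)
  refine ⟨fun κ hκ => ⟨(c.nlsDispersion ω κ, c.nlsNonlinearity ω κ), hred hκ,
    fun ρ hρ => Prod.ext_iff.2 (huniq hκ hρ)⟩, fun κ hκ ρ₁ ρ₂ hρ => ?_, ?_⟩
  · obtain ⟨rfl, rfl⟩ := huniq hκ hρ
    exact ⟨QPlus.nlsDispersion_eq hc hω, fun u hu hb hW₁ hW₂ hW₃ =>
      QPlus.hasProfile_of_bounded hc hω hκ hu hb hW₁ hW₂ hW₃⟩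
  · rw [← QPlus.forall_nlsNonlinearity_im_eq_zero_iff hc hω]
    exact forall₂_congr fun κ hκ => ⟨fun h => h _ _ (hred hκ),
      fun h ρ₁ ρ₂ hρ => (huniq hκ hρ).2 ▸ h⟩
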